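/- **Setting.** Let $d\ge 1$, $a_1,\dots,a_m\in\mathbb R^d\setminus\{0\}$, $b\in\mathbb R^m$, and let $\mathcal K=\{w\in\mathbb R^d:\ a_i^\top w\ge b_i,\ i=1,\dots,m\}$ have nonempty interior and satisfy $\mathcal K\subseteq\{w:\|w\|\le R\}$ with $R>0$. Let $\Psi(w)=-\sum_{i=1}^m\log(a_i^\top w-b_i)$ be the log barrier of $\mathcal K$, let $\Phi(w)=\Psi(w)+\frac{m}{2R^2}\|w\|^2$ on $\operatorname{int}\mathcal K$, and let $w^\star$ be the minimizer of $\Phi$. Write $\|v\|_M=\sqrt{v^\top Mv}$ and $\nabla^{-2}\Phi=(\nabla^2\Phi)^{-1}$. A $C^3$ convex function $f$ on $\operatorname{int}\mathcal K$ that tends to $+\infty$ at the boundary of $\mathcal K$ and satisfies $|\nabla^3f(x)[u,u,u]|\le 2M\|u\|_{\nabla^2f(x)}^3$ and $\nabla f(x)^\top\nabla^{-2}f(x)\nabla f(x)\le\nu$ (with $\nabla^2 f(x)$ positive definite) for all $x\in\operatorname{int}\mathcal K$, $u\in\mathbb R^d$ is called an $(M,\nu)$-self-concordant barrier for $\mathcal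 K$. **Algorithm (BARONS with $\Phi$ and $M=1$).** Let $G>0$, let $T\ge 1$ be an integer, and put $\eta=\frac{m}{RG}\sqrt{\frac{\log T+1}{T}}$, $\varepsilon=\sqrt{m/T}$, $\alpha=0.001$; let $N\ge 1$ be an integer. A gradient oracle returns, for $w\in\operatorname{int}\mathcal K$, some vector $\widehat\nabla$ with $\|\widehat\nabla-\nabla\Phi(w)\|_{\nabla^{-2}\Phi(w)}\le\varepsilon$. A Hessian oracle returns, for $w\in\operatorname{int}\mathcal K$, some invertible symmetric $H$ (and $H^{-1}$) with $(1-\alpha)\nabla^2\Phi(w)\preceq H\preceq(1+\alpha)\nabla^2\Phi(w)$ and $(1-\alpha)\nabla^{-2}\Phi(w)\preceq H^{-1}\preceq(1+\alpha)\nabla^{-2}\Phi(w)$. Start with $u_1=w_1=w^\star$, $s_0=0$, and $H_1$ the Hessian oracle's answer at $w^\star$. In round $t=1,\dots,T$, play $w_t$, observe $g_t$, and set $s_t=s_{t-1}+\eta g_t$. Starting from $w_t$, perform $N-1$ steps $w\leftarrow w-H_t^{-1}(\widehat\nabla+s_t)$, each with a fresh answer $\widehat\nabla$ of the gradient oracle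 at the current $w$; the result is $w_{t+1}$. If $\|w_{t+1}-u_t\|_{H_t}\le\frac1{41}$, keep $u_{t+1}=u_t$ and $H_{t+1}=H_t$; otherwise set $u_{t+1}=w_{t+1}$ and let $H_{t+1}$ be the Hessian oracle's answer at $u_{t+1}$. Let $\ell_1,\dots,\ell_T:\mathcal K\to\mathbb R$ be convex losses (possibly chosen adaptively), $g_t\in\partial\ell_t(w_t)$ and $\|g_t\|\le G$ for all $t$. Assume that $T$ is large enough that $$\eta\le\frac{1}{1000\,b}\ \text{ with }\ b=\frac{RG}{\sqrt m},\qquad\text{and}\qquad \varepsilon\le\frac1{20000},$$ and that $N=\Theta(\log\frac1\varepsilon)$, that is, $c_0\log\frac1\varepsilon\le N\le c_1\log\frac1\varepsilon$. **Claim.** $\Psi$ is a $(1,m)$-self-concordant barrier for $\mathcal K$, and there is a universal constant $c_0>0$ such that the following holds. 1. (Regret.) There is a universal constant $C$ such that, whatever the answers of the oracles within their tolerances (and with only $N\ge c_0\log\frac1\varepsilon$ assumed of $N$), all $w_t$ lie in $\operatorname{int}\mathcal K$ and $$\sum_{t=1}^T\bigl(\ell_t(w_t)-\ell_t(w)\bigr)\le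 C\,RG\sqrt{T\log T}\qquad\text{for all } w\in\operatorname{int}\mathcal K.$$ 2. (Computational cost.) Count constants, arithmetic operations $+,-,\times,\div$ and comparisons of real numbers as one step each (algebraic computation trees). Let $\omega$ be any real number such that real $n\times n$ matrices can be multiplied in $O(n^\omega)$ steps, and let $c_1\in\mathbb R$. Then there are constants $C',k$ depending only on $\omega$ and $c_1$ such that for all $d,m,N$ there is an algorithm, taking $(a_i),b,w^\star,R,\eta$ as input and then reading $g_1,g_2,\dots$ online, which carries out BARONS (its iterates are those of an execution of BARONS with admissible oracle answers, for every sequence of vectors $g_t$ with $\|g_t\|\le G$) in at most $$C'\,(1+\log T+\log d)^k\Bigl((md+d^2)\,T+m\,d^{\omega-1}\sqrt{mT}\Bigr)$$ steps in total over the $T$ rounds, that is, in $\widetilde O\bigl((md+d^2)T+md^{\omega-1}\sqrt{mT}\bigr)$ steps. -/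

import Mathlib

/-! ### Polytopes, derivatives in coordinates, local norms -/

/-- The polytope `{w | ⟪a i, w⟫ ≥ b i for all i}` in `ℝ^d`. -/
def polytope {d m : ℕ} (a : Fin m → EuclideanSpace ℝ (Fin d)) (b : Fin m → ℝ) :
    Set (EuclideanSpace ℝ (Fin d)) :=
  {w | ∀ i, b i ≤ inner ℝ (a i) w}

/-- The Hessian matrix of second partial derivatives of `f` at `w`. -/
noncomputable def hessian {d : ℕ} (f : EuclideanSpace ℝ (Fin d) → ℝ)
    (w : EuclideanSpace ℝ (Fin d)) : Matrix (Fin d) (Fin d) ℝ :=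
  Matrix.of fun i j =>
    fderiv ℝ (fun x => fderiv ℝ f x (EuclideanSpace.single j (1 : ℝ))) w
      (EuclideanSpace.single i (1 : ℝ))

/-- The (semi)norm `‖v‖_M = √(vᵀ M v)` of a positive semidefinite matrix `M`. -/
noncomputable def matNorm {d : ℕ} (M : Matrix (Fin d) (Fin d) ℝ)
    (v : EuclideanSpace ℝ (Fin d)) : ℝ :=
  √(v.ofLp ⬝ᵥ M.mulVec v.ofLp)

/-- Matrix-vector product as a map on Euclidean space. -/
noncomputable def matVec {d : ℕ} (M : Matrix (Fin d) (Fin d) ℝ)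
    (v : EuclideanSpace ℝ (Fin d)) : EuclideanSpace ℝ (Fin d) :=
  WithLp.toLp 2 (M.mulVec v.ofLp)

/-- The logarithmic barrier `w ↦ -∑ i, log (⟪a i, w⟫ - b i)` of a polytope. -/
noncomputable def logBarrier {d m : ℕ} (a : Fin m → EuclideanSpace ℝ (Fin d)) (b : Fin m → ℝ)
    (w : EuclideanSpace ℝ (Fin d)) : ℝ :=
  -∑ i, Real.log (inner ℝ (a i) w - b i)

/-- The hybrid regularizer `Ψ + ν / (2 R²) ‖·‖²`. -/
noncomputable def hybrid {d : ℕ} (Ψ : EuclideanSpace ℝ (Fin d) → ℝ) (ν R : ℝ)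
    (w : EuclideanSpace ℝ (Fin d)) : ℝ :=
  Ψ w + ν / (2 * R ^ 2) * ‖w‖ ^ 2

/-! ### Self-concordant barriers -/

/-- `f` is a self-concordant function over `K` (a function on the interior of `K`)
with constant `M`. -/
structure IsSelfConcordant {d : ℕ} (K : Set (EuclideanSpace ℝ (Fin d)))
    (f : EuclideanSpace ℝ (Fin d) → ℝ) (M : ℝ) : Prop where
  convex : ConvexOn ℝ (interior K) f
  smooth : ContDiffOn ℝ 3 f (interior K)
  blowup : ∀ x ∈ frontier K, Filter.Tendsto f (nhdsWithin x (interior K)) Filter.atTop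
  third : ∀ x ∈ interior K, ∀ u : EuclideanSpace ℝ (Fin d),
    |iteratedFDeriv ℝ 3 f x (fun _ => u)| ≤ 2 * M * matNorm (hessian f x) u ^ 3

/-- `f` is an `(M, ν)`-self-concordant barrier for `K`. The Hessian is required to be positive
definite, so that its inverse is meaningful. -/
structure IsSelfConcordantBarrier {d : ℕ} (K : Set (EuclideanSpace ℝ (Fin d)))
    (f : EuclideanSpace ℝ (Fin d) → ℝ) (M ν : ℝ) : Prop where
  selfConcordant : IsSelfConcordant K f M
  posDef : ∀ x ∈ interior K, (hessian f x).PosDef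
  decrement : ∀ x ∈ interior K,
    (gradient f x).ofLp ⬝ᵥ ((hessian f x)⁻¹).mulVec (gradient f x).ofLp ≤ ν

/-! ### Oracles and the algorithm BARONS -/

/-- `h` is an admissible answer of the gradient oracle with tolerance `ε` at the point `w`. -/
def IsGradAnswer {d : ℕ} (Φ : EuclideanSpace ℝ (Fin d) → ℝ) (ε : ℝ)
    (w h : EuclideanSpace ℝ (Fin d)) : Prop :=
  matNorm (hessian Φ w)⁻¹ (h - gradient Φ w) ≤ ε

/-- `H` (together with its inverse) is an admissible answer of the Hessian oracle with
tolerance `α` at the point `w`. -/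
structure IsHessAnswer {d : ℕ} (Φ : EuclideanSpace ℝ (Fin d) → ℝ) (α : ℝ)
    (w : EuclideanSpace ℝ (Fin d)) (H : Matrix (Fin d) (Fin d) ℝ) : Prop where
  isUnit : IsUnit H.det
  lower : (H - (1 - α) • hessian Φ w).PosSemidef
  upper : ((1 + α) • hessian Φ w - H).PosSemidef
  inv_lower : (H⁻¹ - (1 - α) • (hessian Φ w)⁻¹).PosSemidef
  inv_upper : ((1 + α) • (hessian Φ w)⁻¹ - H⁻¹).PosSemidef

/-- An execution of BARONS over `T` rounds, with a regularizer `Φ` on the interior of `K` of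
self-concordance constant `M`, parameters `η ε α mN`, start `wstar`, and observed vectors
`g 0, …, g (T - 1)`. Rounds are numbered from `0`: in round `t` the point `w t` is played and
`g t` is observed. `y t k` is the iterate after `k` of the `mN - 1` intermediate Newton steps of
round `t`, and `h t k` is the gradient oracle's answer at `y t k`. The answers of the oracles are
arbitrary within their tolerance; nothing is required of an answer at a point outside the
interior of `K`. -/
structure BaronsRun {d : ℕ} (K : Set (EuclideanSpace ℝ (Fin d)))
    (Φ : EuclideanSpace ℝ (Fin d) → ℝ) (M η ε α : ℝ) (mN T : ℕ)
    (wstar : EuclideanSpace ℝ (Fin d)) (g : ℕ → EuclideanSpace ℝ (Fin d)) where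
  w : ℕ → EuclideanSpace ℝ (Fin d)
  u : ℕ → EuclideanSpace ℝ (Fin d)
  s : ℕ → EuclideanSpace ℝ (Fin d)
  H : ℕ → Matrix (Fin d) (Fin d) ℝ
  y : ℕ → ℕ → EuclideanSpace ℝ (Fin d)
  h : ℕ → ℕ → EuclideanSpace ℝ (Fin d)
  w_zero : w 0 = wstar
  u_zero : u 0 = wstar
  s_zero : s 0 = 0
  H_zero : wstar ∈ interior K → IsHessAnswer Φ α wstar (H 0)
  s_succ : ∀ t < T, s (t + 1) = s t + η • g t
  y_zero : ∀ t < T, y t 0 = w t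
  h_spec : ∀ t < T, ∀ k < mN - 1, y t k ∈ interior K → IsGradAnswer Φ ε (y t k) (h t k)
  y_succ : ∀ t < T, ∀ k < mN - 1, y t (k + 1) = y t k - matVec (H t)⁻¹ (h t k + s (t + 1))
  w_succ : ∀ t < T, w (t + 1) = y t (mN - 1)
  keep : ∀ t < T, matNorm (H t) (w (t + 1) - u t) ≤ 1 / (41 * M) →
    u (t + 1) = u t ∧ H (t + 1) = H t
  renew : ∀ t < T, ¬ matNorm (H t) (w (t + 1) - u t) ≤ 1 / (41 * M) →
    u (t + 1) = w (t + 1) ∧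
      (w (t + 1) ∈ interior K → IsHessAnswer Φ α (w (t + 1)) (H (t + 1)))

/-- `g` is a subgradient at `x` of the function `f` on `K`. -/
def IsSubgradient {d : ℕ} (K : Set (EuclideanSpace ℝ (Fin d)))
    (f : EuclideanSpace ℝ (Fin d) → ℝ) (x g : EuclideanSpace ℝ (Fin d)) : Prop :=
  ∀ z ∈ K, f x + inner ℝ g (z - x) ≤ f z

/-- The step size `ν / (R G) * √((log T + 1) / T)`. -/
noncomputable def stepSize (ν R G : ℝ) (T : ℕ) : ℝ :=
  ν / (R * G) * √((Real.log T + 1) / T)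

/-- The gradient tolerance `√(ν / T)`. -/
noncomputable def gradTol (ν : ℝ) (T : ℕ) : ℝ :=
  √(ν / T)

/-! ### Cost model: algebraic computation trees over the reals -/

/-- The arithmetic operations. -/
inductive ArithOp where
  | add
  | sub
  | mul
  | div

/-- The value of an arithmetic operation. -/
noncomputable def ArithOp.apply : ArithOp → ℝ → ℝ → ℝ
  | .add, x, y => x + y
  | .sub, x, y => x - y
  | .mul, x, y => x * y
  | .div, x, y => x / y

/-- The values indexed by `ι` that are available so far, extended by a new value `c`. -/
def pushVal {ι : Type} (x : ι → ℝ) (c : ℝ) : Option ι → ℝ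
  | none => c
  | some i => x i

/-- Algebraic computation trees whose available values are indexed by `ι` and whose outputs are
indexed by `o`. A tree can introduce a constant, apply an arithmetic operation to two available
values (either adds one available value), branch on a comparison of two available values, or stop
and declare which of the available values are its outputs. -/
inductive ArithTree : Type → Type → Type 1 where
  | ret {ι o : Type} (out : o → ι) : ArithTree ι o
  | const {ι o : Type} (c : ℝ) (next : ArithTree (Option ι) o) : ArithTree ι o
  | op {ι o : Type} (f : ArithOp) (i j : ι) (next : ArithTree (Option ι) o) : ArithTree ι o
  | branch {ι o : Type} (i j : ι) (yes no : ArithTree ι o) : ArithTree ι o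

/-- The outputs of a computation tree on the input `x`. -/
noncomputable def ArithTree.eval : {ι o : Type} → ArithTree ι o → (ι → ℝ) → o → ℝ
  | _, _, .ret out, x => fun k => x (out k)
  | _, _, .const c next, x => next.eval (pushVal x c)
  | _, _, .op f i j next, x => next.eval (pushVal x (f.apply (x i) (x j)))
  | _, _, .branch i j yes no, x =>
      open scoped Classical in if x i ≤ x j then yes.eval x else no.eval x

/-- The number of steps (constants, arithmetic operations, comparisons) that a computation tree
performs on the input `x`. -/
noncomputable def ArithTree.cost : {ι o : Type} → ArithTree ι o → (ι → ℝ) → ℕ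
  | _, _, .ret _, _ => 0
  | _, _, .const c next, x => next.cost (pushVal x c) + 1
  | _, _, .op f i j next, x => next.cost (pushVal x (f.apply (x i) (x j))) + 1
  | _, _, .branch i j yes no, x =>
      (open scoped Classical in if x i ≤ x j then yes.cost x else no.cost x) + 1

/-- The entries of a pair of `n × n` matrices, as inputs of a computation tree. -/
def matPairVal {n : ℕ} (A B : Matrix (Fin n) (Fin n) ℝ) :
    (Fin n × Fin n) ⊕ (Fin n × Fin n) → ℝ
  | .inl p => A p.1 p.2
  | .inr p => B p.1 p.2

/-- `ω` is an admissible exponent of matrix multiplication: real `n × n` matrices can be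
multiplied in `O(n ^ ω)` steps. -/
def IsMatMulExponent (ω : ℝ) : Prop :=
  ∃ C : ℝ, ∀ n : ℕ, 1 ≤ n →
    ∃ P : ArithTree ((Fin n × Fin n) ⊕ (Fin n × Fin n)) (Fin n × Fin n),
      ∀ A B : Matrix (Fin n) (Fin n) ℝ,
        (∀ i j, P.eval (matPairVal A B) (i, j) = (A * B) i j) ∧
        (P.cost (matPairVal A B) : ℝ) ≤ C * (n : ℝ) ^ ω

/-- The names of the inputs of an online algorithm over a polytope. -/
inductive InputName (d m : ℕ) where
  | normal (i : Fin m) (j : Fin d)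
  | offset (i : Fin m)
  | start (j : Fin d)
  | radius
  | step

/-- The values of the inputs. -/
def inputVal {d m : ℕ} (a : Fin m → EuclideanSpace ℝ (Fin d)) (b : Fin m → ℝ)
    (wstar : EuclideanSpace ℝ (Fin d)) (R η : ℝ) : InputName d m → ℝ
  | .normal i j => a i j
  | .offset i => b i
  | .start j => wstar j
  | .radius => R
  | .step => η

/-- An online algorithm in the computation tree model. Its memory is a finite family of reals
indexed by `σ`. The tree `init` computes the initial memory from the inputs; in every round the
point stored at the addresses `play` is played, the vector `g` is observed, and the tree `round`
computes the new memory from the old one and `g`. -/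
structure OnlineAlg (d m : ℕ) where
  σ : Type
  fin : Finite σ
  init : ArithTree (InputName d m) σ
  round : ArithTree (σ ⊕ Fin d) σ
  play : Fin d → σ

/-- The memory at the beginning of round `t` on the input `x` and the observations `g`. -/
noncomputable def OnlineAlg.state {d m : ℕ} (P : OnlineAlg d m) (x : InputName d m → ℝ)
    (g : ℕ → EuclideanSpace ℝ (Fin d)) : ℕ → P.σ → ℝ
  | 0 => P.init.eval x
  | t + 1 => P.round.eval (Sum.elim (P.state x g t) (g t).ofLp)

/-- The point played in round `t`. -/
noncomputable def OnlineAlg.iterate {d m : ℕ} (P : OnlineAlg d m) (x : InputName d m → ℝ)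
    (g : ℕ → EuclideanSpace ℝ (Fin d)) (t : ℕ) : EuclideanSpace ℝ (Fin d) :=
  WithLp.toLp 2 fun j => P.state x g t (P.play j)

/-- The number of steps performed in the initialization and in the first `T` rounds. -/
noncomputable def OnlineAlg.totalCost {d m : ℕ} (P : OnlineAlg d m) (x : InputName d m → ℝ)
    (g : ℕ → EuclideanSpace ℝ (Fin d)) (T : ℕ) : ℕ :=
  P.init.cost x + ∑ t ∈ Finset.range T, P.round.cost (Sum.elim (P.state x g t) (g t).ofLp)

/-! ### Matrices as quadratic forms on Euclidean space -/

section LinearAlgebra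

variable {d : ℕ}

/-! All estimates come from explicit formulas for the barrier rather than from the general theory of
self-concordant functions. Write ρ = m/R² and let s_i denote the slacks. Since 1/s − 1/s' = (s' −
s)/(s s'), the identity ∇Φ(y) − ∇Φ(w) = A(y − w) holds exactly with A = Σ a_i a_iᵀ/(s_i(w) s_i(y)) +
ρI (`barrierGrad_sub`). If w and y are within 0.03 of the reference point u in the norm of the
Hessian answer H at u, every slack is within about 3% of its value at u, so A − H is at most 0.1·H
as a quadratic form (`barrierSecant_near`).

Hence a Newton step with frozen H multiplies the residual ∇Φ(w) + s by 0.1, up to the oracle error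
(`residual_newton_step`). A new loss gradient perturbs the residual by O(τ), τ = ηRG/√m, because ∇²Φ
dominates ρI (`matNorm_inv_le_norm`). About log(1/ε) steps bring the residual back to 2ε while
moving the point by at most 5(ε + τ) (`newton_round`). This gives the invariant `BaronsInv`,
whatever the oracles answer.

Regret: the potential Φ(z) − Φ(w_t) + ⟨s_t, z − w_t⟩ telescopes, and each round costs O((ε + τ)²),
since the Bregman divergence is quadratically small for close points (`linear_regret_le`). The last
iterate is only an approximate minimizer; its residual is absorbed because the divergence grows at
least linearly far away (`neg_le_bregman_add_inner`). The comparator is pulled by a fraction 1/T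
towards w*, so its regularization is at most m log T + m/2 and the loss incurred is O(RG). Since T(ε
+ τ)² = O(m log T), division by η gives the bound.

Cost: the implementation uses exact gradients and stores only X = H⁻¹ and p = H(w − u), so that the
keep test is one inner product. On renewal the Hessian is assembled from ⌊m/d⌋ + 1 products of d × d
blocks. No matrix is inverted: the old X is still within 10% of the new inverse, and two
Newton–Schulz steps reduce the error to 10⁻⁴ (`renew_hessAnswer`). The first inverse is built by m
Sherman–Morrison updates. A renewal requires a displacement of more than 1/41 accumulated in moves
of 5(ε + τ), so there are at most 205·T(ε + τ) = O(√(mT) log T) of them (`renewals_le`).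

Self-concordance of Ψ follows from the ratios r_i = ⟨a_i, u⟩/s_i: one has |Σ r_i³| ≤ (Σ r_i²)^{3/2},
and Cauchy–Schwarz over the m constraints bounds the decrement. -/

theorem matVec_add (M : Matrix (Fin d) (Fin d) ℝ) (x y : EuclideanSpace ℝ (Fin d)) :
    matVec M (x + y) = matVec M x + matVec M y := by
  simp [matVec, Matrix.mulVec_add]

theorem matVec_sub (M : Matrix (Fin d) (Fin d) ℝ) (x y : EuclideanSpace ℝ (Fin d)) :
    matVec M (x - y) = matVec M x - matVec M y := by
  simp [matVec, Matrix.mulVec_sub]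

theorem matVec_neg (M : Matrix (Fin d) (Fin d) ℝ) (x : EuclideanSpace ℝ (Fin d)) :
    matVec M (-x) = -matVec M x := by
  simp [matVec, Matrix.mulVec_neg]

theorem matVec_smul (M : Matrix (Fin d) (Fin d) ℝ) (c : ℝ) (x : EuclideanSpace ℝ (Fin d)) :
    matVec M (c • x) = c • matVec M x := by
  simp [matVec, Matrix.mulVec_smul]

theorem matVec_zero (M : Matrix (Fin d) (Fin d) ℝ) : matVec M 0 = 0 := by
  simp [matVec]

theorem add_matVec (M N : Matrix (Fin d) (Fin d) ℝ) (x : EuclideanSpace ℝ (Fin d)) :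
    matVec (M + N) x = matVec M x + matVec N x := by
  simp [matVec, Matrix.add_mulVec]

theorem sub_matVec (M N : Matrix (Fin d) (Fin d) ℝ) (x : EuclideanSpace ℝ (Fin d)) :
    matVec (M - N) x = matVec M x - matVec N x := by
  simp [matVec, Matrix.sub_mulVec]

theorem smul_matVec (M : Matrix (Fin d) (Fin d) ℝ) (c : ℝ) (x : EuclideanSpace ℝ (Fin d)) :
    matVec (c • M) x = c • matVec M x := by
  simp [matVec, Matrix.smul_mulVec]

theorem mul_matVec (M N : Matrix (Fin d) (Fin d) ℝ) (x : EuclideanSpace ℝ (Fin d)) :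
    matVec (M * N) x = matVec M (matVec N x) := by
  simp [matVec, Matrix.mulVec_mulVec]

theorem one_matVec (x : EuclideanSpace ℝ (Fin d)) :
    matVec (1 : Matrix (Fin d) (Fin d) ℝ) x = x := by
  simp [matVec]

theorem inner_eq_dotProduct (x y : EuclideanSpace ℝ (Fin d)) :
    inner ℝ x y = x.ofLp ⬝ᵥ y.ofLp := by
  simp [PiLp.inner_apply, dotProduct, mul_comm]

/-- The quadratic form `vᵀ M v`. -/
noncomputable def quad (M : Matrix (Fin d) (Fin d) ℝ) (v : EuclideanSpace ℝ (Fin d)) : ℝ :=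
  inner ℝ v (matVec M v)

theorem quad_eq (M : Matrix (Fin d) (Fin d) ℝ) (v : EuclideanSpace ℝ (Fin d)) :
    quad M v = v.ofLp ⬝ᵥ M.mulVec v.ofLp :=
  inner_eq_dotProduct _ _

theorem matNorm_eq (M : Matrix (Fin d) (Fin d) ℝ) (v : EuclideanSpace ℝ (Fin d)) :
    matNorm M v = √(quad M v) := by
  rw [quad_eq, matNorm]

theorem matNorm_nonneg (M : Matrix (Fin d) (Fin d) ℝ) (v : EuclideanSpace ℝ (Fin d)) :
    0 ≤ matNorm M v := Real.sqrt_nonneg _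

theorem matNorm_zero (M : Matrix (Fin d) (Fin d) ℝ) : matNorm M 0 = 0 := by
  simp [matNorm_eq, quad]

theorem matNorm_neg (M : Matrix (Fin d) (Fin d) ℝ) (v : EuclideanSpace ℝ (Fin d)) :
    matNorm M (-v) = matNorm M v := by
  simp [matNorm_eq, quad, matVec_neg]

theorem matNorm_sub_comm (M : Matrix (Fin d) (Fin d) ℝ) (x y : EuclideanSpace ℝ (Fin d)) :
    matNorm M (x - y) = matNorm M (y - x) := by
  rw [← matNorm_neg, neg_sub]

theorem quad_sub (M N : Matrix (Fin d) (Fin d) ℝ) (v : EuclideanSpace ℝ (Fin d)) :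
    quad (M - N) v = quad M v - quad N v := by
  simp [quad, sub_matVec, inner_sub_right]

theorem quad_smul (M : Matrix (Fin d) (Fin d) ℝ) (c : ℝ) (v : EuclideanSpace ℝ (Fin d)) :
    quad (c • M) v = c * quad M v := by
  simp [quad, smul_matVec, inner_smul_right]

theorem inner_matVec_comm {M : Matrix (Fin d) (Fin d) ℝ} (hM : M.IsHermitian)
    (x y : EuclideanSpace ℝ (Fin d)) : inner ℝ x (matVec M y) = inner ℝ (matVec M x) y := by
  have hT : M.transpose = M := by rw [← Matrix.conjTranspose_eq_transpose_of_trivial, hM.eq]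
  rw [inner_eq_dotProduct, inner_eq_dotProduct, matVec, matVec, Matrix.dotProduct_mulVec]
  simp only
  rw [← Matrix.mulVec_transpose, hT]

theorem posSemidef_iff_quad {M : Matrix (Fin d) (Fin d) ℝ} :
    M.PosSemidef ↔ M.IsHermitian ∧ ∀ v, 0 ≤ quad M v := by
  rw [Matrix.posSemidef_iff_dotProduct_mulVec]
  refine and_congr_right fun _ => ⟨fun h v => ?_, fun h v => ?_⟩
  · simpa [quad_eq] using h v.ofLp
  · simpa [quad_eq] using h (WithLp.toLp 2 v)

theorem posDef_iff_quad {M : Matrix (Fin d) (Fin d) ℝ} :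
    M.PosDef ↔ M.IsHermitian ∧ ∀ v, v ≠ 0 → 0 < quad M v := by
  rw [Matrix.posDef_iff_dotProduct_mulVec]
  refine and_congr_right fun _ => ⟨fun h v hv => ?_, fun h v hv => ?_⟩
  · simpa [quad_eq] using h (x := v.ofLp) (by simpa using hv)
  · simpa [quad_eq] using h (WithLp.toLp 2 v) (by simpa using hv)

theorem Matrix.PosSemidef.quad_nonneg {M : Matrix (Fin d) (Fin d) ℝ} (hM : M.PosSemidef)
    (v : EuclideanSpace ℝ (Fin d)) : 0 ≤ quad M v :=
  (posSemidef_iff_quad.1 hM).2 v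

theorem matNorm_sq {M : Matrix (Fin d) (Fin d) ℝ} (hM : M.PosSemidef)
    (v : EuclideanSpace ℝ (Fin d)) : matNorm M v ^ 2 = quad M v := by
  rw [matNorm_eq, Real.sq_sqrt (hM.quad_nonneg v)]

theorem posSemidef_sub_iff {M N : Matrix (Fin d) (Fin d) ℝ} (hM : M.IsHermitian)
    (hN : N.IsHermitian) : (M - N).PosSemidef ↔ ∀ v, quad N v ≤ quad M v := by
  rw [posSemidef_iff_quad]
  simp only [quad_sub, sub_nonneg]
  exact ⟨fun h => h.2, fun h => ⟨hM.sub hN, h⟩⟩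

theorem Matrix.IsHermitian.real_smul {M : Matrix (Fin d) (Fin d) ℝ} (hM : M.IsHermitian) (c : ℝ) :
    (c • M).IsHermitian := by
  rw [Matrix.IsHermitian, Matrix.conjTranspose_smul, hM.eq]; simp

/-- Cauchy–Schwarz for a possibly degenerate form: the polynomial t ↦ (x + ty)ᵀM(x + ty) is
nonnegative, so its discriminant is not positive. -/
theorem abs_inner_matVec_le {M : Matrix (Fin d) (Fin d) ℝ} (hM : M.PosSemidef)
    (x y : EuclideanSpace ℝ (Fin d)) :
    |inner ℝ x (matVec M y)| ≤ matNorm M x * matNorm M y := by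
  have key : ∀ t : ℝ, 0 ≤ quad M y * (t * t) + 2 * inner ℝ x (matVec M y) * t + quad M x := by
    intro t
    have h := hM.quad_nonneg (x + t • y)
    have hs : inner ℝ y (matVec M x) = inner ℝ x (matVec M y) := by
      rw [inner_matVec_comm hM.1, real_inner_comm]
    have e : quad M (x + t • y)
        = quad M y * (t * t) + 2 * inner ℝ x (matVec M y) * t + quad M x := by
      simp only [quad, matVec_add, matVec_smul, inner_add_left, inner_add_right, inner_smul_left,
        inner_smul_right, hs]
      simp
      ring
    linarith
  have hd := discrim_le_zero key
  rw [discrim] at hd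
  rw [matNorm_eq, matNorm_eq, ← Real.sqrt_mul (hM.quad_nonneg x)]
  apply Real.abs_le_sqrt
  nlinarith

theorem matNorm_add_le {M : Matrix (Fin d) (Fin d) ℝ} (hM : M.PosSemidef)
    (x y : EuclideanSpace ℝ (Fin d)) : matNorm M (x + y) ≤ matNorm M x + matNorm M y := by
  have h0 := matNorm_nonneg M x
  have h1 := matNorm_nonneg M y
  refine abs_le_of_sq_le_sq' ?_ (by positivity) |>.2
  have h2 := (abs_le.1 (abs_inner_matVec_le hM x y)).2
  have hs : inner ℝ y (matVec M x) = inner ℝ x (matVec M y) := by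
    rw [inner_matVec_comm hM.1, real_inner_comm]
  have e : quad M (x + y) = quad M x + 2 * inner ℝ x (matVec M y) + quad M y := by
    simp only [quad, matVec_add, inner_add_left, inner_add_right, hs]
    ring
  rw [matNorm_sq hM, e, ← matNorm_sq hM x, ← matNorm_sq hM y]
  nlinarith

theorem matNorm_smul {M : Matrix (Fin d) (Fin d) ℝ} (c : ℝ) (x : EuclideanSpace ℝ (Fin d)) :
    matNorm M (c • x) = |c| * matNorm M x := by
  have e : quad M (c • x) = c ^ 2 * quad M x := by
    simp only [quad, matVec_smul, inner_smul_left, inner_smul_right]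
    simp
    ring
  rw [matNorm_eq, matNorm_eq, e, Real.sqrt_mul (sq_nonneg c), Real.sqrt_sq_eq_abs]

theorem matNorm_le_of_quad_le {M N : Matrix (Fin d) (Fin d) ℝ} {c : ℝ} (hc : 0 ≤ c)
    {x : EuclideanSpace ℝ (Fin d)} (h : quad M x ≤ c ^ 2 * quad N x) :
    matNorm M x ≤ c * matNorm N x := by
  rw [matNorm_eq, matNorm_eq]
  calc √(quad M x) ≤ √(c ^ 2 * quad N x) := Real.sqrt_le_sqrt h
    _ = c * √(quad N x) := by rw [Real.sqrt_mul (sq_nonneg c), Real.sqrt_sq hc]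

/-! ### Inverses and dual norms -/

theorem Matrix.PosDef.matVec_inv_matVec {H : Matrix (Fin d) (Fin d) ℝ} (hH : H.PosDef)
    (x : EuclideanSpace ℝ (Fin d)) : matVec H⁻¹ (matVec H x) = x := by
  rw [← mul_matVec, Matrix.nonsing_inv_mul _ ((Matrix.isUnit_iff_isUnit_det _).1 hH.isUnit),
    one_matVec]

theorem Matrix.PosDef.matVec_matVec_inv {H : Matrix (Fin d) (Fin d) ℝ} (hH : H.PosDef)
    (x : EuclideanSpace ℝ (Fin d)) : matVec H (matVec H⁻¹ x) = x := by
  rw [← mul_matVec, Matrix.mul_nonsing_inv _ ((Matrix.isUnit_iff_isUnit_det _).1 hH.isUnit),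
    one_matVec]

theorem quad_inv_matVec {H : Matrix (Fin d) (Fin d) ℝ} (hH : H.PosDef)
    (x : EuclideanSpace ℝ (Fin d)) : quad H⁻¹ (matVec H x) = quad H x := by
  rw [quad, hH.matVec_inv_matVec, quad, inner_matVec_comm hH.1]

theorem quad_matVec_inv {H : Matrix (Fin d) (Fin d) ℝ} (hH : H.PosDef)
    (x : EuclideanSpace ℝ (Fin d)) : quad H (matVec H⁻¹ x) = quad H⁻¹ x := by
  rw [quad, hH.matVec_matVec_inv, quad, inner_matVec_comm hH.inv.1]

theorem matNorm_inv_matVec {H : Matrix (Fin d) (Fin d) ℝ} (hH : H.PosDef)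
    (x : EuclideanSpace ℝ (Fin d)) : matNorm H⁻¹ (matVec H x) = matNorm H x := by
  rw [matNorm_eq, matNorm_eq, quad_inv_matVec hH]

theorem matNorm_matVec_inv {H : Matrix (Fin d) (Fin d) ℝ} (hH : H.PosDef)
    (x : EuclideanSpace ℝ (Fin d)) : matNorm H (matVec H⁻¹ x) = matNorm H⁻¹ x := by
  rw [matNorm_eq, matNorm_eq, quad_matVec_inv hH]

/-- Cauchy–Schwarz for a pair of dual local norms. -/
theorem abs_inner_le_matNorm {H : Matrix (Fin d) (Fin d) ℝ} (hH : H.PosDef)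
    (x y : EuclideanSpace ℝ (Fin d)) :
    |inner ℝ x y| ≤ matNorm H⁻¹ x * matNorm H y := by
  have h := abs_inner_matVec_le hH.inv.posSemidef x (matVec H y)
  rwa [hH.matVec_inv_matVec, matNorm_inv_matVec hH] at h

/-- A symmetric matrix whose quadratic form is dominated by that of `H` is bounded as an operator
from the norm of `H` to the dual norm. -/
theorem matNorm_inv_matVec_le {H B : Matrix (Fin d) (Fin d) ℝ} (hH : H.PosDef)
    (hB : B.IsHermitian) {δ : ℝ} (hδ : ∀ v, |quad B v| ≤ δ * quad H v)
    (x : EuclideanSpace ℝ (Fin d)) :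
    matNorm H⁻¹ (matVec B x) ≤ δ * matNorm H x := by
  have hHs := hH.posSemidef
  -- Polarization: 4pᵀBq is the difference of the forms at p + q and p − q, and the parallelogram
  -- law applies to H.
  have polar : ∀ (p q : EuclideanSpace ℝ (Fin d)),
      2 * inner ℝ p (matVec B q) ≤ δ * (quad H p + quad H q) := by
    intro p q
    have hs : inner ℝ q (matVec B p) = inner ℝ p (matVec B q) := by
      rw [inner_matVec_comm hB, real_inner_comm]
    have hs' : inner ℝ q (matVec H p) = inner ℝ p (matVec H q) := by
      rw [inner_matVec_comm hH.1, real_inner_comm]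
    have h1 := (abs_le.1 (hδ (p + q))).2
    have h2 := (abs_le.1 (hδ (p - q))).1
    simp only [quad, matVec_add, matVec_sub, inner_add_left, inner_add_right, inner_sub_left,
      inner_sub_right, hs, hs'] at h1 h2 ⊢
    linarith
  set z := matVec B x
  set y := matVec H⁻¹ z
  have hzy : matNorm H y = matNorm H⁻¹ z := matNorm_matVec_inv hH z
  have hyz : inner ℝ y z = matNorm H⁻¹ z ^ 2 := by
    rw [matNorm_sq hH.inv.posSemidef, quad, real_inner_comm]
  have hx0 := matNorm_nonneg H x
  have hz0 := matNorm_nonneg H⁻¹ z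
  rcases hx0.eq_or_lt with h0 | hx
  · have hq : quad H x = 0 := by rw [← matNorm_sq hHs, ← h0]; simp
    have hx' : x = 0 := by
      by_contra hne
      exact absurd hq ((posDef_iff_quad.1 hH).2 x hne).ne'
    simp [z, hx', matVec_zero, matNorm_zero]
  · rcases hz0.eq_or_lt with h1 | hz
    · have hδ0 : 0 ≤ δ := by
        have := (abs_nonneg _).trans (hδ x)
        rw [← matNorm_sq hHs] at this
        exact nonneg_of_mul_nonneg_left this (by positivity)
      rw [← h1]; positivity
    -- The dual vector y = H⁻¹z realizes the dual norm of z; both arguments are normalized so that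
    -- the right-hand side becomes 2δ.
    · have h := polar ((1 / matNorm H⁻¹ z) • y) ((1 / matNorm H x) • x)
      have e1 : quad H ((1 / matNorm H⁻¹ z) • y) = 1 := by
        rw [← matNorm_sq hHs, matNorm_smul, hzy, abs_of_pos (by positivity)]
        field_simp
      have e2 : quad H ((1 / matNorm H x) • x) = 1 := by
        rw [← matNorm_sq hHs, matNorm_smul, abs_of_pos (by positivity)]
        field_simp
      have e3 : inner ℝ ((1 / matNorm H⁻¹ z) • y) (matVec B ((1 / matNorm H x) • x))
          = matNorm H⁻¹ z / matNorm H x := by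
        rw [matVec_smul, inner_smul_left, inner_smul_right, hyz]
        simp
        field_simp
      rw [e1, e2, e3] at h
      rw [← div_le_iff₀ hx]
      linarith

/-- Inversion reverses the Loewner order. -/
theorem quad_inv_le {A B : Matrix (Fin d) (Fin d) ℝ} (hA : A.PosDef) (hB : B.PosDef) {c : ℝ}
    (hc : 0 ≤ c) (h : ∀ v, quad A v ≤ c * quad B v) (x : EuclideanSpace ℝ (Fin d)) :
    quad B⁻¹ x ≤ c * quad A⁻¹ x := by
  have h1 := (abs_le.1 (abs_inner_le_matNorm hA x (matVec B⁻¹ x))).2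
  have h2 := h (matVec B⁻¹ x)
  rw [quad_matVec_inv hB] at h2
  change quad B⁻¹ x ≤ _ at h1
  have h3 := matNorm_sq hA.posSemidef (matVec B⁻¹ x)
  have h4 := matNorm_sq hA.inv.posSemidef x
  have hq := hB.inv.posSemidef.quad_nonneg x
  rcases hq.eq_or_lt with h0 | h0
  · rw [← h0, ← h4]; positivity
  -- With p = xᵀB⁻¹x, Cauchy–Schwarz in the norms of A⁻¹ and A and the hypothesis at B⁻¹x give p² ≤
  -- (xᵀA⁻¹x)·cp; one factor p > 0 cancels.
  · have h5 : quad B⁻¹ x ^ 2 ≤ quad A⁻¹ x * (c * quad B⁻¹ x) := by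
      calc quad B⁻¹ x ^ 2 ≤ (matNorm A⁻¹ x * matNorm A (matVec B⁻¹ x)) ^ 2 := by gcongr
        _ = quad A⁻¹ x * quad A (matVec B⁻¹ x) := by rw [mul_pow, h3, h4]
        _ ≤ _ := by gcongr; exact hA.inv.posSemidef.quad_nonneg x
    nlinarith

/-- One Newton–Schulz step for the inverse `H⁻¹` squares the relative error. -/
theorem newtonSchulz {H X : Matrix (Fin d) (Fin d) ℝ} (hH : H.PosDef) (hX : X.IsHermitian)
    {β : ℝ} (h : ∀ v, |quad (H⁻¹ - X) v| ≤ β * quad H⁻¹ v) :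
    ((2 : ℝ) • X - X * (H * X)).IsHermitian ∧
    ∀ v, |quad (H⁻¹ - ((2 : ℝ) • X - X * (H * X))) v| ≤ β ^ 2 * quad H⁻¹ v := by
  have hB : (H⁻¹ - X).IsHermitian := hH.inv.1.sub hX
  have hdet := (Matrix.isUnit_iff_isUnit_det _).1 hH.isUnit
  refine ⟨?_, fun v => ?_⟩
  · refine (hX.real_smul 2).sub ?_
    have := Matrix.isHermitian_mul_mul_conjTranspose X hH.1
    rwa [hX.eq, mul_assoc] at this
  -- The new error is the old error E squared with H in between, so its form at v is the H-form at
  -- Ev.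
  · have e : H⁻¹ - ((2 : ℝ) • X - X * (H * X)) = (H⁻¹ - X) * (H * (H⁻¹ - X)) := by
      rw [mul_sub H, sub_mul, mul_sub, mul_sub, Matrix.mul_nonsing_inv _ hdet,
        ← mul_assoc H⁻¹ H, Matrix.nonsing_inv_mul _ hdet, two_smul]
      simp
      abel
    have e2 : quad (H⁻¹ - ((2 : ℝ) • X - X * (H * X))) v = quad H (matVec (H⁻¹ - X) v) := by
      rw [e, quad, mul_matVec, inner_matVec_comm hB, mul_matVec, quad]
    have h1 := matNorm_inv_matVec_le hH.inv hB h v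
    rw [Matrix.nonsing_inv_nonsing_inv _ hdet] at h1
    rw [e2, abs_of_nonneg (hH.posSemidef.quad_nonneg _), ← matNorm_sq hH.posSemidef,
      ← matNorm_sq hH.inv.posSemidef, ← mul_pow]
    have := matNorm_nonneg H (matVec (H⁻¹ - X) v)
    gcongr

end LinearAlgebra

/-! ### Derivatives of the regularized logarithmic barrier -/

section Barrier

variable {d m : ℕ}

/-- The slack of the `i`-th constraint. -/
noncomputable def slack (a : Fin m → EuclideanSpace ℝ (Fin d)) (b : Fin m → ℝ)
    (w : EuclideanSpace ℝ (Fin d)) (i : Fin m) : ℝ :=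
  inner ℝ (a i) w - b i

/-- The matrix `∑ i, c i • a i (a i)ᵀ + ρ • 1`. -/
noncomputable def weightMat (a : Fin m → EuclideanSpace ℝ (Fin d)) (c : Fin m → ℝ) (ρ : ℝ) :
    Matrix (Fin d) (Fin d) ℝ :=
  ∑ i, c i • Matrix.vecMulVec (a i).ofLp (a i).ofLp + ρ • (1 : Matrix (Fin d) (Fin d) ℝ)

/-- The logarithmic barrier with the quadratic `ρ / 2 * ‖·‖ ^ 2` added. -/
noncomputable def regBarrier (a : Fin m → EuclideanSpace ℝ (Fin d)) (b : Fin m → ℝ) (ρ : ℝ)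
    (w : EuclideanSpace ℝ (Fin d)) : ℝ :=
  logBarrier a b w + ρ / 2 * ‖w‖ ^ 2

/-- The gradient of `regBarrier`. -/
noncomputable def barrierGrad (a : Fin m → EuclideanSpace ℝ (Fin d)) (b : Fin m → ℝ) (ρ : ℝ)
    (w : EuclideanSpace ℝ (Fin d)) : EuclideanSpace ℝ (Fin d) :=
  -∑ i, (slack a b w i)⁻¹ • a i + ρ • w

/-- The divided difference of the gradient of `regBarrier` between two points. -/
noncomputable def barrierSecant (a : Fin m → EuclideanSpace ℝ (Fin d)) (b : Fin m → ℝ) (ρ : ℝ)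
    (w y : EuclideanSpace ℝ (Fin d)) : Matrix (Fin d) (Fin d) ℝ :=
  weightMat a (fun i => (slack a b w i * slack a b y i)⁻¹) ρ

/-- The Hessian of `regBarrier`. -/
noncomputable def barrierHess (a : Fin m → EuclideanSpace ℝ (Fin d)) (b : Fin m → ℝ) (ρ : ℝ)
    (w : EuclideanSpace ℝ (Fin d)) : Matrix (Fin d) (Fin d) ℝ :=
  barrierSecant a b ρ w w

variable {a : Fin m → EuclideanSpace ℝ (Fin d)} {b : Fin m → ℝ} {ρ : ℝ}

theorem logBarrier_eq_regBarrier : logBarrier a b = regBarrier a b 0 := by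
  funext w; simp [regBarrier]

theorem hybrid_eq_regBarrier (R : ℝ) :
    hybrid (logBarrier a b) m R = regBarrier a b (m / R ^ 2) := by
  funext w; simp only [hybrid, regBarrier]; congr 2; rw [div_div, mul_comm (R ^ 2)]

theorem matVec_weightMat (c : Fin m → ℝ) (v : EuclideanSpace ℝ (Fin d)) :
    matVec (weightMat a c ρ) v = ∑ i, (c i * inner ℝ (a i) v) • a i + ρ • v := by
  rw [weightMat, add_matVec, smul_matVec, one_matVec]
  congr 1
  ext j
  simp [matVec, Matrix.sum_mulVec, Matrix.smul_mulVec, Matrix.vecMulVec_mulVec,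
    inner_eq_dotProduct]
  refine Finset.sum_congr rfl fun i _ => ?_
  ring

theorem quad_weightMat (c : Fin m → ℝ) (v : EuclideanSpace ℝ (Fin d)) :
    quad (weightMat a c ρ) v = ∑ i, c i * inner ℝ (a i) v ^ 2 + ρ * ‖v‖ ^ 2 := by
  rw [quad, matVec_weightMat, inner_add_right, inner_sum, inner_smul_right,
    real_inner_self_eq_norm_sq]
  congr 1
  refine Finset.sum_congr rfl fun i _ => ?_
  rw [inner_smul_right, real_inner_comm]; ring

theorem weightMat_isHermitian (c : Fin m → ℝ) : (weightMat a c ρ).IsHermitian := by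
  rw [weightMat, Matrix.IsHermitian, Matrix.conjTranspose_eq_transpose_of_trivial]
  simp [Matrix.transpose_sum, Matrix.transpose_vecMulVec]

/-- An exact mean value formula, from 1/s − 1/s' = (s' − s)/(s s') in each summand. It replaces the
integral of the Hessian along the segment throughout. -/
theorem barrierGrad_sub {w y : EuclideanSpace ℝ (Fin d)} (hw : ∀ i, slack a b w i ≠ 0)
    (hy : ∀ i, slack a b y i ≠ 0) :
    barrierGrad a b ρ y - barrierGrad a b ρ w = matVec (barrierSecant a b ρ w y) (y - w) := by
  rw [barrierSecant, matVec_weightMat, barrierGrad, barrierGrad, smul_sub, neg_add_eq_sub,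
    neg_add_eq_sub, sub_sub_sub_comm, sub_eq_add_neg, ← Finset.sum_sub_distrib,
    ← Finset.sum_neg_distrib, add_comm]
  congr 1
  refine Finset.sum_congr rfl fun i _ => ?_
  rw [← sub_smul, ← neg_smul, inner_sub_right]
  congr 1
  have h1 := hw i
  have h2 := hy i
  have e : inner ℝ (a i) y - inner ℝ (a i) w = slack a b y i - slack a b w i := by
    simp [slack]
  rw [e]
  field_simp
  ring

theorem continuous_slack (i : Fin m) : Continuous fun w => slack a b w i := by
  unfold slack; fun_prop

/-- A nonzero linear functional is an open map, so taking the interior commutes with its preimage;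
finite intersections also commute with interiors. -/
theorem interior_polytope (ha : ∀ i, a i ≠ 0) :
    interior (polytope a b) = {w | ∀ i, 0 < slack a b w i} := by
  have e : polytope a b = ⋂ i, {w | b i ≤ inner ℝ (a i) w} := by
    ext w; simp [polytope]
  rw [e, interior_iInter_of_finite]
  ext w
  simp only [Set.mem_iInter, Set.mem_ofPred_eq, slack, sub_pos]
  refine forall_congr' fun i => ?_
  have hs : Function.Surjective (innerSL ℝ (a i)) := by
    intro t
    refine ⟨(t / ‖a i‖ ^ 2) • a i, ?_⟩
    have : ‖a i‖ ≠ 0 := by simpa using ha i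
    simp
    field_simp
  have hopen := (innerSL ℝ (a i)).isOpenMap hs
  have := hopen.preimage_interior_eq_interior_preimage (innerSL ℝ (a i)).continuous (Set.Ici (b i))
  rw [interior_Ici] at this
  have h2 : {w | b i ≤ inner ℝ (a i) w} = (innerSL ℝ (a i)) ⁻¹' Set.Ici (b i) := by
    ext; simp
  rw [h2, ← this]; simp

theorem isOpen_slack_pos : IsOpen {w | ∀ i, 0 < slack a b w i} := by
  have e : {w | ∀ i, 0 < slack a b w i} = ⋂ i, {w | 0 < slack a b w i} := by ext; simp
  rw [e]
  exact isOpen_iInter_of_finite fun i => isOpen_lt continuous_const (continuous_slack i)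

theorem hasFDerivAt_slack (w : EuclideanSpace ℝ (Fin d)) (i : Fin m) :
    HasFDerivAt (fun w => slack a b w i) (innerSL ℝ (a i)) w :=
  (innerSL ℝ (a i)).hasFDerivAt.sub_const (b i)

theorem hasGradientAt_regBarrier {w : EuclideanSpace ℝ (Fin d)} (hw : ∀ i, slack a b w i ≠ 0) :
    HasGradientAt (regBarrier a b ρ) (barrierGrad a b ρ w) w := by
  rw [hasGradientAt_iff_hasFDerivAt]
  have h1 : HasFDerivAt (fun w => -∑ i, Real.log (slack a b w i))
      (-∑ i, (slack a b w i)⁻¹ • innerSL ℝ (a i)) w :=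
    (HasFDerivAt.fun_sum fun i _ => (hasFDerivAt_slack w i).log (hw i)).neg
  have h2 : HasFDerivAt (fun w : EuclideanSpace ℝ (Fin d) => ρ / 2 * ‖w‖ ^ 2)
      ((ρ / 2) • (2 • (innerSL ℝ w))) w := by
    have := (hasStrictFDerivAt_norm_sq w).hasFDerivAt.const_mul (ρ / 2)
    exact this
  refine (h1.add h2).congr_fderiv ?_
  ext v
  simp [barrierGrad]
  ring

theorem gradient_regBarrier {w : EuclideanSpace ℝ (Fin d)} (hw : ∀ i, slack a b w i ≠ 0) :
    gradient (regBarrier a b ρ) w = barrierGrad a b ρ w :=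
  (hasGradientAt_regBarrier hw).gradient

theorem hessian_regBarrier {w : EuclideanSpace ℝ (Fin d)} (hw : ∀ i, 0 < slack a b w i) :
    hessian (regBarrier a b ρ) w = barrierHess a b ρ w := by
  ext k l
  rw [hessian, Matrix.of_apply]
  -- The first derivative is differentiated again, so its formula is needed on a neighbourhood;
  -- positivity of the slacks is an open condition.
  have e : (fun x => fderiv ℝ (regBarrier a b ρ) x (EuclideanSpace.single l (1 : ℝ))) =ᶠ[nhds w]
      fun x => -∑ i, (slack a b x i)⁻¹ * (a i) l + ρ * x l := by
    filter_upwards [isOpen_slack_pos.mem_nhds hw] with x hx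
    have := hasGradientAt_iff_hasFDerivAt.1
      (hasGradientAt_regBarrier (ρ := ρ) fun i => (hx i).ne')
    rw [this.fderiv]
    simp [barrierGrad, EuclideanSpace.inner_single_right]
  have h : HasFDerivAt (fun x => -∑ i, (slack a b x i)⁻¹ * (a i) l + ρ * x l)
      (-∑ i, (a i) l • (-(slack a b w i ^ 2)⁻¹ • innerSL ℝ (a i)) +
        ρ • (EuclideanSpace.proj l : EuclideanSpace ℝ (Fin d) →L[ℝ] ℝ)) w := by
    refine HasFDerivAt.add (HasFDerivAt.fun_sum fun i _ => ?_).neg ?_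
    · refine HasFDerivAt.mul_const ?_ _
      exact (hasDerivAt_inv (hw i).ne').comp_hasFDerivAt w (hasFDerivAt_slack w i)
    · exact (EuclideanSpace.proj l : EuclideanSpace ℝ (Fin d) →L[ℝ] ℝ).hasFDerivAt.const_mul ρ
  rw [e.fderiv_eq, h.fderiv]
  simp only [barrierHess, barrierSecant, weightMat, Matrix.add_apply, Matrix.sum_apply,
    Matrix.smul_apply, Matrix.vecMulVec_apply, smul_eq_mul]
  simp [EuclideanSpace.inner_single_right, Matrix.one_apply, eq_comm]
  refine Finset.sum_congr rfl fun i _ => ?_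
  have := (hw i).ne'
  field_simp

/-! ### The logarithmic barrier is a self-concordant barrier -/

theorem contDiffAt_slack_log {w : EuclideanSpace ℝ (Fin d)} (hw : ∀ i, 0 < slack a b w i)
    (n : WithTop ℕ∞) (i : Fin m) : ContDiffAt ℝ n (fun w => Real.log (slack a b w i)) w := by
  refine ContDiffAt.log ?_ (hw i).ne'
  exact ((innerSL ℝ (a i)).contDiff.sub contDiff_const).contDiffAt

theorem iteratedDeriv_three_log_sub (c : ℝ) {r : ℝ} (hr : 0 < r - c) :
    iteratedDeriv 3 (fun r => Real.log (r - c)) r = 2 / (r - c) ^ 3 := by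
  have e1 : deriv (fun r => Real.log (r - c)) = fun r => (r - c)⁻¹ := by
    funext r; rw [deriv_comp_sub_const (f := Real.log)]; simp
  have e2 : deriv (fun r : ℝ => (r - c)⁻¹) = fun r => -((r - c) ^ 2)⁻¹ := by
    funext r; rw [deriv_comp_sub_const (f := fun r : ℝ => r⁻¹)]; simp
  rw [iteratedDeriv_eq_iterate]
  simp only [Function.iterate_succ, Function.iterate_zero, Function.comp_apply, id]
  rw [e1, e2]
  have h : HasDerivAt (fun r : ℝ => -((r - c) ^ 2)⁻¹) (2 / (r - c) ^ 3) r := by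
    have h0 : HasDerivAt (fun r : ℝ => (r - c) ^ 2) (2 * (r - c)) r := by
      simpa using ((hasDerivAt_id r).sub_const c).fun_pow 2
    refine ((h0.inv (by positivity)).neg).congr_deriv ?_
    field_simp
  exact h.deriv

/-- Each summand is a function of one real variable composed with the continuous linear functional
⟨a_i, ·⟩, so only a scalar third derivative is needed. -/
theorem iteratedFDeriv_three_logBarrier {w : EuclideanSpace ℝ (Fin d)}
    (hw : ∀ i, 0 < slack a b w i) (u : EuclideanSpace ℝ (Fin d)) :
    iteratedFDeriv ℝ 3 (logBarrier a b) w (fun _ => u)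
      = -∑ i, 2 * (inner ℝ (a i) u / slack a b w i) ^ 3 := by
  have hlog : ∀ i, iteratedFDeriv ℝ 3 (fun w => Real.log (slack a b w i)) w (fun _ => u)
      = 2 * (inner ℝ (a i) u / slack a b w i) ^ 3 := by
    intro i
    have hc : ContDiffOn ℝ 3 (fun r => Real.log (r - b i)) (Set.Ioi (b i)) := by
      refine ContDiffOn.log (by fun_prop) fun r hr => ?_
      exact (sub_pos.2 hr).ne'
    have hop : IsOpen ((innerSL ℝ (a i)) ⁻¹' Set.Ioi (b i)) :=
      isOpen_Ioi.preimage (innerSL ℝ (a i)).continuous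
    have hmem : (innerSL ℝ (a i)) w ∈ Set.Ioi (b i) := by
      have := hw i; simpa [slack] using this
    have h := (innerSL ℝ (a i)).iteratedFDerivWithin_comp_right hc isOpen_Ioi.uniqueDiffOn
      hop.uniqueDiffOn hmem (i := 3) le_rfl
    rw [iteratedFDerivWithin_of_isOpen 3 hop hmem,
      iteratedFDerivWithin_of_isOpen 3 isOpen_Ioi hmem] at h
    change iteratedFDeriv ℝ 3 ((fun r => Real.log (r - b i)) ∘ (innerSL ℝ (a i))) w _ = _
    rw [h, ContinuousMultilinearMap.compContinuousLinearMap_apply,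
      iteratedFDeriv_apply_eq_iteratedDeriv_mul_prod, iteratedDeriv_three_log_sub]
    · simp [slack, div_pow]
      ring_nf
    · simpa using hmem
  have e : logBarrier a b = -(fun w => ∑ i, Real.log (slack a b w i)) := rfl
  rw [e, iteratedFDeriv_neg_apply, neg_apply,
    iteratedFDeriv_fun_sum_apply fun i _ => contDiffAt_slack_log hw _ i,
    sum_apply]
  congr 1
  exact Finset.sum_congr rfl fun i _ => hlog i

theorem quad_barrierHess (w v : EuclideanSpace ℝ (Fin d)) :
    quad (barrierHess a b ρ w) v = ∑ i, (inner ℝ (a i) v / slack a b w i) ^ 2 + ρ * ‖v‖ ^ 2 := by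
  rw [barrierHess, barrierSecant, quad_weightMat]
  congr 1
  refine Finset.sum_congr rfl fun i _ => ?_
  rw [div_pow, div_eq_inv_mul, sq (slack a b w i)]

theorem weightMat_posDef {c : Fin m → ℝ} (hc : ∀ i, 0 ≤ c i) (hρ : 0 < ρ) :
    (weightMat a c ρ).PosDef := by
  rw [posDef_iff_quad]
  refine ⟨weightMat_isHermitian c, fun v hv => ?_⟩
  rw [quad_weightMat]
  have h1 : 0 ≤ ∑ i, c i * inner ℝ (a i) v ^ 2 :=
    Finset.sum_nonneg fun i _ => mul_nonneg (hc i) (sq_nonneg _)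
  have h2 : 0 < ‖v‖ := norm_pos_iff.2 hv
  positivity

/-- If a polytope is bounded, its constraint normals separate points. -/
theorem exists_inner_ne_zero {R : ℝ} (hR : polytope a b ⊆ Metric.closedBall 0 R)
    {x : EuclideanSpace ℝ (Fin d)} (hx : x ∈ polytope a b) {v : EuclideanSpace ℝ (Fin d)}
    (hv : v ≠ 0) : ∃ i, inner ℝ (a i) v ≠ 0 := by
  by_contra! h
  have hn : 0 < ‖v‖ := norm_pos_iff.2 hv
  have hmem : ∀ t : ℝ, x + t • v ∈ polytope a b := by
    intro t i
    rw [inner_add_right, inner_smul_right, h i]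
    simpa using hx i
  -- A direction orthogonal to all normals gives a whole line in the polytope. This point is at
  -- distance R + ‖x‖ + 1 from x, hence outside the ball.
  have h1 := hR (hmem ((R + ‖x‖ + 1) / ‖v‖))
  rw [mem_closedBall_zero_iff] at h1
  have h0 : 0 ≤ R := (norm_nonneg _).trans (mem_closedBall_zero_iff.1 (hR hx))
  have h2 : ‖((R + ‖x‖ + 1) / ‖v‖) • v‖ = R + ‖x‖ + 1 := by
    rw [norm_smul, Real.norm_of_nonneg (by positivity)]; field_simp
  have h3 := norm_sub_le (x + ((R + ‖x‖ + 1) / ‖v‖) • v) x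
  rw [add_sub_cancel_left, h2] at h3
  linarith

/-- Every |h i| is at most the ℓ² norm; extracting one such factor from each cube leaves the sum of
squares. -/
theorem abs_sum_pow_three_le {ι : Type*} (s : Finset ι) (h : ι → ℝ) :
    |∑ i ∈ s, h i ^ 3| ≤ √(∑ i ∈ s, h i ^ 2) ^ 3 := by
  have hle : ∀ i ∈ s, |h i| ≤ √(∑ i ∈ s, h i ^ 2) := fun i hi =>
    Real.abs_le_sqrt (Finset.single_le_sum (f := fun i => h i ^ 2) (fun j _ => sq_nonneg _) hi)
  calc |∑ i ∈ s, h i ^ 3| ≤ ∑ i ∈ s, |h i ^ 3| := Finset.abs_sum_le_sum_abs _ _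
    _ ≤ ∑ i ∈ s, √(∑ i ∈ s, h i ^ 2) * h i ^ 2 := by
        refine Finset.sum_le_sum fun i hi => ?_
        have : |h i ^ 3| = |h i| * h i ^ 2 := by rw [pow_succ', abs_mul, abs_sq]
        rw [this]
        exact mul_le_mul_of_nonneg_right (hle i hi) (sq_nonneg _)
    _ = √(∑ i ∈ s, h i ^ 2) ^ 3 := by
        rw [← Finset.mul_sum, pow_succ', Real.sq_sqrt (Finset.sum_nonneg fun i _ => sq_nonneg _)]

theorem convexOn_logBarrier (ha : ∀ i, a i ≠ 0) :
    ConvexOn ℝ (interior (polytope a b)) (logBarrier a b) := by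
  rw [interior_polytope ha]
  have aff : ∀ (x y : EuclideanSpace ℝ (Fin d)) (α β : ℝ), α + β = 1 → ∀ i,
      slack a b (α • x + β • y) i = α • slack a b x i + β • slack a b y i := by
    intro x y α β h i
    simp only [slack, inner_add_right, inner_smul_right, smul_eq_mul]
    linear_combination b i * h
  have hlog := strictConcaveOn_log_Ioi.concaveOn
  refine ⟨fun x hx y hy α β hα hβ h i => ?_, fun x hx y hy α β hα hβ h => ?_⟩
  · rw [aff x y α β h]
    exact hlog.1 (hx i) (hy i) hα hβ h
  · have e : ∀ z, logBarrier a b z = -∑ i, Real.log (slack a b z i) := fun _ => rfl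
    rw [e, e, e, smul_neg, smul_neg, ← neg_add, neg_le_neg_iff, Finset.smul_sum, Finset.smul_sum,
      ← Finset.sum_add_distrib]
    refine Finset.sum_le_sum fun i _ => ?_
    rw [aff x y α β h]
    exact hlog.2 (hx i) (hy i) hα hβ h

theorem isClosed_polytope : IsClosed (polytope a b) := by
  have e : polytope a b = ⋂ i, {w | b i ≤ inner ℝ (a i) w} := by
    ext w; simp [polytope]
  rw [e]
  exact isClosed_iInter fun i => isClosed_le continuous_const (by fun_prop)

/-- At a boundary point some slack vanishes and its term tends to +∞. The remaining terms are
bounded below near x, because their slacks stay below their value at x plus one, even if several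
vanish together. -/
theorem tendsto_logBarrier_frontier (ha : ∀ i, a i ≠ 0) {x : EuclideanSpace ℝ (Fin d)}
    (hx : x ∈ frontier (polytope a b)) :
    Filter.Tendsto (logBarrier a b) (nhdsWithin x (interior (polytope a b))) Filter.atTop := by
  rw [isClosed_polytope.frontier_eq, interior_polytope ha] at hx
  rw [interior_polytope ha]
  obtain ⟨k, hk⟩ : ∃ k, slack a b x k = 0 := by
    by_contra! h
    exact hx.2 fun i => lt_of_le_of_ne (sub_nonneg.2 (hx.1 i)) (h i).symm
  have h1 : Filter.Tendsto (fun w => -Real.log (slack a b w k))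
      (nhdsWithin x {w | ∀ i, 0 < slack a b w i}) Filter.atTop := by
    refine Filter.tendsto_neg_atBot_atTop.comp (Real.tendsto_log_nhdsGT_zero.comp ?_)
    rw [tendsto_nhdsWithin_iff]
    refine ⟨?_, ?_⟩
    · have := (continuous_slack (a := a) (b := b) k).tendsto x
      rw [hk] at this
      exact this.mono_left nhdsWithin_le_nhds
    · filter_upwards [self_mem_nhdsWithin] with w hw using hw k
  refine Filter.tendsto_atTop_mono' _ ?_
    (Filter.tendsto_atTop_add_const_right _
      (-∑ i ∈ Finset.univ.erase k, Real.log (slack a b x i + 1)) h1)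
  have h2 : ∀ᶠ w in nhdsWithin x {w | ∀ i, 0 < slack a b w i},
      ∀ i, slack a b w i < slack a b x i + 1 := by
    rw [Filter.eventually_all]
    intro i
    exact ((continuous_slack i).tendsto x |>.mono_left nhdsWithin_le_nhds).eventually_lt_const
      (lt_add_one _)
  filter_upwards [h2, self_mem_nhdsWithin] with w hw hpos
  have e : logBarrier a b w = -∑ i, Real.log (slack a b w i) := rfl
  rw [e, ← Finset.add_sum_erase _ _ (Finset.mem_univ k), neg_add, add_le_add_iff_left,
    neg_le_neg_iff]
  exact Finset.sum_le_sum fun i _ => Real.log_le_log (hpos i) (hw i).le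

/-- For v = H⁻¹∇Ψ and r_i = ⟨a_i, v⟩/s_i, the squared decrement equals both Σ r_i² and −Σ r_i.
Cauchy–Schwarz over m terms then bounds its square by m times itself. -/
theorem quad_inv_barrierGrad_le {x : EuclideanSpace ℝ (Fin d)}
    (hH : (barrierHess a b 0 x).PosDef) :
    quad (barrierHess a b 0 x)⁻¹ (barrierGrad a b 0 x) ≤ m := by
  set H := barrierHess a b 0 x
  set n := barrierGrad a b 0 x with hn
  set v := matVec H⁻¹ n
  have h1 : quad H⁻¹ n = ∑ i, (inner ℝ (a i) v / slack a b x i) ^ 2 := by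
    rw [← quad_matVec_inv hH, quad_barrierHess]; simp [v]
  have h2 : quad H⁻¹ n = -∑ i, (inner ℝ (a i) v / slack a b x i) := by
    change inner ℝ n v = _
    rw [hn, barrierGrad]
    simp [sum_inner, inner_smul_left, div_eq_inv_mul]
  have h4 : (∑ i, (inner ℝ (a i) v / slack a b x i)) ^ 2
      ≤ m * ∑ i, (inner ℝ (a i) v / slack a b x i) ^ 2 := by
    simpa using sq_sum_le_card_mul_sum_sq (s := Finset.univ)
      (f := fun i => inner ℝ (a i) v / slack a b x i)
  rw [← h1, ← neg_sq, ← h2] at h4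
  have h5 := hH.inv.posSemidef.quad_nonneg n
  rcases h5.eq_or_lt with h0 | h0
  · rw [← h0]; positivity
  · nlinarith

theorem isSelfConcordantBarrier_logBarrier {R : ℝ} (ha : ∀ i, a i ≠ 0)
    (hR : polytope a b ⊆ Metric.closedBall 0 R) :
    IsSelfConcordantBarrier (polytope a b) (logBarrier a b) 1 m := by
  have hint := interior_polytope (b := b) ha
  have hess : ∀ x ∈ interior (polytope a b),
      hessian (logBarrier a b) x = barrierHess a b 0 x := by
    intro x hx
    rw [hint] at hx
    rw [logBarrier_eq_regBarrier, hessian_regBarrier hx]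
  have hpd : ∀ x ∈ interior (polytope a b), (barrierHess a b 0 x).PosDef := by
    intro x hx
    rw [posDef_iff_quad]
    refine ⟨weightMat_isHermitian _, fun v hv => ?_⟩
    obtain ⟨i, hi⟩ := exists_inner_ne_zero hR (interior_subset hx) hv
    rw [hint] at hx
    rw [quad_barrierHess, zero_mul, add_zero]
    refine Finset.sum_pos' (fun i _ => sq_nonneg _) ⟨i, Finset.mem_univ i, ?_⟩
    have := (hx i).ne'
    positivity
  refine ⟨⟨convexOn_logBarrier ha, ?_, fun x hx => tendsto_logBarrier_frontier ha hx, ?_⟩, ?_, ?_⟩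
  · intro x hx
    rw [hint] at hx
    exact (ContDiffAt.sum fun i _ => contDiffAt_slack_log hx _ i).neg.contDiffWithinAt
  · intro x hx u
    rw [hess x hx, matNorm_eq, quad_barrierHess]
    rw [hint] at hx
    rw [iteratedFDeriv_three_logBarrier hx, abs_neg, ← Finset.mul_sum, abs_mul, abs_two, mul_one,
      zero_mul, add_zero]
    gcongr
    exact abs_sum_pow_three_le _ _
  · intro x hx
    rw [hess x hx]
    exact hpd x hx
  · intro x hx
    have hpd' := hpd x hx
    rw [hess x hx]
    rw [hint] at hx
    rw [logBarrier_eq_regBarrier, gradient_regBarrier fun i => (hx i).ne', ← quad_eq]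
    exact quad_inv_barrierGrad_le hpd'

end Barrier

/-! ### Approximate Newton steps near a reference point -/

section Newton

variable {d m : ℕ} {a : Fin m → EuclideanSpace ℝ (Fin d)} {b : Fin m → ℝ} {ρ : ℝ}

theorem barrierSecant_posDef (hρ : 0 < ρ) {w y : EuclideanSpace ℝ (Fin d)}
    (hw : ∀ i, 0 < slack a b w i) (hy : ∀ i, 0 < slack a b y i) :
    (barrierSecant a b ρ w y).PosDef :=
  weightMat_posDef (fun i => (inv_pos.2 (mul_pos (hw i) (hy i))).le) hρ

theorem barrierHess_posDef (hρ : 0 < ρ) {w : EuclideanSpace ℝ (Fin d)}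
    (hw : ∀ i, 0 < slack a b w i) : (barrierHess a b ρ w).PosDef :=
  barrierSecant_posDef hρ hw hw

/-- `H` is positive definite and agrees with the Hessian at `u` up to a factor `1 ± 0.001`. -/
def IsHessApprox (a : Fin m → EuclideanSpace ℝ (Fin d)) (b : Fin m → ℝ) (ρ : ℝ)
    (u : EuclideanSpace ℝ (Fin d)) (H : Matrix (Fin d) (Fin d) ℝ) : Prop :=
  H.PosDef ∧ ∀ v, 0.999 * quad (barrierHess a b ρ u) v ≤ quad H v ∧
    quad H v ≤ 1.001 * quad (barrierHess a b ρ u) v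

theorem IsHessAnswer.isHessApprox (hρ : 0 < ρ) {u : EuclideanSpace ℝ (Fin d)}
    (hu : ∀ i, 0 < slack a b u i) {H : Matrix (Fin d) (Fin d) ℝ}
    (h : IsHessAnswer (regBarrier a b ρ) 0.001 u H) : IsHessApprox a b ρ u H := by
  obtain ⟨_, h1, h2, _, _⟩ := h
  rw [hessian_regBarrier hu] at h1 h2
  have hpd := barrierHess_posDef hρ hu
  have hbd : ∀ v, 0.999 * quad (barrierHess a b ρ u) v ≤ quad H v ∧
      quad H v ≤ 1.001 * quad (barrierHess a b ρ u) v := by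
    intro v
    have e1 := h1.quad_nonneg v
    have e2 := h2.quad_nonneg v
    rw [quad_sub, quad_smul] at e1 e2
    constructor <;> linarith
  refine ⟨posDef_iff_quad.2 ⟨?_, fun v hv => ?_⟩, hbd⟩
  · have := h1.1.add (hpd.1.real_smul (1 - 0.001))
    rwa [sub_add_cancel] at this
  · have := (posDef_iff_quad.1 hpd).2 v hv
    linarith [(hbd v).1]

/-- The inverse of a sufficiently accurate approximate inverse of the Hessian is an admissible
answer of the Hessian oracle. -/
theorem isHessAnswer_inv (hρ : 0 < ρ) {u : EuclideanSpace ℝ (Fin d)}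
    (hu : ∀ i, 0 < slack a b u i) {X : Matrix (Fin d) (Fin d) ℝ} (hX : X.IsHermitian)
    (h : ∀ v, |quad ((barrierHess a b ρ u)⁻¹ - X) v| ≤ 0.0005 * quad (barrierHess a b ρ u)⁻¹ v) :
    X.PosDef ∧ IsHessAnswer (regBarrier a b ρ) 0.001 u X⁻¹ := by
  have hpd := barrierHess_posDef hρ hu
  set Q := barrierHess a b ρ u
  have hbd : ∀ v, 0.9995 * quad Q⁻¹ v ≤ quad X v ∧ quad X v ≤ 1.0005 * quad Q⁻¹ v := by
    intro v
    have := abs_le.1 (h v)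
    rw [quad_sub] at this
    constructor <;> linarith [this.1, this.2]
  have hXpd : X.PosDef := by
    refine posDef_iff_quad.2 ⟨hX, fun v hv => ?_⟩
    have := (posDef_iff_quad.1 hpd.inv).2 v hv
    linarith [(hbd v).1]
  have hQdet := (Matrix.isUnit_iff_isUnit_det _).1 hpd.isUnit
  have hXdet := (Matrix.isUnit_iff_isUnit_det _).1 hXpd.isUnit
  -- The tolerance 0.0005 for the inverse leaves room for inversion: 1/0.9995 ≤ 1.001 and 1/1.0005 ≥
  -- 0.999.
  have u1 : ∀ v, quad X⁻¹ v ≤ (1 / 0.9995) * quad Q v := by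
    intro v
    have := quad_inv_le hpd.inv hXpd (c := 1 / 0.9995) (by norm_num)
      (fun v => by have := (hbd v).1; linarith) v
    rwa [Matrix.nonsing_inv_nonsing_inv _ hQdet] at this
  have u2 : ∀ v, quad Q v ≤ 1.0005 * quad X⁻¹ v := by
    intro v
    have := quad_inv_le hXpd hpd.inv (c := 1.0005) (by norm_num) (fun v => (hbd v).2) v
    rwa [Matrix.nonsing_inv_nonsing_inv _ hQdet] at this
  refine ⟨hXpd, (Matrix.isUnit_iff_isUnit_det _).1 hXpd.inv.isUnit, ?_, ?_, ?_, ?_⟩ <;>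
    rw [hessian_regBarrier hu]
  · rw [posSemidef_sub_iff hXpd.inv.1 (hpd.1.real_smul _)]
    intro v
    have := u2 v
    have := hpd.posSemidef.quad_nonneg v
    rw [quad_smul]; linarith
  · rw [posSemidef_sub_iff (hpd.1.real_smul _) hXpd.inv.1]
    intro v
    have := u1 v
    have := hpd.posSemidef.quad_nonneg v
    rw [quad_smul]; linarith
  · rw [Matrix.nonsing_inv_nonsing_inv _ hXdet, posSemidef_sub_iff hX (hpd.inv.1.real_smul _)]
    intro v
    have := (hbd v).1
    have := hpd.inv.posSemidef.quad_nonneg v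
    rw [quad_smul]; linarith
  · rw [Matrix.nonsing_inv_nonsing_inv _ hXdet, posSemidef_sub_iff (hpd.inv.1.real_smul _) hX]
    intro v
    have := (hbd v).2
    have := hpd.inv.posSemidef.quad_nonneg v
    rw [quad_smul]; linarith

/-! ### Comparison of slacks and Hessians near a reference point -/

theorem slack_div_sq_le_quad (hρ : 0 ≤ ρ) (u v : EuclideanSpace ℝ (Fin d)) (i : Fin m) :
    (inner ℝ (a i) v / slack a b u i) ^ 2 ≤ quad (barrierHess a b ρ u) v := by
  rw [quad_barrierHess]
  have := Finset.single_le_sum (f := fun i => (inner ℝ (a i) v / slack a b u i) ^ 2)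
    (fun j _ => sq_nonneg _) (Finset.mem_univ i)
  have h2 : 0 ≤ ρ * ‖v‖ ^ 2 := by positivity
  linarith

/-- The relative change of a slack is one term of the Hessian form at u. The figure 0.0301 is 0.03
enlarged for the oracle error: 0.03²/0.999 ≤ 0.0301². In particular, such points are strictly
feasible. -/
theorem slack_near (hρ : 0 < ρ) {u : EuclideanSpace ℝ (Fin d)} (hu : ∀ i, 0 < slack a b u i)
    {H : Matrix (Fin d) (Fin d) ℝ} (hH : IsHessApprox a b ρ u H) {y : EuclideanSpace ℝ (Fin d)}
    (hy : matNorm H (y - u) ≤ 0.03) (i : Fin m) :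
    0.9699 * slack a b u i ≤ slack a b y i ∧ slack a b y i ≤ 1.0301 * slack a b u i := by
  have h1 := slack_div_sq_le_quad (a := a) (b := b) hρ.le u (y - u) i
  have h2 := (hH.2 (y - u)).1
  have h3 : quad H (y - u) ≤ 0.03 ^ 2 := by
    rw [← matNorm_sq hH.1.posSemidef]
    have := matNorm_nonneg H (y - u)
    gcongr
  have h4 : (inner ℝ (a i) (y - u) / slack a b u i) ^ 2 ≤ 0.0301 ^ 2 := by
    norm_num at h2 h3 ⊢; linarith
  have h5 := abs_le.1 (abs_le_of_sq_le_sq h4 (by norm_num))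
  have h6 : slack a b y i = slack a b u i + inner ℝ (a i) (y - u) := by
    rw [inner_sub_right, slack, slack]; ring
  have hp := hu i
  rw [le_div_iff₀ hp, div_le_iff₀ hp] at h5
  constructor <;> linarith [h5.1, h5.2]

theorem slack_pos_of_near (hρ : 0 < ρ) {u : EuclideanSpace ℝ (Fin d)}
    (hu : ∀ i, 0 < slack a b u i) {H : Matrix (Fin d) (Fin d) ℝ} (hH : IsHessApprox a b ρ u H)
    {y : EuclideanSpace ℝ (Fin d)} (hy : matNorm H (y - u) ≤ 0.03) (i : Fin m) :
    0 < slack a b y i := by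
  have := (slack_near hρ hu hH hy i).1
  have := hu i
  linarith

/-- The weights of the secant matrix are those at u up to factors between 1.0301⁻² ≥ 0.94 and
0.9699⁻² ≤ 1.064, while the ρ-terms agree. The bound 0.1 also covers the difference between H and
the exact Hessian at u. -/
theorem barrierSecant_near (hρ : 0 < ρ) {u : EuclideanSpace ℝ (Fin d)}
    (hu : ∀ i, 0 < slack a b u i) {H : Matrix (Fin d) (Fin d) ℝ} (hH : IsHessApprox a b ρ u H)
    {y z : EuclideanSpace ℝ (Fin d)} (hy : matNorm H (y - u) ≤ 0.03)
    (hz : matNorm H (z - u) ≤ 0.03) (v : EuclideanSpace ℝ (Fin d)) :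
    |quad (barrierSecant a b ρ y z - H) v| ≤ 0.1 * quad H v := by
  have hv := hH.2 v
  have hpos := (barrierHess_posDef hρ hu).posSemidef.quad_nonneg v
  have hρv : 0 ≤ ρ * ‖v‖ ^ 2 := by positivity
  have hterm : ∀ i, 0.94 * (inner ℝ (a i) v / slack a b u i) ^ 2 ≤
      (slack a b y i * slack a b z i)⁻¹ * inner ℝ (a i) v ^ 2 ∧
      (slack a b y i * slack a b z i)⁻¹ * inner ℝ (a i) v ^ 2 ≤
      1.064 * (inner ℝ (a i) v / slack a b u i) ^ 2 := by
    intro i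
    have hp := hu i
    obtain ⟨y1, y2⟩ := slack_near hρ hu hH hy i
    obtain ⟨z1, z2⟩ := slack_near hρ hu hH hz i
    have hyp := slack_pos_of_near hρ hu hH hy i
    have hzp := slack_pos_of_near hρ hu hH hz i
    set su := slack a b u i
    have l1 : (0.9699 * su) * (0.9699 * su) ≤ slack a b y i * slack a b z i := by gcongr
    have l2 : slack a b y i * slack a b z i ≤ (1.0301 * su) * (1.0301 * su) := by gcongr
    have hyz : 0 < slack a b y i * slack a b z i := by positivity
    have hsu : 0 < su ^ 2 := by positivity
    have hq := sq_nonneg (inner ℝ (a i) v)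
    rw [div_pow, ← mul_div_assoc, ← mul_div_assoc, inv_mul_eq_div, div_le_div_iff₀ hsu hyz,
      div_le_div_iff₀ hyz hsu]
    constructor
    · have : 0.94 * (slack a b y i * slack a b z i) ≤ su ^ 2 := by nlinarith
      nlinarith
    · have : su ^ 2 ≤ 1.064 * (slack a b y i * slack a b z i) := by nlinarith
      nlinarith
  have hsum1 : 0.94 * ∑ i, (inner ℝ (a i) v / slack a b u i) ^ 2 ≤
      ∑ i, (slack a b y i * slack a b z i)⁻¹ * inner ℝ (a i) v ^ 2 := by
    rw [Finset.mul_sum]; exact Finset.sum_le_sum fun i _ => (hterm i).1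
  have hsum2 : ∑ i, (slack a b y i * slack a b z i)⁻¹ * inner ℝ (a i) v ^ 2 ≤
      1.064 * ∑ i, (inner ℝ (a i) v / slack a b u i) ^ 2 := by
    rw [Finset.mul_sum]; exact Finset.sum_le_sum fun i _ => (hterm i).2
  rw [quad_barrierHess] at hv hpos
  rw [quad_sub, barrierSecant, quad_weightMat, abs_le]
  constructor <;> linarith [hv.1, hv.2]

theorem barrierHess_near (hρ : 0 < ρ) {u : EuclideanSpace ℝ (Fin d)}
    (hu : ∀ i, 0 < slack a b u i) {H : Matrix (Fin d) (Fin d) ℝ} (hH : IsHessApprox a b ρ u H)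
    {y : EuclideanSpace ℝ (Fin d)} (hy : matNorm H (y - u) ≤ 0.03)
    (v : EuclideanSpace ℝ (Fin d)) :
    0.9 * quad H v ≤ quad (barrierHess a b ρ y) v ∧
      quad (barrierHess a b ρ y) v ≤ 1.1 * quad H v := by
  have := abs_le.1 (barrierSecant_near hρ hu hH hy hy v)
  rw [quad_sub] at this
  change _ ≤ quad (barrierHess a b ρ y) v - _ ∧ quad (barrierHess a b ρ y) v - _ ≤ _ at this
  constructor <;> linarith [this.1, this.2]

theorem inv_le_inv_hess (hρ : 0 < ρ) {u : EuclideanSpace ℝ (Fin d)}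
    (hu : ∀ i, 0 < slack a b u i) {H : Matrix (Fin d) (Fin d) ℝ} (hH : IsHessApprox a b ρ u H)
    {y : EuclideanSpace ℝ (Fin d)} (hy : matNorm H (y - u) ≤ 0.03)
    (x : EuclideanSpace ℝ (Fin d)) :
    quad H⁻¹ x ≤ 1.1 * quad (barrierHess a b ρ y)⁻¹ x :=
  quad_inv_le (barrierHess_posDef hρ (slack_pos_of_near hρ hu hH hy)) hH.1 (by norm_num)
    (fun v => (barrierHess_near hρ hu hH hy v).2) x

theorem inv_hess_le_inv (hρ : 0 < ρ) {u : EuclideanSpace ℝ (Fin d)}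
    (hu : ∀ i, 0 < slack a b u i) {H : Matrix (Fin d) (Fin d) ℝ} (hH : IsHessApprox a b ρ u H)
    {y : EuclideanSpace ℝ (Fin d)} (hy : matNorm H (y - u) ≤ 0.03)
    (x : EuclideanSpace ℝ (Fin d)) :
    quad (barrierHess a b ρ y)⁻¹ x ≤ 1 / 0.9 * quad H⁻¹ x :=
  quad_inv_le hH.1 (barrierHess_posDef hρ (slack_pos_of_near hρ hu hH hy)) (by norm_num)
    (fun v => by have := (barrierHess_near hρ hu hH hy v).1; linarith) x

theorem matNorm_inv_le_inv_hess (hρ : 0 < ρ) {u : EuclideanSpace ℝ (Fin d)}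
    (hu : ∀ i, 0 < slack a b u i) {H : Matrix (Fin d) (Fin d) ℝ} (hH : IsHessApprox a b ρ u H)
    {y : EuclideanSpace ℝ (Fin d)} (hy : matNorm H (y - u) ≤ 0.03)
    (x : EuclideanSpace ℝ (Fin d)) :
    matNorm H⁻¹ x ≤ 1.1 * matNorm (barrierHess a b ρ y)⁻¹ x := by
  refine matNorm_le_of_quad_le (by norm_num) ?_
  have h1 := inv_le_inv_hess hρ hu hH hy x
  have h2 := (barrierHess_posDef hρ
    (slack_pos_of_near hρ hu hH hy)).inv.posSemidef.quad_nonneg x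
  linarith

theorem matNorm_inv_hess_le_inv (hρ : 0 < ρ) {u : EuclideanSpace ℝ (Fin d)}
    (hu : ∀ i, 0 < slack a b u i) {H : Matrix (Fin d) (Fin d) ℝ} (hH : IsHessApprox a b ρ u H)
    {y : EuclideanSpace ℝ (Fin d)} (hy : matNorm H (y - u) ≤ 0.03)
    (x : EuclideanSpace ℝ (Fin d)) :
    matNorm (barrierHess a b ρ y)⁻¹ x ≤ 1.1 * matNorm H⁻¹ x := by
  refine matNorm_le_of_quad_le (by norm_num) ?_
  have h1 := inv_hess_le_inv hρ hu hH hy x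
  have h2 := hH.1.inv.posSemidef.quad_nonneg x
  linarith

/-! ### Contraction of inexact Newton steps -/

/-- The distance of two points near `u` is controlled by their residual gradients. -/
theorem matNorm_sub_le_residual (hρ : 0 < ρ) {u : EuclideanSpace ℝ (Fin d)}
    (hu : ∀ i, 0 < slack a b u i) {H : Matrix (Fin d) (Fin d) ℝ} (hH : IsHessApprox a b ρ u H)
    {w y : EuclideanSpace ℝ (Fin d)} (hw : matNorm H (w - u) ≤ 0.03)
    (hy : matNorm H (y - u) ≤ 0.03) (s : EuclideanSpace ℝ (Fin d)) :
    0.9 * matNorm H (y - w) ≤ matNorm H⁻¹ (barrierGrad a b ρ y + s) +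
      matNorm H⁻¹ (barrierGrad a b ρ w + s) := by
  have hs := barrierGrad_sub (ρ := ρ) (fun i => (slack_pos_of_near hρ hu hH hw i).ne')
    (fun i => (slack_pos_of_near hρ hu hH hy i).ne')
  set v := y - w
  set A := barrierSecant a b ρ w y
  -- Strong monotonicity: the secant form is at least 0.9 times the form of H. The difference of the
  -- gradients is also the difference of the residuals.
  have h1 := (abs_le.1 (barrierSecant_near hρ hu hH hw hy v)).1
  rw [quad_sub] at h1
  have h2 := (abs_le.1 (abs_inner_le_matNorm hH.1 (matVec A v) v)).2
  have h3 : inner ℝ (matVec A v) v = quad A v := by rw [quad, real_inner_comm]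
  have e : matVec A v = (barrierGrad a b ρ y + s) + -(barrierGrad a b ρ w + s) := by
    rw [← hs]; abel
  have h4 := matNorm_add_le hH.1.inv.posSemidef (barrierGrad a b ρ y + s)
    (-(barrierGrad a b ρ w + s))
  rw [← e, matNorm_neg] at h4
  rw [h3] at h2
  have h5 := matNorm_sq hH.1.posSemidef v
  rcases (matNorm_nonneg H v).eq_or_lt with h0 | h0
  · rw [← h0, mul_zero]
    exact add_nonneg (matNorm_nonneg _ _) (matNorm_nonneg _ _)
  · refine le_trans (le_of_mul_le_mul_right ?_ h0) h4
    nlinarith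

/-- H⁻¹ is an isometry from the dual norm to the norm of H. In applications `q` is the exact
gradient, which separates the residual from the oracle error. -/
theorem matNorm_newton_step {H : Matrix (Fin d) (Fin d) ℝ} (hH : H.PosDef)
    (y h s : EuclideanSpace ℝ (Fin d)) (q : EuclideanSpace ℝ (Fin d)) :
    matNorm H (y - matVec H⁻¹ (h + s) - y) ≤ matNorm H⁻¹ (q + s) + matNorm H⁻¹ (h - q) := by
  rw [sub_sub_cancel_left, matNorm_neg, matNorm_matVec_inv hH]
  have := matNorm_add_le hH.inv.posSemidef (q + s) (h - q)
  rwa [show q + s + (h - q) = h + s by abel] at this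

/-- One approximate Newton step contracts the residual gradient. -/
theorem residual_newton_step (hρ : 0 < ρ) {u : EuclideanSpace ℝ (Fin d)}
    (hu : ∀ i, 0 < slack a b u i) {H : Matrix (Fin d) (Fin d) ℝ} (hH : IsHessApprox a b ρ u H)
    {y y' h s : EuclideanSpace ℝ (Fin d)} (hy : matNorm H (y - u) ≤ 0.03)
    (hy' : matNorm H (y' - u) ≤ 0.03) (hstep : y' = y - matVec H⁻¹ (h + s)) :
    matNorm H⁻¹ (barrierGrad a b ρ y' + s) ≤ 0.1 * matNorm H⁻¹ (barrierGrad a b ρ y + s) +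
      1.1 * matNorm H⁻¹ (h - barrierGrad a b ρ y) := by
  have hs := barrierGrad_sub (ρ := ρ) (fun i => (slack_pos_of_near hρ hu hH hy i).ne')
    (fun i => (slack_pos_of_near hρ hu hH hy' i).ne')
  have h0 := matNorm_newton_step hH.1 y h s (barrierGrad a b ρ y)
  rw [← hstep] at h0
  have hHv : matVec H (y' - y) = -(h + s) := by
    rw [hstep, sub_sub_cancel_left, matVec_neg, hH.1.matVec_matVec_inv]
  set v := y' - y
  set A := barrierSecant a b ρ y y'
  have h1 := matNorm_inv_matVec_le hH.1 ((weightMat_isHermitian _).sub hH.1.1)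
    (barrierSecant_near hρ hu hH hy hy') v
  -- Since Hv = −(h + s), a step with A in place of H and an exact gradient would annihilate the
  -- residual; what remains are these two errors.
  have e : barrierGrad a b ρ y' + s = matVec (A - H) v + -(h - barrierGrad a b ρ y) := by
    rw [sub_matVec, hHv, ← hs]; abel
  have h2 := matNorm_add_le hH.1.inv.posSemidef (matVec (A - H) v) (-(h - barrierGrad a b ρ y))
  rw [← e, matNorm_neg] at h2
  change matNorm H⁻¹ (matVec (A - H) v) ≤ _ at h1
  linarith

/-- The intermediate Newton iterations of one round: they stay close to the reference point, and
the residual gradient decreases geometrically down to the accuracy of the gradient oracle. -/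
theorem newton_iterations (hρ : 0 < ρ) {u : EuclideanSpace ℝ (Fin d)}
    (hu : ∀ i, 0 < slack a b u i) {H : Matrix (Fin d) (Fin d) ℝ} (hH : IsHessApprox a b ρ u H)
    {w s s' : EuclideanSpace ℝ (Fin d)} {ε τ : ℝ} (hε0 : 0 ≤ ε) (hε : ε ≤ 1 / 20000)
    (hτ0 : 0 ≤ τ) (hτ : τ ≤ 1 / 1000) (hw : matNorm H (w - u) ≤ 1 / 41)
    (hres : matNorm (barrierHess a b ρ w)⁻¹ (barrierGrad a b ρ w + s) ≤ 2 * ε)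
    (hs : matNorm H⁻¹ (s' - s) ≤ 1.1 * τ) {n : ℕ} {y h : ℕ → EuclideanSpace ℝ (Fin d)}
    (hy0 : y 0 = w)
    (hh : ∀ k < n, (∀ i, 0 < slack a b (y k) i) →
      matNorm (barrierHess a b ρ (y k))⁻¹ (h k - barrierGrad a b ρ (y k)) ≤ ε)
    (hy : ∀ k < n, y (k + 1) = y k - matVec H⁻¹ (h k + s')) {k : ℕ} (hk : k ≤ n) :
    matNorm H (y k - u) ≤ 0.0275 ∧
    matNorm H⁻¹ (barrierGrad a b ρ (y k) + s') ≤ 0.1 ^ k * (1.1 * (2 * ε + τ)) + 1.35 * ε ∧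
    0.9 * matNorm H (y k - w) ≤ 0.1 ^ k * (1.1 * (2 * ε + τ)) + 1.35 * ε +
      1.1 * (2 * ε + τ) := by
  have hw' : matNorm H (w - u) ≤ 0.03 := hw.trans (by norm_num)
  -- The residual inherited from the previous round, transferred to the norm of H⁻¹, plus the effect
  -- of the new gradient.
  have hr0 : matNorm H⁻¹ (barrierGrad a b ρ w + s') ≤ 1.1 * (2 * ε + τ) := by
    have h1 := matNorm_inv_le_inv_hess hρ hu hH hw' (barrierGrad a b ρ w + s)
    have h2 := matNorm_add_le hH.1.inv.posSemidef (barrierGrad a b ρ w + s) (s' - s)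
    rw [show barrierGrad a b ρ w + s + (s' - s) = barrierGrad a b ρ w + s' by abel] at h2
    linarith
  induction k with
  | zero =>
    rw [hy0, sub_self, matNorm_zero]
    refine ⟨hw.trans (by norm_num), by linarith, by linarith⟩
  | succ k ih =>
    obtain ⟨h1, h2, h3⟩ := ih (Nat.le_of_succ_le hk)
    have hk' : k < n := hk
    have hpow : (0.1 : ℝ) ^ k ≤ 1 := pow_le_one₀ (by norm_num) (by norm_num)
    have hpow0 : (0 : ℝ) ≤ 0.1 ^ k := by positivity
    have hyk : matNorm H (y k - u) ≤ 0.03 := h1.trans (by norm_num)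
    have hpos := slack_pos_of_near hρ hu hH hyk
    have he : matNorm H⁻¹ (h k - barrierGrad a b ρ (y k)) ≤ 1.1 * ε := by
      have := matNorm_inv_le_inv_hess hρ hu hH hyk (h k - barrierGrad a b ρ (y k))
      have := hh k hk' hpos
      linarith
    have hc0 : 0 ≤ 1.1 * (2 * ε + τ) := by positivity
    have hc : 0.1 ^ k * (1.1 * (2 * ε + τ)) ≤ 1.1 * (2 * ε + τ) :=
      mul_le_of_le_one_left hc0 hpow
    have hmove := matNorm_newton_step hH.1 (y k) (h k) s' (barrierGrad a b ρ (y k))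
    rw [← hy k hk'] at hmove
    -- A crude bound, 0.0275 plus one step length, which the contraction lemma needs at the new
    -- point. Afterwards 0.0275 is recovered from the distance to w, so the steps do not accumulate.
    have hy1 : matNorm H (y (k + 1) - u) ≤ 0.03 := by
      have := matNorm_add_le hH.1.posSemidef (y (k + 1) - y k) (y k - u)
      rw [sub_add_sub_cancel] at this
      linarith
    have hres1 := residual_newton_step hρ hu hH hyk hy1 (hy k hk')
    -- The coefficient 1.35 is nearly the fixed point of the recursion: 0.1·1.35 + 1.1·1.1 = 1.345.
    have hr1 : matNorm H⁻¹ (barrierGrad a b ρ (y (k + 1)) + s') ≤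
        0.1 ^ (k + 1) * (1.1 * (2 * ε + τ)) + 1.35 * ε := by
      rw [pow_succ]; linarith
    have hd := matNorm_sub_le_residual hρ hu hH hw' hy1 s'
    have hpow1 : (0.1 : ℝ) ^ (k + 1) * (1.1 * (2 * ε + τ)) ≤ 1.1 * (2 * ε + τ) :=
      mul_le_of_le_one_left hc0 (pow_le_one₀ (by norm_num) (by norm_num))
    refine ⟨?_, hr1, by linarith⟩
    have := matNorm_add_le hH.1.posSemidef (y (k + 1) - w) (w - u)
    rw [sub_add_sub_cancel] at this
    linarith

/-- The effect of one round, from the point `w` to the point `y n`. -/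
theorem newton_round (hρ : 0 < ρ) {u : EuclideanSpace ℝ (Fin d)}
    (hu : ∀ i, 0 < slack a b u i) {H : Matrix (Fin d) (Fin d) ℝ} (hH : IsHessApprox a b ρ u H)
    {w s s' : EuclideanSpace ℝ (Fin d)} {ε τ : ℝ} (hε0 : 0 ≤ ε) (hε : ε ≤ 1 / 20000)
    (hτ0 : 0 ≤ τ) (hτ : τ ≤ 1 / 1000) (hw : matNorm H (w - u) ≤ 1 / 41)
    (hres : matNorm (barrierHess a b ρ w)⁻¹ (barrierGrad a b ρ w + s) ≤ 2 * ε)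
    (hs : matNorm H⁻¹ (s' - s) ≤ 1.1 * τ) {n : ℕ} {y h : ℕ → EuclideanSpace ℝ (Fin d)}
    (hn : 0.1 ^ n ≤ 10 * ε) (hy0 : y 0 = w)
    (hh : ∀ k < n, (∀ i, 0 < slack a b (y k) i) →
      matNorm (barrierHess a b ρ (y k))⁻¹ (h k - barrierGrad a b ρ (y k)) ≤ ε)
    (hy : ∀ k < n, y (k + 1) = y k - matVec H⁻¹ (h k + s')) :
    matNorm H (y n - u) ≤ 0.03 ∧
    matNorm (barrierHess a b ρ (y n))⁻¹ (barrierGrad a b ρ (y n) + s') ≤ 2 * ε ∧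
    matNorm H (y n - w) ≤ 5 * (ε + τ) := by
  obtain ⟨h1, h2, h3⟩ := newton_iterations hρ hu hH hε0 hε hτ0 hτ hw hres hs hy0 hh hy le_rfl
  have h1' : matNorm H (y n - u) ≤ 0.03 := h1.trans (by norm_num)
  -- The starting residual is at most 0.00121, so after n steps only 0.013ε of it is left; 1.1·(1.35
  -- + 0.013) stays below 2.
  have hc : 0.1 ^ n * (1.1 * (2 * ε + τ)) ≤ 10 * ε * 0.0013 := by
    apply mul_le_mul hn _ (by positivity) (by positivity)
    linarith
  refine ⟨h1', ?_, ?_⟩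
  · have := matNorm_inv_hess_le_inv hρ hu hH h1' (barrierGrad a b ρ (y n) + s')
    linarith
  · linarith

/-- Contraction by 0.1 < e⁻¹ per step makes log(1/ε) steps sufficient, which is why the constant c₀
can be 1. The factor 10 pays for performing N − 1 steps instead of N. -/
theorem pow_le_gradTol {ε : ℝ} (hε0 : 0 < ε) {N : ℕ} (hN1 : 1 ≤ N)
    (hN : Real.log (1 / ε) ≤ N) : (0.1 : ℝ) ^ (N - 1) ≤ 10 * ε := by
  have h1 : (0.1 : ℝ) ^ N ≤ ε := by
    have h2 : (0.1 : ℝ) ≤ Real.exp (-1) := by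
      rw [Real.exp_neg, le_inv_comm₀ (by norm_num) (Real.exp_pos _)]
      have := Real.exp_one_lt_d9
      norm_num at this ⊢; linarith
    calc (0.1 : ℝ) ^ N ≤ Real.exp (-1) ^ N := by gcongr
      _ = Real.exp (-N) := by rw [← Real.exp_nat_mul]; ring_nf
      _ ≤ Real.exp (Real.log ε) := by
          apply Real.exp_le_exp.2
          rw [one_div, Real.log_inv] at hN; linarith
      _ = ε := Real.exp_log hε0
  obtain ⟨k, rfl⟩ : ∃ k, N = k + 1 := ⟨N - 1, by omega⟩
  rw [pow_succ] at h1
  simp only [Nat.add_sub_cancel]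
  linarith

/-- The quadratic part makes the Hessian dominate ρI. This is the purpose of the hybrid barrier:
Euclidean gradient bounds become dual local bounds, uniformly over the polytope. -/
theorem matNorm_inv_le_norm (hρ : 0 < ρ) {u : EuclideanSpace ℝ (Fin d)}
    {H : Matrix (Fin d) (Fin d) ℝ} (hH : IsHessApprox a b ρ u H)
    (x : EuclideanSpace ℝ (Fin d)) : matNorm H⁻¹ x ≤ 1.1 * (‖x‖ / √ρ) := by
  have h2 : ρ * ‖matVec H⁻¹ x‖ ^ 2 ≤ 1.002 * quad H⁻¹ x := by
    have h3 := (hH.2 (matVec H⁻¹ x)).1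
    rw [quad_barrierHess, quad_matVec_inv hH.1] at h3
    have h4 : 0 ≤ ∑ i, (inner ℝ (a i) (matVec H⁻¹ x) / slack a b u i) ^ 2 :=
      Finset.sum_nonneg fun i _ => sq_nonneg _
    have h5 : 0 ≤ ρ * ‖matVec H⁻¹ x‖ ^ 2 := by positivity
    linarith
  have h3 : quad H⁻¹ x ≤ ‖x‖ * ‖matVec H⁻¹ x‖ := real_inner_le_norm _ _
  have hq := hH.1.inv.posSemidef.quad_nonneg x
  have hsq : √ρ ^ 2 = ρ := Real.sq_sqrt hρ.le
  have hsp : 0 < √ρ := Real.sqrt_pos.2 hρ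
  have h4 : √ρ * ‖matVec H⁻¹ x‖ ≤ 1.1 * matNorm H⁻¹ x := by
    apply abs_le_of_sq_le_sq' _ (by have := matNorm_nonneg H⁻¹ x; positivity) |>.2
    rw [mul_pow, mul_pow, hsq, matNorm_sq hH.1.inv.posSemidef]
    linarith
  rw [← mul_div_assoc, le_div_iff₀ hsp]
  rw [← matNorm_sq hH.1.inv.posSemidef] at h3
  rcases (matNorm_nonneg H⁻¹ x).eq_or_lt with h0 | h0
  · rw [← h0, zero_mul]; positivity
  · refine le_of_mul_le_mul_left ?_ h0
    have := norm_nonneg x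
    nlinarith [mul_le_mul_of_nonneg_left h4 this]

end Newton

/-! ### Invariants of BARONS -/

section Invariant

variable {d m : ℕ} {a : Fin m → EuclideanSpace ℝ (Fin d)} {b : Fin m → ℝ} {ρ ε τ : ℝ}

/-- The invariant of BARONS at the beginning of a round: `H` is a Hessian oracle's answer at `u`,
the point `w` is close to `u`, and the residual gradient at `w` is small. -/
structure BaronsInv (a : Fin m → EuclideanSpace ℝ (Fin d)) (b : Fin m → ℝ) (ρ ε : ℝ)
    (w u s : EuclideanSpace ℝ (Fin d)) (H : Matrix (Fin d) (Fin d) ℝ) : Prop where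
  u_pos : ∀ i, 0 < slack a b u i
  hess : IsHessApprox a b ρ u H
  near : matNorm H (w - u) ≤ 1 / 41
  residual : matNorm (barrierHess a b ρ w)⁻¹ (barrierGrad a b ρ w + s) ≤ 2 * ε

/-- The parameters of BARONS are in the range in which its analysis works. -/
structure BaronsParams (ρ ε τ : ℝ) (N : ℕ) : Prop where
  rho_pos : 0 < ρ
  eps_pos : 0 < ε
  eps_le : ε ≤ 1 / 20000
  tau_nonneg : 0 ≤ τ
  tau_le : τ ≤ 1 / 1000
  one_le : 1 ≤ N
  log_le : Real.log (1 / ε) ≤ N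

variable {w u s s' : EuclideanSpace ℝ (Fin d)} {H : Matrix (Fin d) (Fin d) ℝ} {N : ℕ}

theorem BaronsInv.near' (inv : BaronsInv a b ρ ε w u s H) : matNorm H (w - u) ≤ 0.03 :=
  inv.near.trans (by norm_num)

theorem BaronsInv.w_pos (inv : BaronsInv a b ρ ε w u s H) (hρ : 0 < ρ) (i : Fin m) :
    0 < slack a b w i :=
  slack_pos_of_near hρ inv.u_pos inv.hess inv.near' i

/-- The effect of the Newton steps of a round under the invariant. -/
theorem BaronsInv.newton (inv : BaronsInv a b ρ ε w u s H) (hp : BaronsParams ρ ε τ N)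
    (hs : ‖s' - s‖ / √ρ ≤ τ) {y h : ℕ → EuclideanSpace ℝ (Fin d)} (hy0 : y 0 = w)
    (hh : ∀ k < N - 1, (∀ i, 0 < slack a b (y k) i) →
      matNorm (barrierHess a b ρ (y k))⁻¹ (h k - barrierGrad a b ρ (y k)) ≤ ε)
    (hy : ∀ k < N - 1, y (k + 1) = y k - matVec H⁻¹ (h k + s')) :
    matNorm H (y (N - 1) - u) ≤ 0.03 ∧
    matNorm (barrierHess a b ρ (y (N - 1)))⁻¹ (barrierGrad a b ρ (y (N - 1)) + s') ≤ 2 * ε ∧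
    matNorm H (y (N - 1) - w) ≤ 5 * (ε + τ) := by
  refine newton_round hp.rho_pos inv.u_pos inv.hess hp.eps_pos.le hp.eps_le hp.tau_nonneg
    hp.tau_le inv.near inv.residual ?_ (pow_le_gradTol hp.eps_pos hp.one_le hp.log_le) hy0 hh hy
  refine (matNorm_inv_le_norm hp.rho_pos inv.hess _).trans ?_
  linarith

theorem BaronsInv.keep {w' : EuclideanSpace ℝ (Fin d)} (inv : BaronsInv a b ρ ε w u s H)
    (hnear : matNorm H (w' - u) ≤ 1 / 41)
    (hres : matNorm (barrierHess a b ρ w')⁻¹ (barrierGrad a b ρ w' + s') ≤ 2 * ε) :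
    BaronsInv a b ρ ε w' u s' H :=
  ⟨inv.u_pos, inv.hess, hnear, hres⟩

theorem BaronsInv.renew {w' : EuclideanSpace ℝ (Fin d)} {H' : Matrix (Fin d) (Fin d) ℝ}
    (hρ : 0 < ρ) (hpos : ∀ i, 0 < slack a b w' i)
    (hH : IsHessAnswer (regBarrier a b ρ) 0.001 w' H')
    (hres : matNorm (barrierHess a b ρ w')⁻¹ (barrierGrad a b ρ w' + s') ≤ 2 * ε) :
    BaronsInv a b ρ ε w' w' s' H' := by
  refine ⟨hpos, hH.isHessApprox hρ hpos, ?_, hres⟩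
  rw [sub_self, matNorm_zero]; norm_num

/-- The distance travelled in a round, measured in the local norm of the new point. -/
theorem matNorm_hess_step_le (hρ : 0 < ρ) (inv : BaronsInv a b ρ ε w u s H)
    {w' : EuclideanSpace ℝ (Fin d)} (hnear : matNorm H (w' - u) ≤ 0.03) {r : ℝ}
    (hstep : matNorm H (w' - w) ≤ r) : matNorm (barrierHess a b ρ w') (w - w') ≤ 1.1 * r := by
  have h := (barrierHess_near hρ inv.u_pos inv.hess hnear (w - w')).2
  have h2 : matNorm (barrierHess a b ρ w') (w - w') ≤ 1.1 * matNorm H (w - w') := by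
    refine matNorm_le_of_quad_le (by norm_num) ?_
    have := inv.hess.1.posSemidef.quad_nonneg (w - w')
    linarith
  rw [matNorm_sub_comm H] at h2
  linarith

/-- The invariant holds throughout an execution of BARONS. -/
theorem BaronsRun.invariant (ha : ∀ i, a i ≠ 0) (hp : BaronsParams ρ ε τ N) {η : ℝ} {T : ℕ}
    {wstar : EuclideanSpace ℝ (Fin d)} {g : ℕ → EuclideanSpace ℝ (Fin d)}
    (run : BaronsRun (polytope a b) (regBarrier a b ρ) 1 η ε 0.001 N T wstar g)
    (hw : wstar ∈ interior (polytope a b)) (hgrad : barrierGrad a b ρ wstar = 0)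
    (hg : ∀ t < T, ‖η • g t‖ / √ρ ≤ τ) :
    ∀ t ≤ T, BaronsInv a b ρ ε (run.w t) (run.u t) (run.s t) (run.H t) ∧
      (t < T → matNorm (run.H t) (run.w (t + 1) - run.u t) ≤ 0.03 ∧
        matNorm (run.H t) (run.w (t + 1) - run.w t) ≤ 5 * (ε + τ)) := by
  have hint := interior_polytope (b := b) ha
  have step : ∀ t < T, BaronsInv a b ρ ε (run.w t) (run.u t) (run.s t) (run.H t) →
      matNorm (run.H t) (run.w (t + 1) - run.u t) ≤ 0.03 ∧
      matNorm (barrierHess a b ρ (run.w (t + 1)))⁻¹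
        (barrierGrad a b ρ (run.w (t + 1)) + run.s (t + 1)) ≤ 2 * ε ∧
      matNorm (run.H t) (run.w (t + 1) - run.w t) ≤ 5 * (ε + τ) := by
    intro t ht inv
    rw [run.w_succ t ht]
    refine inv.newton hp ?_ (run.y_zero t ht) (fun k hk hpos => ?_) (run.y_succ t ht)
    · rw [run.s_succ t ht, add_sub_cancel_left]; exact hg t ht
    · have := run.h_spec t ht k hk (by rw [hint]; exact hpos)
      rwa [IsGradAnswer, hessian_regBarrier hpos, gradient_regBarrier fun i => (hpos i).ne']
        at this
  have main : ∀ t ≤ T, BaronsInv a b ρ ε (run.w t) (run.u t) (run.s t) (run.H t) := by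
    intro t
    induction t with
    | zero =>
      intro _
      have hpos : ∀ i, 0 < slack a b wstar i := by rw [hint] at hw; exact hw
      rw [run.w_zero, run.u_zero, run.s_zero]
      refine .renew hp.rho_pos hpos (run.H_zero hw) ?_
      rw [hgrad, add_zero, matNorm_zero]
      have := hp.eps_pos
      positivity
    | succ t ih =>
      intro ht
      have ht' : t < T := ht
      have inv := ih ht'.le
      obtain ⟨h1, h2, _⟩ := step t ht' inv
      by_cases hk : matNorm (run.H t) (run.w (t + 1) - run.u t) ≤ 1 / (41 * 1)
      · obtain ⟨e1, e2⟩ := run.keep t ht' hk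
        rw [e1, e2]
        rw [mul_one] at hk
        exact inv.keep hk h2
      · obtain ⟨e1, e2⟩ := run.renew t ht' hk
        have hpos := slack_pos_of_near hp.rho_pos inv.u_pos inv.hess h1
        rw [e1]
        exact .renew hp.rho_pos hpos (e2 (by rw [hint]; exact hpos)) h2
  intro t ht
  refine ⟨main t ht, fun ht' => ?_⟩
  obtain ⟨h1, _, h3⟩ := step t ht' (main t ht)
  exact ⟨h1, h3⟩

end Invariant

/-! ### Regret -/

section Regret

variable {d m : ℕ} {a : Fin m → EuclideanSpace ℝ (Fin d)} {b : Fin m → ℝ} {ρ ε τ : ℝ}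

/-- The Bregman divergence of the regularized barrier. -/
noncomputable def bregman (a : Fin m → EuclideanSpace ℝ (Fin d)) (b : Fin m → ℝ) (ρ : ℝ)
    (x y : EuclideanSpace ℝ (Fin d)) : ℝ :=
  regBarrier a b ρ x - regBarrier a b ρ y - inner ℝ (barrierGrad a b ρ y) (x - y)

/-- The slack ratio of x to y is 1 + h with h = ⟨a_i, x − y⟩/s_i(y), so the divergence separates
into scalar functions h − log(1 + h) and the quadratic part. -/
theorem bregman_eq {x y : EuclideanSpace ℝ (Fin d)} (hx : ∀ i, 0 < slack a b x i)
    (hy : ∀ i, 0 < slack a b y i) :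
    bregman a b ρ x y = ∑ i, (inner ℝ (a i) (x - y) / slack a b y i -
      Real.log (1 + inner ℝ (a i) (x - y) / slack a b y i)) + ρ / 2 * ‖x - y‖ ^ 2 := by
  have e1 : ∀ z, regBarrier a b ρ z = -∑ i, Real.log (slack a b z i) + ρ / 2 * ‖z‖ ^ 2 :=
    fun _ => rfl
  have e2 : ∀ i, Real.log (1 + inner ℝ (a i) (x - y) / slack a b y i) =
      Real.log (slack a b x i) - Real.log (slack a b y i) := by
    intro i
    rw [← Real.log_div (hx i).ne' (hy i).ne']
    congr 1
    have := (hy i).ne'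
    field_simp
    rw [inner_sub_right]; simp [slack]
  have e3 : inner ℝ (barrierGrad a b ρ y) (x - y) =
      -∑ i, inner ℝ (a i) (x - y) / slack a b y i + ρ * inner ℝ y (x - y) := by
    simp only [barrierGrad, inner_add_left, inner_neg_left, sum_inner, real_inner_smul_left,
      div_eq_inv_mul]
  have e4 : ‖x - y‖ ^ 2 = ‖x‖ ^ 2 - ‖y‖ ^ 2 - 2 * inner ℝ y (x - y) := by
    rw [norm_sub_sq_real, inner_sub_right, real_inner_self_eq_norm_sq, real_inner_comm x y]; ring
  rw [bregman, e1, e1, e3, e4]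
  simp only [e2, Finset.sum_sub_distrib]
  ring

theorem one_add_ratio_pos {x y : EuclideanSpace ℝ (Fin d)} (hx : ∀ i, 0 < slack a b x i)
    (hy : ∀ i, 0 < slack a b y i) (i : Fin m) :
    0 < 1 + inner ℝ (a i) (x - y) / slack a b y i := by
  have h1 : 1 + inner ℝ (a i) (x - y) / slack a b y i = slack a b x i / slack a b y i := by
    have := (hy i).ne'
    field_simp
    rw [inner_sub_right]; simp [slack]
  rw [h1]
  exact div_pos (hx i) (hy i)

theorem sub_log_one_add_le {h : ℝ} (hh : -(1 / 2) ≤ h) : h - Real.log (1 + h) ≤ 2 * h ^ 2 := by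
  have hp : 0 < 1 + h := by linarith
  have h1 := Real.one_sub_inv_le_log_of_pos hp
  have h2 : h - (1 - (1 + h)⁻¹) = h ^ 2 / (1 + h) := by field_simp; ring
  have h3 : h ^ 2 / (1 + h) ≤ 2 * h ^ 2 := by
    rw [div_le_iff₀ hp]; nlinarith [sq_nonneg h]
  linarith

/-- Linear growth of h − log(1 + h) up to a constant. For h ≥ 0 the tangent of the logarithm at 2
leaves slope 1/2, and 2 log 2 ≤ 2 settles the constant. -/
theorem abs_le_sub_log_one_add {h : ℝ} (hh : 0 < 1 + h) :
    |h| ≤ 2 * (h - Real.log (1 + h)) + 1 := by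
  have h1 := Real.log_le_sub_one_of_pos hh
  rcases abs_cases h with ⟨e, h0⟩ | ⟨e, h0⟩
  · have h2 := Real.log_le_sub_one_of_pos (x := (1 + h) / 2) (by linarith)
    rw [Real.log_div hh.ne' two_ne_zero] at h2
    have h3 := Real.log_two_lt_d9
    rw [e]; linarith
  · rw [e]; linarith

/-- A local norm of at most 1/2 bounds every ratio h by 1/2 in absolute value, where h − log(1 + h)
≤ 2h². -/
theorem bregman_le (hρ : 0 < ρ) {x y : EuclideanSpace ℝ (Fin d)}
    (hx : ∀ i, 0 < slack a b x i) (hy : ∀ i, 0 < slack a b y i) {r : ℝ} (hr : r ≤ 1 / 2)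
    (h : matNorm (barrierHess a b ρ y) (x - y) ≤ r) : bregman a b ρ x y ≤ 2 * r ^ 2 := by
  have hpd := (barrierHess_posDef hρ hy).posSemidef
  have h0 := matNorm_nonneg (barrierHess a b ρ y) (x - y)
  have h1 : quad (barrierHess a b ρ y) (x - y) ≤ r ^ 2 := by
    rw [← matNorm_sq hpd]; gcongr
  have hterm : ∀ i, inner ℝ (a i) (x - y) / slack a b y i -
      Real.log (1 + inner ℝ (a i) (x - y) / slack a b y i) ≤
      2 * (inner ℝ (a i) (x - y) / slack a b y i) ^ 2 := by
    intro i
    apply sub_log_one_add_le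
    have h2 := (slack_div_sq_le_quad hρ.le y (x - y) i).trans h1
    have h3 := abs_le.1 (abs_le_of_sq_le_sq h2 (h0.trans h))
    linarith [h3.1]
  have hsum := Finset.sum_le_sum fun i (_ : i ∈ Finset.univ) => hterm i
  rw [← Finset.mul_sum] at hsum
  rw [quad_barrierHess] at h1
  rw [bregman_eq hx hy]
  have : 0 ≤ ρ * ‖x - y‖ ^ 2 := by positivity
  linarith

/-- Controls the error of stopping at a point y with nonzero residual n, for x arbitrarily far away.
The local norm of x − y is at most Σ|h_i| + √ρ‖x − y‖, and 0.1·Σ|h_i| is absorbed by the linear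
growth of the divergence, at the price of 0.1 per constraint. -/
theorem neg_le_bregman_add_inner (hρ : 0 < ρ) {x y n : EuclideanSpace ℝ (Fin d)}
    (hx : ∀ i, 0 < slack a b x i) (hy : ∀ i, 0 < slack a b y i)
    (hn : matNorm (barrierHess a b ρ y)⁻¹ n ≤ 0.1) {D : ℝ} (hD : √ρ * ‖x - y‖ ≤ D) :
    -(0.1 * (m + D)) ≤ bregman a b ρ x y + inner ℝ n (x - y) := by
  have hpd := barrierHess_posDef hρ hy
  set h : Fin m → ℝ := fun i => inner ℝ (a i) (x - y) / slack a b y i with hh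
  have hb : bregman a b ρ x y = ∑ i, (h i - Real.log (1 + h i)) + ρ / 2 * ‖x - y‖ ^ 2 :=
    bregman_eq hx hy
  have hpos : ∀ i, 0 < 1 + h i := one_add_ratio_pos hx hy
  have hsum : ∑ i, |h i| ≤ 2 * ∑ i, (h i - Real.log (1 + h i)) + m := by
    calc ∑ i, |h i| ≤ ∑ i, (2 * (h i - Real.log (1 + h i)) + 1) :=
          Finset.sum_le_sum fun i _ => abs_le_sub_log_one_add (hpos i)
      _ = _ := by rw [Finset.sum_add_distrib, ← Finset.mul_sum]; simp
  have hS0 : 0 ≤ ∑ i, |h i| := Finset.sum_nonneg fun i _ => abs_nonneg _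
  have hD0 : 0 ≤ √ρ * ‖x - y‖ := by positivity
  have hnorm : matNorm (barrierHess a b ρ y) (x - y) ≤ ∑ i, |h i| + √ρ * ‖x - y‖ := by
    rw [matNorm_eq, quad_barrierHess]
    apply Real.sqrt_le_iff.2 ⟨by positivity, ?_⟩
    have h1 : ∑ i, h i ^ 2 ≤ (∑ i, |h i|) ^ 2 := by
      have := Finset.sum_sq_le_sq_sum_of_nonneg (s := Finset.univ) (f := fun i => |h i|)
        fun i _ => abs_nonneg _
      simpa using this
    have h2 : (√ρ * ‖x - y‖) ^ 2 = ρ * ‖x - y‖ ^ 2 := by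
      rw [mul_pow, Real.sq_sqrt hρ.le]
    nlinarith
  have hin := (abs_le.1 (abs_inner_le_matNorm hpd n (x - y))).1
  have hm0 := matNorm_nonneg (barrierHess a b ρ y) (x - y)
  have h1 : matNorm (barrierHess a b ρ y)⁻¹ n * matNorm (barrierHess a b ρ y) (x - y) ≤
      0.1 * matNorm (barrierHess a b ρ y) (x - y) := by gcongr
  have h2 : 0 ≤ ρ / 2 * ‖x - y‖ ^ 2 := by positivity
  have h3 : 0 ≤ ∑ i, (h i - Real.log (1 + h i)) := Finset.sum_nonneg fun i _ => by
    have := Real.log_le_sub_one_of_pos (hpos i)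
    linarith
  linarith

/-- Approximate follow-the-regularized-leader: the regret in terms of the residual gradients and
of the distances between successive iterates. -/
theorem linear_regret_le (hρ : 0 < ρ) {η : ℝ} {T : ℕ} {w s g : ℕ → EuclideanSpace ℝ (Fin d)}
    {z : EuclideanSpace ℝ (Fin d)} (hz : ∀ i, 0 < slack a b z i)
    (hw : ∀ t ≤ T, ∀ i, 0 < slack a b (w t) i)
    (h0 : barrierGrad a b ρ (w 0) + s 0 = 0) (hs : ∀ t < T, s (t + 1) = s t + η • g t)
    {e r D : ℝ} (he : e ≤ 0.1) (hr : r ≤ 1 / 2)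
    (hres : ∀ t ≤ T, matNorm (barrierHess a b ρ (w t))⁻¹ (barrierGrad a b ρ (w t) + s t) ≤ e)
    (hstep : ∀ t < T, matNorm (barrierHess a b ρ (w (t + 1))) (w t - w (t + 1)) ≤ r)
    (hD : √ρ * ‖z - w T‖ ≤ D) :
    η * ∑ t ∈ Finset.range T, inner ℝ (g t) (w t - z) ≤
      bregman a b ρ z (w 0) + 0.1 * (m + D) + T * (2 * r ^ 2 + e * r) := by
  set n : ℕ → EuclideanSpace ℝ (Fin d) := fun t => barrierGrad a b ρ (w t) + s t with hn
  -- The subtracted bracket is Φ_t(z) − Φ_t(w_t) for the follow-the-leader objective Φ_t = Φ + ⟨s_t,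
  -- ·⟩.
  have key : ∀ t ≤ T, η * ∑ t ∈ Finset.range t, inner ℝ (g t) (w t - z) ≤
      bregman a b ρ z (w 0) - (bregman a b ρ z (w t) + inner ℝ (n t) (z - w t)) +
        t * (2 * r ^ 2 + e * r) := by
    intro t
    induction t with
    | zero =>
      intro _
      have : n 0 = 0 := h0
      simp [this]
    | succ t ih =>
      intro ht
      have ht' : t < T := ht
      have h1 := ih ht'.le
      have hpos := hw (t + 1) ht
      have h2 := bregman_le hρ (hw t ht'.le) hpos hr (hstep t ht')
      have h3 := (abs_le.1 (abs_inner_le_matNorm (barrierHess_posDef hρ hpos) (n (t + 1))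
        (w t - w (t + 1)))).2
      have h4 : matNorm (barrierHess a b ρ (w (t + 1)))⁻¹ (n (t + 1)) *
          matNorm (barrierHess a b ρ (w (t + 1))) (w t - w (t + 1)) ≤ e * r :=
        mul_le_mul (hres (t + 1) ht) (hstep t ht') (matNorm_nonneg _ _)
          ((matNorm_nonneg _ _).trans (hres (t + 1) ht))
      -- The three-point identity: beyond the telescoping potential, a round costs D(w_t, w_{t+1})
      -- and the pairing of the new residual with the move.
      have h5 : η * inner ℝ (g t) (w t - z) =
          (bregman a b ρ z (w t) + inner ℝ (n t) (z - w t)) -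
          (bregman a b ρ z (w (t + 1)) + inner ℝ (n (t + 1)) (z - w (t + 1))) +
          bregman a b ρ (w t) (w (t + 1)) + inner ℝ (n (t + 1)) (w t - w (t + 1)) := by
        have e1 : η * inner ℝ (g t) (w t - z) = inner ℝ (s (t + 1) - s t) (w t - z) := by
          rw [hs t ht', add_sub_cancel_left, real_inner_smul_left]
        rw [e1]
        simp only [hn, bregman, inner_add_left, inner_sub_left, inner_sub_right]
        ring
      rw [Finset.sum_range_succ, mul_add, h5]
      push_cast
      linarith
  have h1 := key T le_rfl
  have h2 := neg_le_bregman_add_inner hρ hz (hw T le_rfl) ((hres T le_rfl).trans he) hD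
  linarith

theorem barrierGrad_eq_zero_of_isMinOn (ha : ∀ i, a i ≠ 0) {x : EuclideanSpace ℝ (Fin d)}
    (hx : x ∈ interior (polytope a b))
    (hmin : IsMinOn (regBarrier a b ρ) (interior (polytope a b)) x) :
    barrierGrad a b ρ x = 0 := by
  have hloc : IsLocalMin (regBarrier a b ρ) x := hmin.isLocalMin (isOpen_interior.mem_nhds hx)
  rw [interior_polytope ha] at hx
  have h := hasGradientAt_iff_hasFDerivAt.1
    (hasGradientAt_regBarrier (ρ := ρ) fun i => (hx i).ne')
  simpa using hloc.hasFDerivAt_eq_zero h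

/-- The comparator shrunk towards the minimizer has small regularization. -/
theorem bregman_shrink_le (hρ : 0 < ρ) {x z : EuclideanSpace ℝ (Fin d)}
    (hx : ∀ i, 0 < slack a b x i) (hgrad : barrierGrad a b ρ x = 0) {T R : ℝ} (hT : 0 < T)
    (hz : ∀ i, slack a b x i / T ≤ slack a b z i) (hR : ‖z‖ ≤ R) :
    bregman a b ρ z x ≤ m * Real.log T + ρ / 2 * R ^ 2 := by
  have e1 : ∀ z, regBarrier a b ρ z = -∑ i, Real.log (slack a b z i) + ρ / 2 * ‖z‖ ^ 2 :=
    fun _ => rfl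
  have h1 : ∑ i, (Real.log (slack a b x i) - Real.log T) ≤ ∑ i, Real.log (slack a b z i) := by
    refine Finset.sum_le_sum fun i _ => ?_
    rw [← Real.log_div (hx i).ne' hT.ne']
    exact Real.log_le_log (div_pos (hx i) hT) (hz i)
  rw [Finset.sum_sub_distrib] at h1
  simp only [Finset.sum_const, Finset.card_univ, Fintype.card_fin, nsmul_eq_mul] at h1
  have h2 : ρ / 2 * ‖z‖ ^ 2 ≤ ρ / 2 * R ^ 2 := by gcongr
  have h3 : 0 ≤ ρ / 2 * ‖x‖ ^ 2 := by positivity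
  rw [bregman, hgrad, inner_zero_left, e1, e1]
  linarith

end Regret

/-! ### The parameters of BARONS with the hybrid barrier -/

section Parameters

variable {d m : ℕ} {a : Fin m → EuclideanSpace ℝ (Fin d)} {b : Fin m → ℝ} {R G : ℝ} {T N : ℕ}

/-- A bounded nonempty polytope has at least as many constraints as dimensions. -/
theorem dim_le_card (hR : polytope a b ⊆ Metric.closedBall 0 R)
    {x : EuclideanSpace ℝ (Fin d)} (hx : x ∈ polytope a b) : d ≤ m := by
  let L : EuclideanSpace ℝ (Fin d) →ₗ[ℝ] (Fin m → ℝ) :=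
    LinearMap.pi fun i => (innerSL ℝ (a i)).toLinearMap
  have hL : Function.Injective L := by
    rw [injective_iff_map_eq_zero]
    intro v hv
    by_contra hne
    obtain ⟨i, hi⟩ := exists_inner_ne_zero hR hx hne
    exact hi (congrFun hv i)
  simpa using LinearMap.finrank_le_finrank_of_injective hL

/-- Here 20000² = 4·10⁸. Besides log T ≥ 1 for m ≥ 1, this yields m ≤ T, which lets the
initialization cost disappear in the cost of the rounds. -/
theorem card_le_rounds (hT : 1 ≤ T) (hε : gradTol m T ≤ 1 / 20000) :
    400000000 * (m : ℝ) ≤ T := by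
  have hT' : (0 : ℝ) < T := by exact_mod_cast hT
  rw [gradTol, Real.sqrt_le_left (by norm_num), div_le_iff₀ hT'] at hε
  linarith

theorem tau_eq (hm : 0 < m) (hR : 0 < R) (hG : 0 < G) :
    stepSize m R G T * (R * G / √(m : ℝ)) = √((m : ℝ) * ((Real.log T + 1) / T)) := by
  have hm' : (0 : ℝ) < m := by exact_mod_cast hm
  have h : (m : ℝ) / √(m : ℝ) = √m := Real.div_sqrt
  rw [Real.sqrt_mul hm'.le, stepSize]
  calc _ = m / √(m : ℝ) * √((Real.log T + 1) / T) := by field_simp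
    _ = _ := by rw [h]

theorem baronsParams (hm : 0 < m) (hR : 0 < R) (hG : 0 < G) (hT : 1 ≤ T) (hN : 1 ≤ N)
    (hτ : stepSize m R G T * (R * G / √(m : ℝ)) ≤ 1 / 1000) (hε : gradTol m T ≤ 1 / 20000)
    (hlog : 1 * Real.log (1 / gradTol m T) ≤ N) :
    BaronsParams (m / R ^ 2) (gradTol m T) (stepSize m R G T * (R * G / √(m : ℝ))) N := by
  have hm' : (0 : ℝ) < m := by exact_mod_cast hm
  have hT' : (0 : ℝ) < T := by exact_mod_cast hT
  refine ⟨by positivity, Real.sqrt_pos.2 (by positivity), hε, ?_, hτ, hN, by linarith⟩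
  rw [tau_eq hm hR hG]
  positivity

theorem norm_step_le (hm : 0 < m) (hR : 0 < R) (hG : 0 < G) {g : EuclideanSpace ℝ (Fin d)}
    (hg : ‖g‖ ≤ G) :
    ‖stepSize m R G T • g‖ / √((m : ℝ) / R ^ 2) ≤ stepSize m R G T * (R * G / √(m : ℝ)) := by
  have hm' : (0 : ℝ) < m := by exact_mod_cast hm
  have hη : 0 ≤ stepSize m R G T := by unfold stepSize; positivity
  rw [norm_smul, Real.norm_of_nonneg hη, Real.sqrt_div hm'.le, Real.sqrt_sq hR.le, mul_div_assoc]
  apply mul_le_mul_of_nonneg_left _ hη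
  rw [div_div_eq_mul_div, mul_comm]
  gcongr

theorem one_le_log (hT : (400000000 : ℝ) ≤ T) : 1 ≤ Real.log T := by
  rw [Real.le_log_iff_exp_le (by linarith)]
  have := Real.exp_one_lt_d9
  linarith

/-- The accumulated accuracy of the rounds. -/
theorem rounds_mul_sq_le (hm : 0 < m) (hR : 0 < R) (hG : 0 < G)
    (hT : (400000000 : ℝ) ≤ T) :
    T * (gradTol m T + stepSize m R G T * (R * G / √(m : ℝ))) ^ 2 ≤
      4 * (m * (Real.log T + 1)) := by
  have hm' : (0 : ℝ) < m := by exact_mod_cast hm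
  have hT' : (0 : ℝ) < T := by linarith
  have hL := one_le_log hT
  have h1 : gradTol m T ^ 2 * T = m := by
    rw [gradTol, Real.sq_sqrt (by positivity)]; field_simp
  have h2 : (stepSize m R G T * (R * G / √(m : ℝ))) ^ 2 * T = m * (Real.log T + 1) := by
    rw [tau_eq hm hR hG, Real.sq_sqrt (by positivity)]; field_simp
  set x := gradTol m T
  set y := stepSize m R G T * (R * G / √(m : ℝ))
  nlinarith [sq_nonneg (x - y)]

/-- The step size is tuned so that η·RG√(T(log T + 1)) = m(log T + 1); the factor 2 replaces log T +
1 by log T. -/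
theorem regret_bound (hm : 0 < m) (hR : 0 < R) (hG : 0 < G)
    (hT : (400000000 : ℝ) ≤ T) {S c : ℝ} (hc : 0 ≤ c)
    (hS : stepSize m R G T * S ≤ c * (m * (Real.log T + 1))) :
    S ≤ 2 * c * (R * G * √(T * Real.log T)) := by
  have hm' : (0 : ℝ) < m := by exact_mod_cast hm
  have hT' : (0 : ℝ) < T := by linarith
  have hL := one_le_log hT
  have hx : 0 < √((Real.log T + 1) / T) := Real.sqrt_pos.2 (by positivity)
  have hη : 0 < stepSize m R G T := by unfold stepSize; positivity
  have h1 : stepSize m R G T * (R * G * √(T * (Real.log T + 1))) = m * (Real.log T + 1) := by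
    have : √((Real.log T + 1) / T) * √(T * (Real.log T + 1)) = Real.log T + 1 := by
      rw [← Real.sqrt_mul (by positivity)]
      rw [show (Real.log T + 1) / T * (T * (Real.log T + 1)) = (Real.log T + 1) ^ 2 by field_simp]
      exact Real.sqrt_sq (by linarith)
    rw [stepSize]
    calc _ = m * (√((Real.log T + 1) / T) * √(T * (Real.log T + 1))) := by field_simp
      _ = _ := by rw [this]
  have h2 : S ≤ c * (R * G * √(T * (Real.log T + 1))) := by
    refine le_of_mul_le_mul_left ?_ hη
    rw [← h1] at hS
    linarith
  have h3 : √(T * (Real.log T + 1)) ≤ 2 * √(T * Real.log T) := by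
    rw [Real.sqrt_le_left (by positivity), mul_pow, Real.sq_sqrt (by positivity)]
    nlinarith
  calc S ≤ c * (R * G * √(T * (Real.log T + 1))) := h2
    _ ≤ c * (R * G * (2 * √(T * Real.log T))) := by gcongr
    _ = _ := by ring

theorem slack_shrink {x w : EuclideanSpace ℝ (Fin d)} (hw : ∀ i, 0 < slack a b w i) {T : ℝ}
    (hT : 1 ≤ T) (i : Fin m) :
    slack a b x i / T ≤ slack a b (w + (1 / T) • (x - w)) i := by
  have e : slack a b (w + (1 / T) • (x - w)) i =
      slack a b x i / T + (1 - 1 / T) * slack a b w i := by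
    simp only [slack, inner_add_right, inner_smul_right, inner_sub_right]
    ring
  rw [e]
  have h1 : 1 / T ≤ 1 := by rw [div_le_one (by linarith)]; exact hT
  have := mul_nonneg (sub_nonneg.2 h1) (hw i).le
  linarith

/-- The linearized regret is measured against z = w + (w* − w)/T, whose slacks are at least 1/T
times those of w*. Passing from z back to w costs at most 2RG/T per round. -/
theorem barons_regret (hd : 0 < d) (hR : 0 < R) (hG : 0 < G) (hT : 1 ≤ T) (hN : 1 ≤ N)
    (ha : ∀ i, a i ≠ 0) (hpoly : polytope a b ⊆ Metric.closedBall 0 R)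
    {wstar : EuclideanSpace ℝ (Fin d)} (hwstar : wstar ∈ interior (polytope a b))
    {Φ : EuclideanSpace ℝ (Fin d) → ℝ} {η ε ρ : ℝ} (hΦ : Φ = regBarrier a b ρ)
    (hρ : ρ = m / R ^ 2) (hη : η = stepSize m R G T) (hεT : ε = gradTol m T)
    (hmin : IsMinOn Φ (interior (polytope a b)) wstar)
    (hτ : η * (R * G / √(m : ℝ)) ≤ 1 / 1000) (hε : ε ≤ 1 / 20000)
    (hlog : 1 * Real.log (1 / ε) ≤ N)
    {g : ℕ → EuclideanSpace ℝ (Fin d)} {ℓ : ℕ → EuclideanSpace ℝ (Fin d) → ℝ}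
    (run : BaronsRun (polytope a b) Φ 1 η ε 0.001 N T wstar g)
    (hg : ∀ t < T, ‖g t‖ ≤ G)
    (hsub : ∀ t < T, run.w t ∈ polytope a b →
      IsSubgradient (polytope a b) (ℓ t) (run.w t) (g t)) :
    (∀ t < T, run.w t ∈ interior (polytope a b)) ∧
      ∀ w ∈ interior (polytope a b),
        ∑ t ∈ Finset.range T, (ℓ t (run.w t) - ℓ t w) ≤
          1000 * (R * G * √(T * Real.log T)) := by
  have hdm := dim_le_card hpoly (interior_subset hwstar)
  have hm : 0 < m := by omega
  have hm' : (1 : ℝ) ≤ m := by exact_mod_cast hm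
  have hTm := card_le_rounds hT (hεT ▸ hε)
  have hTbig : (400000000 : ℝ) ≤ T := by linarith
  have hT' : (0 : ℝ) < T := by linarith
  have hL := one_le_log hTbig
  have hint := interior_polytope (b := b) ha
  obtain ⟨τ, hτ'⟩ : ∃ τ, τ = η * (R * G / √(m : ℝ)) := ⟨_, rfl⟩
  have hp : BaronsParams ρ ε τ N := by
    rw [hτ', hρ, hη, hεT]
    exact baronsParams hm hR hG hT hN (hη ▸ hτ) (hεT ▸ hε) (hεT ▸ hlog)
  have hgτ : ∀ t < T, ‖η • g t‖ / √ρ ≤ τ := fun t ht => by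
    rw [hτ', hρ, hη]
    exact norm_step_le hm hR hG (hg t ht)
  have hsum : T * (ε + τ) ^ 2 ≤ 4 * (m * (Real.log T + 1)) := by
    rw [hτ', hη, hεT]
    exact rounds_mul_sq_le hm hR hG hTbig
  subst hΦ
  have hgrad := barrierGrad_eq_zero_of_isMinOn ha hwstar hmin
  have inv := run.invariant ha hp hwstar hgrad hgτ
  have hpos : ∀ t ≤ T, ∀ i, 0 < slack a b (run.w t) i := fun t ht =>
    (inv t ht).1.w_pos hp.rho_pos
  have hwint : ∀ t < T, run.w t ∈ interior (polytope a b) := fun t ht => by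
    rw [hint]; exact hpos t ht.le
  refine ⟨hwint, fun w hw => ?_⟩
  have hwpos : ∀ i, 0 < slack a b w i := by rw [hint] at hw; exact hw
  have hxpos : ∀ i, 0 < slack a b wstar i := by rw [hint] at hwstar; exact hwstar
  set z := w + (1 / (T : ℝ)) • (wstar - w) with hzdef
  have hzs : ∀ i, slack a b wstar i / T ≤ slack a b z i :=
    slack_shrink hwpos (by linarith)
  have hzpos : ∀ i, 0 < slack a b z i := fun i => (div_pos (hxpos i) hT').trans_le (hzs i)
  have hball : ∀ x, (∀ i, 0 < slack a b x i) → ‖x‖ ≤ R := fun x hx => by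
    have : x ∈ interior (polytope a b) := by rw [hint]; exact hx
    exact mem_closedBall_zero_iff.1 (hpoly (interior_subset this))
  have hsqρ : √ρ = √m / R := by
    rw [hρ, Real.sqrt_div (by positivity), Real.sqrt_sq hR.le]
  have hsqm : √(m : ℝ) ≤ m := by
    rw [Real.sqrt_le_left (by positivity)]; nlinarith
  have hB := bregman_shrink_le hp.rho_pos hxpos hgrad hT' hzs (hball z hzpos)
  have hρR : ρ / 2 * R ^ 2 = m / 2 := by rw [hρ]; field_simp
  have hlin := linear_regret_le hp.rho_pos (η := η) (g := g) (r := 1.1 * (5 * (ε + τ)))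
    (e := 2 * ε) (D := 2 * m) hzpos hpos
    (by rw [run.w_zero, run.s_zero, hgrad, add_zero]) run.s_succ
    (by linarith [hp.eps_le]) (by linarith [hp.eps_le, hp.tau_le])
    (fun t ht => (inv t ht).1.residual)
    (fun t ht => matNorm_hess_step_le hp.rho_pos (inv t ht.le).1 ((inv t ht.le).2 ht).1
      ((inv t ht.le).2 ht).2)
    (by
      have h1 := norm_sub_le z (run.w T)
      have h2 := hball z hzpos
      have h3 := hball _ (hpos T le_rfl)
      calc √ρ * ‖z - run.w T‖ ≤ √m / R * (2 * R) := by
            rw [hsqρ]; gcongr; linarith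
        _ = 2 * √m := by field_simp
        _ ≤ 2 * m := by linarith)
  rw [run.w_zero] at hlin
  have hquad : (T : ℝ) * (2 * (1.1 * (5 * (ε + τ))) ^ 2 + 2 * ε * (1.1 * (5 * (ε + τ)))) ≤
      72 * (T * (ε + τ) ^ 2) := by
    have h1 : ε ≤ ε + τ := by linarith [hp.tau_nonneg]
    have h2 := hp.eps_pos
    have h3 : ε * (ε + τ) ≤ (ε + τ) ^ 2 := by nlinarith [hp.tau_nonneg]
    have h4 : 2 * (1.1 * (5 * (ε + τ))) ^ 2 + 2 * ε * (1.1 * (5 * (ε + τ))) ≤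
        72 * (ε + τ) ^ 2 := by nlinarith
    calc _ ≤ (T : ℝ) * (72 * (ε + τ) ^ 2) := by gcongr
      _ = _ := by ring
  -- The contributions are m log T + m/2 from the comparator, 0.3m from the last residual, and
  -- 72·4·m(log T + 1) from the moves.
  have htot : η * ∑ t ∈ Finset.range T, inner ℝ (g t) (run.w t - z) ≤
      300 * (m * (Real.log T + 1)) := by
    have hX : (m : ℝ) * (Real.log T + 1) = m * Real.log T + m := by ring
    have hmL : 0 ≤ (m : ℝ) * Real.log T := by positivity
    linarith
  have hreg := regret_bound (S := ∑ t ∈ Finset.range T, inner ℝ (g t) (run.w t - z)) (c := 300)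
    hm hR hG hTbig (by norm_num) (by rw [← hη]; exact htot)
  have hTL : 1 ≤ √(T * Real.log T) := by
    rw [Real.one_le_sqrt]; nlinarith
  have hRG : 0 < R * G := by positivity
  have hshrink : ∀ t < T, inner ℝ (g t) (z - w) ≤ 2 * (R * G) / T := by
    intro t ht
    have h1 := real_inner_le_norm (g t) (z - w)
    have h2 : ‖z - w‖ ≤ 2 * R / T := by
      rw [hzdef, add_sub_cancel_left, norm_smul, Real.norm_of_nonneg (by positivity)]
      have h3 := norm_sub_le wstar w
      have h4 := hball _ hwpos
      have h5 := hball _ hxpos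
      rw [div_mul_eq_mul_div, one_mul]
      gcongr
      linarith
    calc _ ≤ ‖g t‖ * ‖z - w‖ := h1
      _ ≤ G * (2 * R / T) := by
          have := hg t ht
          gcongr
      _ = _ := by ring
  have hterm : ∀ t ∈ Finset.range T, ℓ t (run.w t) - ℓ t w ≤
      inner ℝ (g t) (run.w t - z) + 2 * (R * G) / T := by
    intro t ht
    have ht' := Finset.mem_range.1 ht
    have h1 := hsub t ht' (interior_subset (hwint t ht')) w (interior_subset hw)
    have h2 := hshrink t ht'
    have h3 : inner ℝ (g t) (run.w t - z) + inner ℝ (g t) (z - w) = -inner ℝ (g t) (w - run.w t) := by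
      rw [← inner_add_right, ← inner_neg_right]
      congr 1
      abel
    linarith
  have hfin := Finset.sum_le_sum hterm
  rw [Finset.sum_add_distrib, Finset.sum_const, Finset.card_range, nsmul_eq_mul,
    mul_div_cancel₀ _ hT'.ne'] at hfin
  have hRGs := le_mul_of_one_le_right hRG.le hTL
  linarith

end Parameters

/-! ### Composing computation trees -/

namespace ArithTree

/-- Rename the available values of a tree. -/
def reindex : {ι κ o : Type} → (ι → κ) → ArithTree ι o → ArithTree κ o
  | _, _, _, φ, .ret out => .ret (φ ∘ out)
  | _, _, _, φ, .const c next => .const c (next.reindex (Option.map φ))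
  | _, _, _, φ, .op f i j next => .op f (φ i) (φ j) (next.reindex (Option.map φ))
  | _, _, _, φ, .branch i j yes no => .branch (φ i) (φ j) (yes.reindex φ) (no.reindex φ)

theorem pushVal_comp_map {ι κ : Type} (φ : ι → κ) (x : κ → ℝ) (c : ℝ) :
    pushVal x c ∘ Option.map φ = pushVal (x ∘ φ) c := by
  funext k; cases k <;> rfl

theorem eval_reindex {ι o : Type} (t : ArithTree ι o) :
    ∀ {κ : Type} (φ : ι → κ) (x : κ → ℝ), (t.reindex φ).eval x = t.eval (x ∘ φ) := by
  induction t with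
  | ret out => intros; rfl
  | const c next ih => intro κ φ x; simp [reindex, eval, ih, pushVal_comp_map]
  | op f i j next ih => intro κ φ x; simp [reindex, eval, ih, pushVal_comp_map]
  | branch i j yes no ih1 ih2 => intro κ φ x; simp [reindex, eval, ih1, ih2]

theorem cost_reindex {ι o : Type} (t : ArithTree ι o) :
    ∀ {κ : Type} (φ : ι → κ) (x : κ → ℝ), (t.reindex φ).cost x = t.cost (x ∘ φ) := by
  induction t with
  | ret out => intros; rfl
  | const c next ih => intro κ φ x; simp [reindex, cost, ih, pushVal_comp_map]
  | op f i j next ih => intro κ φ x; simp [reindex, cost, ih, pushVal_comp_map]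
  | branch i j yes no ih1 ih2 => intro κ φ x; simp [reindex, cost, ih1, ih2]

/-- Run a second tree on the outputs of a first one. -/
def seq : {ι o o' : Type} → ArithTree ι o → ArithTree o o' → ArithTree ι o'
  | _, _, _, .ret out, t => t.reindex out
  | _, _, _, .const c next, t => .const c (next.seq t)
  | _, _, _, .op f i j next, t => .op f i j (next.seq t)
  | _, _, _, .branch i j yes no, t => .branch i j (yes.seq t) (no.seq t)

theorem eval_seq {ι o : Type} (t : ArithTree ι o) {o' : Type} (t' : ArithTree o o') (x : ι → ℝ) :
    (t.seq t').eval x = t'.eval (t.eval x) := by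
  induction t with
  | ret out => simp [seq, eval, eval_reindex]; rfl
  | const c next ih => simp [seq, eval, ih]
  | op f i j next ih => simp [seq, eval, ih]
  | branch i j yes no ih1 ih2 => simp only [seq, eval, ih1, ih2]; split_ifs <;> rfl

theorem cost_seq {ι o : Type} (t : ArithTree ι o) {o' : Type} (t' : ArithTree o o') (x : ι → ℝ) :
    (t.seq t').cost x = t.cost x + t'.cost (t.eval x) := by
  induction t with
  | ret out => simp [seq, eval, cost, cost_reindex]; rfl
  | const c next ih => simp only [seq, eval, cost, ih]; ring
  | op f i j next ih => simp only [seq, eval, cost, ih]; ring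
  | branch i j yes no ih1 ih2 => simp only [seq, eval, cost, ih1, ih2]; split_ifs <;> ring

/-- Output some of the available values along with the outputs of a tree. -/
def retain : {ι κ o : Type} → (κ → ι) → ArithTree ι o → ArithTree ι (κ ⊕ o)
  | _, _, _, φ, .ret out => .ret (Sum.elim φ out)
  | _, _, _, φ, .const c next => .const c (next.retain (some ∘ φ))
  | _, _, _, φ, .op f i j next => .op f i j (next.retain (some ∘ φ))
  | _, _, _, φ, .branch i j yes no => .branch i j (yes.retain φ) (no.retain φ)

theorem eval_retain {ι o : Type} (t : ArithTree ι o) :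
    ∀ {κ : Type} (φ : κ → ι) (x : ι → ℝ),
      (t.retain φ).eval x = Sum.elim (x ∘ φ) (t.eval x) := by
  induction t with
  | ret out => intro κ φ x; funext k; cases k <;> rfl
  | const c next ih => intro κ φ x; simp only [retain, eval, ih]; rfl
  | op f i j next ih => intro κ φ x; simp only [retain, eval, ih]; rfl
  | branch i j yes no ih1 ih2 =>
    intro κ φ x; simp only [retain, eval, ih1, ih2]; split_ifs <;> rfl

theorem cost_retain {ι o : Type} (t : ArithTree ι o) :
    ∀ {κ : Type} (φ : κ → ι) (x : ι → ℝ), (t.retain φ).cost x = t.cost x := by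
  induction t with
  | ret out => intros; rfl
  | const c next ih => intro κ φ x; simp only [retain, cost, ih]
  | op f i j next ih => intro κ φ x; simp only [retain, cost, ih]
  | branch i j yes no ih1 ih2 => intro κ φ x; simp only [retain, cost, ih1, ih2]

end ArithTree

/-- The map `f` is computed by a tree in at most `n` steps on every input. -/
def Computes {ι o : Type} (f : (ι → ℝ) → o → ℝ) (n : ℕ) : Prop :=
  ∃ t : ArithTree ι o, ∀ x, t.eval x = f x ∧ t.cost x ≤ n

/-- The scalar function `f` is computed by a tree in at most `n` steps on every input. -/
def ComputesScalar {ι : Type} (f : (ι → ℝ) → ℝ) (n : ℕ) : Prop :=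
  Computes (fun x (_ : Unit) => f x) n

section Computes

variable {ι κ o o' : Type}

theorem Computes.mono {f : (ι → ℝ) → o → ℝ} {n k : ℕ} (h : Computes f n) (hnk : n ≤ k) :
    Computes f k := by
  obtain ⟨t, ht⟩ := h
  exact ⟨t, fun x => ⟨(ht x).1, (ht x).2.trans hnk⟩⟩

theorem computes_select (φ : o → ι) : Computes (fun (x : ι → ℝ) k => x (φ k)) 0 :=
  ⟨.ret φ, fun _ => ⟨rfl, le_rfl⟩⟩

theorem Computes.comp {f : (ι → ℝ) → o → ℝ} {g : (o → ℝ) → o' → ℝ} {n k : ℕ}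
    (hf : Computes f n) (hg : Computes g k) : Computes (fun x => g (f x)) (n + k) := by
  obtain ⟨t, ht⟩ := hf
  obtain ⟨t', ht'⟩ := hg
  refine ⟨t.seq t', fun x => ⟨?_, ?_⟩⟩
  · rw [ArithTree.eval_seq, (ht x).1, (ht' _).1]
  · rw [ArithTree.cost_seq, (ht x).1]
    exact Nat.add_le_add (ht x).2 (ht' _).2

theorem Computes.select {f : (ι → ℝ) → o → ℝ} {n : ℕ} (hf : Computes f n) (φ : o' → o) :
    Computes (fun x k => f x (φ k)) n :=
  hf.comp (computes_select φ)

theorem Computes.precomp {f : (ι → ℝ) → o → ℝ} {n : ℕ} (hf : Computes f n) (φ : ι → κ) :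
    Computes (fun x => f fun k => x (φ k)) n :=
  ((computes_select φ).comp hf).mono (zero_add n).le

theorem Computes.retain {f : (ι → ℝ) → o → ℝ} {n : ℕ} (hf : Computes f n) :
    Computes (fun x => Sum.elim x (f x)) n := by
  obtain ⟨t, ht⟩ := hf
  refine ⟨t.retain id, fun x => ⟨?_, ?_⟩⟩
  · rw [ArithTree.eval_retain, (ht x).1]; rfl
  · rw [ArithTree.cost_retain]; exact (ht x).2

/-- Use the result of one computation in another. -/
theorem Computes.bind {f : (ι → ℝ) → o → ℝ} {g : (ι ⊕ o → ℝ) → o' → ℝ} {n k : ℕ}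
    (hf : Computes f n) (hg : Computes g k) :
    Computes (fun x => g (Sum.elim x (f x))) (n + k) :=
  hf.retain.comp hg

theorem Computes.pair {f : (ι → ℝ) → o → ℝ} {g : (ι → ℝ) → o' → ℝ} {n k : ℕ}
    (hf : Computes f n) (hg : Computes g k) :
    Computes (fun x => Sum.elim (f x) (g x)) (n + k) := by
  have h := hf.retain.comp (hg.precomp (Sum.inl : ι → ι ⊕ o)).retain
  have h2 := h.select (Sum.elim (fun i : o => Sum.inl (Sum.inr i)) (fun j : o' => Sum.inr j))
  convert h2 using 1
  funext x k
  cases k <;> rfl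

theorem ComputesScalar.const (c : ℝ) : ComputesScalar (fun _ : ι → ℝ => c) 1 :=
  ⟨.const c (.ret fun _ => none), fun _ => ⟨rfl, le_rfl⟩⟩

theorem ComputesScalar.var (i : ι) : ComputesScalar (fun x : ι → ℝ => x i) 0 :=
  computes_select fun _ => i

theorem ComputesScalar.op (p : ArithOp) {f g : (ι → ℝ) → ℝ} {n k : ℕ} (hf : ComputesScalar f n)
    (hg : ComputesScalar g k) : ComputesScalar (fun x => p.apply (f x) (g x)) (n + k + 1) := by
  refine (Computes.pair hf hg).comp
    (g := fun (y : Unit ⊕ Unit → ℝ) (_ : Unit) => p.apply (y (.inl ())) (y (.inr ()))) ?_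
  exact ⟨.op p (.inl ()) (.inr ()) (.ret fun _ => none), fun _ => ⟨rfl, le_rfl⟩⟩

theorem ComputesScalar.add {f g : (ι → ℝ) → ℝ} {n k : ℕ} (hf : ComputesScalar f n)
    (hg : ComputesScalar g k) : ComputesScalar (fun x => f x + g x) (n + k + 1) :=
  .op .add hf hg

theorem ComputesScalar.sub {f g : (ι → ℝ) → ℝ} {n k : ℕ} (hf : ComputesScalar f n)
    (hg : ComputesScalar g k) : ComputesScalar (fun x => f x - g x) (n + k + 1) :=
  .op .sub hf hg

theorem ComputesScalar.mul {f g : (ι → ℝ) → ℝ} {n k : ℕ} (hf : ComputesScalar f n)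
    (hg : ComputesScalar g k) : ComputesScalar (fun x => f x * g x) (n + k + 1) :=
  .op .mul hf hg

theorem ComputesScalar.div {f g : (ι → ℝ) → ℝ} {n k : ℕ} (hf : ComputesScalar f n)
    (hg : ComputesScalar g k) : ComputesScalar (fun x => f x / g x) (n + k + 1) :=
  .op .div hf hg

/-- Compute a finite family of scalars. -/
theorem computes_pi [Fintype o] {n : ℕ} : ∀ {f : (ι → ℝ) → o → ℝ},
    (∀ k, ComputesScalar (fun x => f x k) n) → Computes f (Fintype.card o * n) := by
  have key : Finite o := inferInstance
  revert key
  suffices H : ∀ (o : Type) [Finite o] (f : (ι → ℝ) → o → ℝ),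
      (∀ k, ComputesScalar (fun x => f x k) n) → Computes f (Nat.card o * n) by
    intro _ f hf
    rw [← Nat.card_eq_fintype_card]
    exact H o f hf
  intro o ho
  -- Induction over finite types up to equivalence, one output being adjoined at a time; the
  -- statement is therefore generalized over the output type and the family.
  refine Finite.induction_empty_option (P := fun o => ∀ (f : (ι → ℝ) → o → ℝ),
      (∀ k, ComputesScalar (fun x => f x k) n) → Computes f (Nat.card o * n)) ?_ ?_ ?_ o
  · intro α β e ih f hf
    have h := (ih (fun x k => f x (e k)) fun k => hf (e k)).select e.symm
    simp only [Equiv.apply_symm_apply] at h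
    rwa [Nat.card_congr e] at h
  · intro f _
    exact ⟨.ret PEmpty.elim, fun x => ⟨funext fun k => k.elim, Nat.zero_le _⟩⟩
  · intro α _ ih f hf
    have h := ((hf none).pair (ih (fun x k => f x (some k)) fun k => hf (some k))).select
      (fun k : Option α => k.elim (Sum.inl ()) Sum.inr)
    have e : Nat.card (Option α) = Nat.card α + 1 := by simp
    rw [e, add_mul, one_mul, add_comm]
    convert h using 1
    funext x k
    cases k <;> rfl

theorem Computes.add [Fintype o] {f g : (ι → ℝ) → o → ℝ} {n k : ℕ} (hf : Computes f n)
    (hg : Computes g k) :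
    Computes (fun x j => f x j + g x j) (n + k + Fintype.card o) := by
  refine (hf.pair hg).comp
    (g := fun (y : o ⊕ o → ℝ) j => y (.inl j) + y (.inr j)) ?_
  refine (computes_pi (n := 1) fun j => ?_).mono (mul_one _).le
  exact (ComputesScalar.var _).add (ComputesScalar.var _)

/-- Compute a finite sum of vectors. -/
theorem computes_sum [Fintype o] {n N : ℕ} {f : Fin N → (ι → ℝ) → o → ℝ}
    (hf : ∀ i, Computes (f i) n) :
    Computes (fun x j => ∑ i, f i x j) (Fintype.card o + N * (n + Fintype.card o)) := by
  induction N with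
  | zero =>
    refine (computes_pi (n := 1) fun j => ?_).mono (by simp)
    simpa using ComputesScalar.const 0
  | succ N ih =>
    have h := (ih fun i => hf i.castSucc).add (hf (Fin.last N))
    simp only [Fin.sum_univ_castSucc]
    refine h.mono (le_of_eq ?_)
    ring

theorem ComputesScalar.sum {n N : ℕ} {f : Fin N → (ι → ℝ) → ℝ}
    (hf : ∀ i, ComputesScalar (f i) n) :
    ComputesScalar (fun x => ∑ i, f i x) (1 + N * (n + 1)) := by
  have h := computes_sum (o := Unit) (f := fun i x _ => f i x) hf
  rw [Fintype.card_unit] at h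
  exact h

theorem Computes.iterate {f : (ι → ℝ) → ι → ℝ} {n : ℕ} (hf : Computes f n) (k : ℕ) :
    Computes (f^[k]) (k * n) := by
  induction k with
  | zero => exact (computes_select id).mono (Nat.zero_le _)
  | succ k ih =>
    have h := ih.comp hf
    simp only [← Function.iterate_succ_apply' f k] at h
    exact h.mono (by rw [Nat.succ_mul])

/-- Fold a family of updates. -/
theorem computes_foldl {α : Type} {f : α → (ι → ℝ) → ι → ℝ} {n : ℕ}
    (hf : ∀ i, Computes (f i) n) (l : List α) :
    Computes (fun x => l.foldl (fun y i => f i y) x) (l.length * n) := by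
  induction l with
  | nil => exact (computes_select id).mono (Nat.zero_le _)
  | cons i l ih =>
    refine ((hf i).comp ih).mono (le_of_eq ?_)
    rw [List.length_cons]; ring

end Computes

/-! ### Matrix products as computations -/

section MatrixProduct

variable {ι : Type} {d : ℕ}

/-- A tree for the product of two `d × d` matrices computes the product of two computed
matrices. -/
theorem Computes.matMul {M : ℕ} (hM : Computes
      (fun (x : (Fin d × Fin d) ⊕ (Fin d × Fin d) → ℝ) (p : Fin d × Fin d) =>
        ∑ k, x (.inl (p.1, k)) * x (.inr (k, p.2))) M)
    {A B : (ι → ℝ) → Fin d × Fin d → ℝ} {n k : ℕ} (hA : Computes A n) (hB : Computes B k) :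
    Computes (fun x (p : Fin d × Fin d) => ∑ j, A x (p.1, j) * B x (j, p.2)) (n + k + M) :=
  (hA.pair hB).comp hM

/-- Every real vector on the sum index type consists of the entries of two matrices, so the given
tree works on all inputs. Taking the maximum with 1 makes the constant positive, and the floor loses
nothing because costs are integers. -/
theorem IsMatMulExponent.exists_computes {ω : ℝ} (h : IsMatMulExponent ω) :
    ∃ C > (0 : ℝ), ∀ d : ℕ, 1 ≤ d → ∃ M : ℕ, (M : ℝ) ≤ C * (d : ℝ) ^ ω ∧ Computes
      (fun (x : (Fin d × Fin d) ⊕ (Fin d × Fin d) → ℝ) (p : Fin d × Fin d) =>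
        ∑ k, x (.inl (p.1, k)) * x (.inr (k, p.2))) M := by
  obtain ⟨C, hC⟩ := h
  refine ⟨max C 1, by positivity, fun d hd => ?_⟩
  obtain ⟨P, hP⟩ := hC d hd
  have hd' : (0 : ℝ) < (d : ℝ) ^ ω := Real.rpow_pos_of_pos (by exact_mod_cast hd) ω
  have hx : ∀ x : (Fin d × Fin d) ⊕ (Fin d × Fin d) → ℝ,
      x = matPairVal (Matrix.of fun i j => x (.inl (i, j))) (Matrix.of fun i j => x (.inr (i, j))) := by
    intro x; funext p; rcases p with p | p <;> rfl
  refine ⟨⌊max C 1 * (d : ℝ) ^ ω⌋₊, Nat.floor_le (by positivity), P, fun x => ⟨?_, ?_⟩⟩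
  · funext p
    rw [hx x]
    exact (hP _ _).1 p.1 p.2
  · rw [hx x]
    apply Nat.le_floor
    refine (hP _ _).2.trans ?_
    gcongr
    exact le_max_left _ _

end MatrixProduct

/-! ### The memory of the algorithm -/

/-- The names of the memory cells: the inputs, the point played, the reference point, the
accumulated gradients, the image of the displacement from the reference point under the Hessian
answer, and the inverse of the Hessian answer. -/
inductive MemName (d m : ℕ) where
  | inp (n : InputName d m)
  | point (j : Fin d)
  | ref (j : Fin d)
  | grads (j : Fin d)
  | dual (j : Fin d)
  | invHess (q : Fin d × Fin d)

theorem finite_inputName (d m : ℕ) : Finite (InputName d m) := by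
  refine Finite.of_surjective
    (fun n : (Fin m × Fin d) ⊕ Fin m ⊕ Fin d ⊕ Unit ⊕ Unit => match n with
      | .inl p => InputName.normal p.1 p.2
      | .inr (.inl i) => .offset i
      | .inr (.inr (.inl j)) => .start j
      | .inr (.inr (.inr (.inl _))) => .radius
      | .inr (.inr (.inr (.inr _))) => .step) ?_
  rintro (⟨i, j⟩ | i | j | _ | _)
  · exact ⟨.inl (i, j), rfl⟩
  · exact ⟨.inr (.inl i), rfl⟩
  · exact ⟨.inr (.inr (.inl j)), rfl⟩
  · exact ⟨.inr (.inr (.inr (.inl ()))), rfl⟩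
  · exact ⟨.inr (.inr (.inr (.inr ()))), rfl⟩

theorem finite_memName (d m : ℕ) : Finite (MemName d m) := by
  have := finite_inputName d m
  refine Finite.of_surjective
    (fun n : InputName d m ⊕ Fin d ⊕ Fin d ⊕ Fin d ⊕ Fin d ⊕ (Fin d × Fin d) => match n with
      | .inl n => MemName.inp n
      | .inr (.inl j) => .point j
      | .inr (.inr (.inl j)) => .ref j
      | .inr (.inr (.inr (.inl j))) => .grads j
      | .inr (.inr (.inr (.inr (.inl j)))) => .dual j
      | .inr (.inr (.inr (.inr (.inr q)))) => .invHess q) ?_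
  rintro (n | j | j | j | j | q)
  · exact ⟨.inl n, rfl⟩
  · exact ⟨.inr (.inl j), rfl⟩
  · exact ⟨.inr (.inr (.inl j)), rfl⟩
  · exact ⟨.inr (.inr (.inr (.inl j))), rfl⟩
  · exact ⟨.inr (.inr (.inr (.inr (.inl j)))), rfl⟩
  · exact ⟨.inr (.inr (.inr (.inr (.inr q)))), rfl⟩

/-- The mutable part of the memory. -/
structure BaronsState (d : ℕ) where
  w : EuclideanSpace ℝ (Fin d)
  u : EuclideanSpace ℝ (Fin d)
  s : EuclideanSpace ℝ (Fin d)
  p : EuclideanSpace ℝ (Fin d)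
  X : Matrix (Fin d) (Fin d) ℝ

/-- The contents of the memory. -/
def memVal {d m : ℕ} (x : InputName d m → ℝ) (st : BaronsState d) : MemName d m → ℝ
  | .inp n => x n
  | .point j => st.w j
  | .ref j => st.u j
  | .grads j => st.s j
  | .dual j => st.p j
  | .invHess q => st.X q.1 q.2

/-- One Newton–Schulz step towards the inverse of `H`. -/
noncomputable def schulzStep {d : ℕ} (H X : Matrix (Fin d) (Fin d) ℝ) :
    Matrix (Fin d) (Fin d) ℝ :=
  (2 : ℝ) • X - X * (H * X)

namespace BaronsState

variable {d m : ℕ} (a : Fin m → EuclideanSpace ℝ (Fin d)) (b : Fin m → ℝ) (ρ : ℝ)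

/-- One Newton step. -/
noncomputable def newton (st : BaronsState d) : BaronsState d :=
  { st with
    w := st.w - matVec st.X (barrierGrad a b ρ st.w + st.s)
    p := st.p - (barrierGrad a b ρ st.w + st.s) }

/-- Take the observed vector into account. -/
noncomputable def observe (η : ℝ) (g : EuclideanSpace ℝ (Fin d)) (st : BaronsState d) :
    BaronsState d :=
  { st with s := st.s + η • g }

/-- Move the reference point to the current point. -/
noncomputable def renew (st : BaronsState d) : BaronsState d :=
  { st with
    u := st.w
    p := 0
    X := schulzStep (barrierHess a b ρ st.w) (schulzStep (barrierHess a b ρ st.w) st.X) }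

/-- The test that decides whether to keep the reference point. -/
def Keeps (st : BaronsState d) : Prop := inner ℝ (st.w - st.u) st.p ≤ 1 / 1681

/-- The Newton steps of a round. -/
noncomputable def advance (η : ℝ) (n : ℕ) (g : EuclideanSpace ℝ (Fin d)) (st : BaronsState d) :
    BaronsState d :=
  (newton a b ρ)^[n] (st.observe η g)

open scoped Classical in
/-- One round. -/
noncomputable def next (η : ℝ) (n : ℕ) (g : EuclideanSpace ℝ (Fin d)) (st : BaronsState d) :
    BaronsState d :=
  if (st.advance a b ρ η n g).Keeps then st.advance a b ρ η n g
  else (st.advance a b ρ η n g).renew a b ρ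

end BaronsState

/-! ### The Newton step as a computation -/

section Programs

variable {d m : ℕ} {ι : Type}

theorem inner_eq_sum (x y : EuclideanSpace ℝ (Fin d)) : inner ℝ x y = ∑ j, x j * y j := by
  rw [inner_eq_dotProduct]; rfl

theorem card_pair : Fintype.card (Fin d × Fin d) = d * d := by simp

/-- The inverse slacks of a point. -/
noncomputable def invSlackVal (n : Fin m → Fin d → ℝ) (o : Fin m → ℝ) (w : Fin d → ℝ)
    (i : Fin m) : ℝ :=
  1 / (∑ j, n i j * w j - o i)

theorem invSlackVal_eq (a : Fin m → EuclideanSpace ℝ (Fin d)) (b : Fin m → ℝ)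
    (w : EuclideanSpace ℝ (Fin d)) (i : Fin m) :
    invSlackVal (fun i j => a i j) b (fun j => w j) i = (slack a b w i)⁻¹ := by
  rw [invSlackVal, slack, inner_eq_sum, one_div]

theorem computes_invSlack (n : Fin m → Fin d → ι) (o : Fin m → ι) (w : Fin d → ι) :
    Computes (fun x : ι → ℝ => invSlackVal (fun i j => x (n i j)) (fun i => x (o i))
      (fun j => x (w j))) (m * (2 * d + 4)) := by
  refine (computes_pi (n := 2 * d + 4) fun i => ?_).mono (by simp)
  refine ((ComputesScalar.const 1).div ((ComputesScalar.sum (n := 1) fun j =>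
    (ComputesScalar.var (n i j)).mul (ComputesScalar.var (w j))).sub
    (ComputesScalar.var (o i)))).mono (by omega)

/-- The residual gradient, given the inverse slacks. -/
noncomputable def residualVal (m' r : ℝ) (n : Fin m → Fin d → ℝ) (v : Fin m → ℝ)
    (w s : Fin d → ℝ) (j : Fin d) : ℝ :=
  m' / (r * r) * w j - ∑ i, v i * n i j + s j

theorem residualVal_eq (a : Fin m → EuclideanSpace ℝ (Fin d)) (b : Fin m → ℝ) (R : ℝ)
    (w s : EuclideanSpace ℝ (Fin d)) (j : Fin d) :
    residualVal m R (fun i j => a i j)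
      (invSlackVal (fun i j => a i j) b (fun j => w j)) (fun j => w j) (fun j => s j) j =
      (barrierGrad a b (m / R ^ 2) w + s) j := by
  simp only [residualVal, invSlackVal_eq, barrierGrad]
  simp [sq]
  ring

theorem computes_residual (m' : ℝ) (r : ι) (n : Fin m → Fin d → ι) (v : Fin m → ι)
    (w s : Fin d → ι) :
    Computes (fun x : ι → ℝ => residualVal m' (x r) (fun i j => x (n i j)) (fun i => x (v i))
      (fun j => x (w j)) (fun j => x (s j))) (d * (2 * m + 7)) := by
  refine (computes_pi (n := 2 * m + 7) fun j => ?_).mono (by simp)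
  refine (((((ComputesScalar.const m').div
    ((ComputesScalar.var r).mul (ComputesScalar.var r))).mul (ComputesScalar.var (w j))).sub
    (ComputesScalar.sum (n := 1) fun i =>
      (ComputesScalar.var (v i)).mul (ComputesScalar.var (n i j)))).add
    (ComputesScalar.var (s j))).mono (by omega)

/-- The inverse slacks at the current point, as a function of the memory. -/
noncomputable def memInvSlack (x : MemName d m → ℝ) : Fin m → ℝ :=
  invSlackVal (fun i j => x (.inp (.normal i j))) (fun i => x (.inp (.offset i)))
    (fun j => x (.point j))

theorem computes_memInvSlack :
    Computes (memInvSlack (d := d) (m := m)) (m * (2 * d + 4)) :=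
  computes_invSlack _ _ _

/-- The residual gradient at the current point, as a function of the memory. -/
noncomputable def memResidual (x : MemName d m → ℝ) : Fin d → ℝ :=
  residualVal m (x (.inp .radius)) (fun i j => x (.inp (.normal i j))) (memInvSlack x)
    (fun j => x (.point j)) (fun j => x (.grads j))

theorem computes_memResidual :
    Computes (memResidual (d := d) (m := m)) (m * (2 * d + 4) + d * (2 * m + 7)) :=
  computes_memInvSlack.bind (computes_residual (m : ℝ) (.inl (.inp .radius))
    (fun i j => .inl (.inp (.normal i j))) (fun i => .inr i) (fun j => .inl (.point j))
    (fun j => .inl (.grads j)))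

/-- The Newton step as a function of the memory. -/
noncomputable def memNewton (x : MemName d m → ℝ) : MemName d m → ℝ
  | .point j => x (.point j) - ∑ l, x (.invHess (j, l)) * memResidual x l
  | .dual j => x (.dual j) - memResidual x j
  | k => x k

theorem computes_memNewton (hd : 0 < d) :
    Computes (memNewton (d := d) (m := m)) (20 * (m * d + d * d)) := by
  have h1 : Computes (fun (y : MemName d m ⊕ Fin d → ℝ) j =>
      y (.inl (.point j)) - ∑ l, y (.inl (.invHess (j, l))) * y (.inr l)) (d * (2 * d + 2)) := by
    refine (computes_pi (n := 2 * d + 2) fun j => ?_).mono (by simp)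
    exact ((ComputesScalar.var (Sum.inl (MemName.point j))).sub (ComputesScalar.sum (n := 1) fun l =>
      (ComputesScalar.var (Sum.inl (MemName.invHess (j, l)))).mul (ComputesScalar.var (Sum.inr l)))).mono
      (by omega)
  have h2 : Computes (fun (y : MemName d m ⊕ Fin d → ℝ) j =>
      y (.inl (.dual j)) - y (.inr j)) (d * 1) := by
    refine (computes_pi (n := 1) fun j => ?_).mono (by simp)
    exact (ComputesScalar.var (Sum.inl (MemName.dual j))).sub (ComputesScalar.var (Sum.inr j))
  have h := (computes_memResidual.bind (h1.pair h2).retain).select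
    (fun k : MemName d m => match k with
      | .point j => Sum.inr (Sum.inl j)
      | .dual j => Sum.inr (Sum.inr j)
      | k => Sum.inl (Sum.inl k))
  refine Computes.mono (n := m * (2 * d + 4) + d * (2 * m + 7) + (d * (2 * d + 2) + d * 1)) ?_ ?_
  · convert h using 1
    funext x k
    cases k <;> rfl
  · have : m ≤ m * d := Nat.le_mul_of_pos_right m hd
    have : d ≤ d * d := Nat.le_mul_of_pos_right d hd
    nlinarith

theorem memNewton_memVal (a : Fin m → EuclideanSpace ℝ (Fin d)) (b : Fin m → ℝ)
    (wstar : EuclideanSpace ℝ (Fin d)) (R η : ℝ) (st : BaronsState d) :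
    memNewton (memVal (inputVal a b wstar R η) st) =
      memVal (inputVal a b wstar R η) (st.newton a b (m / R ^ 2)) := by
  have h : ∀ j, memResidual (memVal (inputVal a b wstar R η) st) j =
      (barrierGrad a b (m / R ^ 2) st.w + st.s) j :=
    fun j => residualVal_eq a b R st.w st.s j
  funext k
  cases k with
  | point j =>
    simp only [memNewton, h]
    rfl
  | dual j => simp only [memNewton, h]; rfl
  | _ => rfl

/-- The observation of a vector as a function of the memory. -/
def memObserve (x : MemName d m ⊕ Fin d → ℝ) : MemName d m → ℝ
  | .grads j => x (.inl (.grads j)) + x (.inl (.inp .step)) * x (.inr j)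
  | k => x (.inl k)

theorem computes_memObserve : Computes (memObserve (d := d) (m := m)) (d * 2) := by
  have h1 : Computes (fun (y : MemName d m ⊕ Fin d → ℝ) j =>
      y (.inl (.grads j)) + y (.inl (.inp .step)) * y (.inr j)) (d * 2) := by
    refine (computes_pi (n := 2) fun j => ?_).mono (by simp)
    exact (ComputesScalar.var (Sum.inl (MemName.grads j))).add
      ((ComputesScalar.var (Sum.inl (MemName.inp InputName.step))).mul (ComputesScalar.var (Sum.inr j)))
  convert h1.retain.select (fun k : MemName d m => match k with
      | .grads j => Sum.inr j
      | k => Sum.inl (Sum.inl k)) using 1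
  funext x k
  cases k <;> rfl

theorem memObserve_memVal (a : Fin m → EuclideanSpace ℝ (Fin d)) (b : Fin m → ℝ)
    (wstar g : EuclideanSpace ℝ (Fin d)) (R η : ℝ) (st : BaronsState d) :
    memObserve (Sum.elim (memVal (inputVal a b wstar R η) st) g.ofLp) =
      memVal (inputVal a b wstar R η) (st.observe η g) := by
  funext k
  cases k <;> rfl

/-- The Newton steps of a round as a function of the memory. -/
noncomputable def memAdvance (n : ℕ) (x : MemName d m ⊕ Fin d → ℝ) : MemName d m → ℝ :=
  memNewton^[n] (memObserve x)

theorem computes_memAdvance (hd : 0 < d) (n : ℕ) :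
    Computes (memAdvance (d := d) (m := m) n) (d * 2 + n * (20 * (m * d + d * d))) :=
  computes_memObserve.comp ((computes_memNewton hd).iterate n)

theorem memAdvance_memVal (a : Fin m → EuclideanSpace ℝ (Fin d)) (b : Fin m → ℝ)
    (wstar g : EuclideanSpace ℝ (Fin d)) (R η : ℝ) (n : ℕ) (st : BaronsState d) :
    memAdvance n (Sum.elim (memVal (inputVal a b wstar R η) st) g.ofLp) =
      memVal (inputVal a b wstar R η) (st.advance a b (m / R ^ 2) η n g) := by
  rw [memAdvance, memObserve_memVal, BaronsState.advance]
  induction n with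
  | zero => rfl
  | succ n ih => rw [Function.iterate_succ_apply', Function.iterate_succ_apply', ih,
      memNewton_memVal]

/-- The value on which the keep test is based. -/
def memTest (x : MemName d m → ℝ) : ℝ :=
  ∑ j, (x (.point j) - x (.ref j)) * x (.dual j)

theorem computes_memTest : ComputesScalar (memTest (d := d) (m := m)) (1 + d * 3) :=
  ComputesScalar.sum (n := 2) fun j =>
    ((ComputesScalar.var (MemName.point j)).sub (ComputesScalar.var (MemName.ref j))).mul
      (ComputesScalar.var (MemName.dual j))

theorem memTest_memVal (x : InputName d m → ℝ) (st : BaronsState d) :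
    memTest (memVal x st) = inner ℝ (st.w - st.u) st.p := by
  rw [inner_eq_sum]; rfl

open scoped Classical in
/-- Branch on a comparison of a scalar with a constant. -/
theorem exists_tree_branch {ι κ o : Type} {f : (ι → ℝ) → κ → ℝ} {q : (κ → ℝ) → ℝ}
    {f₁ f₂ : (κ → ℝ) → o → ℝ} {n k n₁ n₂ : ℕ} (hf : Computes f n) (hq : ComputesScalar q k)
    (h₁ : Computes f₁ n₁) (h₂ : Computes f₂ n₂) (c : ℝ) :
    ∃ t : ArithTree ι o, ∀ x,
      t.eval x = (if q (f x) ≤ c then f₁ (f x) else f₂ (f x)) ∧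
      t.cost x ≤ n + (k + 2) + if q (f x) ≤ c then n₁ else n₂ := by
  obtain ⟨t, ht⟩ := hf
  obtain ⟨t', ht'⟩ := (hq.pair (ComputesScalar.const c)).retain
  obtain ⟨t₁, ht₁⟩ := h₁
  obtain ⟨t₂, ht₂⟩ := h₂
  refine ⟨t.seq (t'.seq (.branch (.inr (.inl ())) (.inr (.inr ())) (t₁.reindex Sum.inl)
    (t₂.reindex Sum.inl))), fun x => ⟨?_, ?_⟩⟩
  · rw [ArithTree.eval_seq, ArithTree.eval_seq, (ht x).1, (ht' _).1]
    simp only [ArithTree.eval, ArithTree.eval_reindex, Sum.elim_comp_inl, Sum.elim_inr,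
      Sum.elim_inl, (ht₁ _).1, (ht₂ _).1]
  · rw [ArithTree.cost_seq, ArithTree.cost_seq, (ht x).1, (ht' _).1]
    simp only [ArithTree.cost, ArithTree.cost_reindex, Sum.elim_comp_inl, Sum.elim_inr,
      Sum.elim_inl]
    have e0 := (ht x).2
    have e1 := (ht' (f x)).2
    have e2 := (ht₁ (f x)).2
    have e3 := (ht₂ (f x)).2
    split_ifs <;> omega

end Programs

/-! ### Renewing the Hessian answer -/

section Renewal

variable {d m : ℕ} {ι : Type}

/-- The left factor of a block of the Hessian. -/
noncomputable def blockLeft (n : Fin m → Fin d → ℝ) (v : Fin m → ℝ) (q : ℕ)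
    (p : Fin d × Fin d) : ℝ :=
  if h : p.2 + d * q < m then n ⟨p.2 + d * q, h⟩ p.1 * (v ⟨p.2 + d * q, h⟩ * v ⟨p.2 + d * q, h⟩)
  else 0

/-- The right factor of a block of the Hessian. -/
noncomputable def blockRight (n : Fin m → Fin d → ℝ) (q : ℕ) (p : Fin d × Fin d) : ℝ :=
  if h : p.1 + d * q < m then n ⟨p.1 + d * q, h⟩ p.2 else 0

/-- The entries of the Hessian, computed in `N` blocks. -/
noncomputable def hessVal (m' r : ℝ) (n : Fin m → Fin d → ℝ) (v : Fin m → ℝ) (N : ℕ)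
    (p : Fin d × Fin d) : ℝ :=
  (∑ q : Fin N, ∑ k, blockLeft n v q (p.1, k) * blockRight n q (k, p.2)) +
    if p.1 = p.2 then m' / (r * r) else 0

/-- The m constraints are padded with zeros to N·d and split into N blocks of d, along the
enumeration k + d·q of `finProdFinEquiv`. -/
theorem sum_blocks {N : ℕ} (hN : m ≤ N * d) (f : Fin m → ℝ) :
    ∑ q : Fin N, ∑ k : Fin d,
      (if h : (k : ℕ) + d * q < m then f ⟨k + d * q, h⟩ else 0) = ∑ i, f i := by
  set F : ℕ → ℝ := fun i => if h : i < m then f ⟨i, h⟩ else 0 with hF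
  have h1 : ∑ i, f i = ∑ i ∈ Finset.range m, F i := by
    rw [Finset.sum_range]
    exact Finset.sum_congr rfl fun i _ => by simp [hF]
  have h2 : ∑ i ∈ Finset.range m, F i = ∑ i ∈ Finset.range (N * d), F i := by
    refine Finset.sum_subset (Finset.range_subset_range.2 hN) fun i _ hi => ?_
    simp only [Finset.mem_range] at hi
    simp [hF, hi]
  rw [h1, h2, Finset.sum_range, ← Fintype.sum_prod_type',
    ← (finProdFinEquiv (m := N) (n := d)).sum_comp]
  rfl

theorem hessVal_eq (a : Fin m → EuclideanSpace ℝ (Fin d)) (b : Fin m → ℝ) (R : ℝ)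
    (w : EuclideanSpace ℝ (Fin d)) {N : ℕ} (hN : m ≤ N * d) (p : Fin d × Fin d) :
    hessVal m R (fun i j => a i j) (invSlackVal (fun i j => a i j) b (fun j => w j)) N p =
      barrierHess a b (m / R ^ 2) w p.1 p.2 := by
  have h := sum_blocks hN fun i => (slack a b w i * slack a b w i)⁻¹ * ((a i) p.1 * (a i) p.2)
  have e : ∀ (q : Fin N) (k : Fin d),
      blockLeft (fun i j => a i j) (invSlackVal (fun i j => a i j) b (fun j => w j)) q (p.1, k) *
        blockRight (fun i j => a i j) q (k, p.2) =
      if h : (k : ℕ) + d * q < m then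
        (slack a b w ⟨k + d * q, h⟩ * slack a b w ⟨k + d * q, h⟩)⁻¹ *
          ((a ⟨k + d * q, h⟩) p.1 * (a ⟨k + d * q, h⟩) p.2) else 0 := by
    intro q k
    by_cases hk : (k : ℕ) + d * q < m
    · simp only [blockLeft, blockRight, dif_pos hk, invSlackVal_eq, mul_inv]
      ring
    · simp only [blockLeft, blockRight, dif_neg hk, mul_zero]
  simp only [hessVal, e, h]
  simp only [barrierHess, barrierSecant, weightMat, Matrix.add_apply, Matrix.sum_apply,
    Matrix.smul_apply, Matrix.vecMulVec_apply, smul_eq_mul, Matrix.one_apply]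
  simp [sq]

/-- The Hessian is a sum of rank-one terms; d of them at a time form one product of square matrices.
With about m/d blocks this costs (m/d)·d^ω = m·d^(ω−1). -/
theorem computes_hess {M : ℕ} (hM : Computes
      (fun (x : (Fin d × Fin d) ⊕ (Fin d × Fin d) → ℝ) (p : Fin d × Fin d) =>
        ∑ k, x (.inl (p.1, k)) * x (.inr (k, p.2))) M)
    (m' : ℝ) (r : ι) (n : Fin m → Fin d → ι) (v : Fin m → ι) (N : ℕ) :
    Computes (fun x : ι → ℝ => hessVal m' (x r) (fun i j => x (n i j)) (fun i => x (v i)) N)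
      (N * (4 * (d * d) + M) + 5 * (d * d)) := by
  have hl : ∀ q : Fin N, Computes (fun x : ι → ℝ =>
      blockLeft (fun i j => x (n i j)) (fun i => x (v i)) q) (d * d * 2) := by
    intro q
    refine (computes_pi (n := 2) fun p => ?_).mono (by simp)
    by_cases h : (p.2 : ℕ) + d * q < m
    · simp only [blockLeft, dif_pos h]
      exact (ComputesScalar.var _).mul ((ComputesScalar.var _).mul (ComputesScalar.var _))
    · simp only [blockLeft, dif_neg h]
      exact (ComputesScalar.const 0).mono (by norm_num)
  have hr : ∀ q : Fin N, Computes (fun x : ι → ℝ =>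
      blockRight (fun i j => x (n i j)) q) (d * d * 1) := by
    intro q
    refine (computes_pi (n := 1) fun p => ?_).mono (by simp)
    by_cases h : (p.1 : ℕ) + d * q < m
    · simp only [blockRight, dif_pos h]
      exact (ComputesScalar.var _).mono (by norm_num)
    · simp only [blockRight, dif_neg h]
      exact ComputesScalar.const 0
  have hdiag : Computes (fun (x : ι → ℝ) (p : Fin d × Fin d) =>
      if p.1 = p.2 then m' / (x r * x r) else 0) (d * d * 3) := by
    refine (computes_pi (n := 3) fun p => ?_).mono (by simp)
    by_cases h : p.1 = p.2
    · simp only [if_pos h]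
      exact (ComputesScalar.const m').div ((ComputesScalar.var r).mul (ComputesScalar.var r))
    · simp only [if_neg h]
      exact (ComputesScalar.const 0).mono (by norm_num)
  refine ((computes_sum fun q => Computes.matMul hM (hl q) (hr q)).add hdiag).mono ?_
  rw [card_pair]
  apply le_of_eq
  ring

/-- The entries of a Newton–Schulz step. -/
noncomputable def schulzVal (H X : Fin d × Fin d → ℝ) (p : Fin d × Fin d) : ℝ :=
  2 * X p - ∑ k, X (p.1, k) * ∑ l, H (k, l) * X (l, p.2)

theorem schulzVal_eq (H X : Matrix (Fin d) (Fin d) ℝ) (p : Fin d × Fin d) :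
    schulzVal (fun q => H q.1 q.2) (fun q => X q.1 q.2) p = schulzStep H X p.1 p.2 := by
  simp [schulzVal, schulzStep, Matrix.mul_apply]

theorem Computes.schulz {M : ℕ} (hM : Computes
      (fun (x : (Fin d × Fin d) ⊕ (Fin d × Fin d) → ℝ) (p : Fin d × Fin d) =>
        ∑ k, x (.inl (p.1, k)) * x (.inr (k, p.2))) M)
    {A B : (ι → ℝ) → Fin d × Fin d → ℝ} {n k : ℕ} (hA : Computes A n) (hB : Computes B k) :
    Computes (fun x => schulzVal (A x) (B x)) (n + k + (2 * M + 3 * (d * d))) := by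
  have hp : Computes (fun (y : (Fin d × Fin d) ⊕ (Fin d × Fin d) → ℝ) (p : Fin d × Fin d) =>
      ∑ j, y (.inr (p.1, j)) * ∑ l, y (.inl (j, l)) * y (.inr (l, p.2))) (0 + (0 + 0 + M) + M) :=
    Computes.matMul hM (computes_select Sum.inr)
      (Computes.matMul hM (computes_select Sum.inl) (computes_select Sum.inr))
  have hq : Computes (fun (z : ((Fin d × Fin d) ⊕ (Fin d × Fin d)) ⊕ (Fin d × Fin d) → ℝ) (p : Fin d × Fin d) =>
      2 * z (Sum.inl (Sum.inr p)) - z (Sum.inr p)) (d * d * 3) := by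
    refine (computes_pi (n := 3) fun p => ?_).mono (by simp)
    exact ((ComputesScalar.const 2).mul (ComputesScalar.var _)).sub (ComputesScalar.var _)
  exact ((hA.pair hB).comp (hp.bind hq)).mono (le_of_eq (by ring))

/-- The Hessian at the current point, as a function of the memory. -/
noncomputable def memHess (N : ℕ) (x : MemName d m → ℝ) : Fin d × Fin d → ℝ :=
  hessVal m (x (.inp .radius)) (fun i j => x (.inp (.normal i j))) (memInvSlack x) N

/-- The renewal of the reference point as a function of the memory. -/
noncomputable def memRenew (N : ℕ) (x : MemName d m → ℝ) : MemName d m → ℝ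
  | .ref j => x (.point j)
  | .dual _ => 0
  | .invHess p => schulzVal (memHess N x) (schulzVal (memHess N x) fun q => x (.invHess q)) p
  | k => x k

theorem memRenew_memVal (a : Fin m → EuclideanSpace ℝ (Fin d)) (b : Fin m → ℝ)
    (wstar : EuclideanSpace ℝ (Fin d)) (R η : ℝ) (st : BaronsState d) {N : ℕ}
    (hN : m ≤ N * d) :
    memRenew N (memVal (inputVal a b wstar R η) st) =
      memVal (inputVal a b wstar R η) (st.renew a b (m / R ^ 2)) := by
  have h : memHess N (memVal (inputVal a b wstar R η) st) =
      fun q => barrierHess a b (m / R ^ 2) st.w q.1 q.2 :=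
    funext fun q => hessVal_eq a b R st.w hN q
  have h2 : schulzVal (memHess N (memVal (inputVal a b wstar R η) st))
      (fun q => memVal (inputVal a b wstar R η) st (.invHess q)) =
      fun q => schulzStep (barrierHess a b (m / R ^ 2) st.w) st.X q.1 q.2 := by
    rw [h]
    exact funext fun q => schulzVal_eq _ st.X q
  funext k
  cases k with
  | invHess p =>
    simp only [memRenew]
    rw [h2, h, schulzVal_eq]
    rfl
  | _ => rfl

/-- Of the m/d + 5 products, m/d + 1 assemble the Hessian and two belong to each of the two
Newton–Schulz steps. -/
theorem computes_memRenew {M : ℕ} (hd : 0 < d) (hM : Computes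
      (fun (x : (Fin d × Fin d) ⊕ (Fin d × Fin d) → ℝ) (p : Fin d × Fin d) =>
        ∑ k, x (.inl (p.1, k)) * x (.inr (k, p.2))) M) :
    Computes (memRenew (d := d) (m := m) (m / d + 1))
      (20 * (m * d + d * d) + (m / d + 5) * M) := by
  have hH' := computes_hess hM (m : ℝ) (Sum.inl (MemName.inp (d := d) (m := m) .radius))
      (fun i j => Sum.inl (MemName.inp (.normal i j)))
      (fun i : Fin m => Sum.inr i) (m / d + 1)
  have hH : Computes (memHess (d := d) (m := m) (m / d + 1))
      (m * (2 * d + 4) + ((m / d + 1) * (4 * (d * d) + M) + 5 * (d * d))) :=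
    computes_memInvSlack.bind hH'
  have hX : Computes (fun (y : MemName d m ⊕ (Fin d × Fin d) → ℝ) =>
      schulzVal (fun p => y (.inr p)) (schulzVal (fun p => y (.inr p))
        (fun p => y (.inl (.invHess p))))) _ :=
    Computes.schulz hM (computes_select _) (Computes.schulz hM (computes_select _)
      (computes_select _))
  have h := ((hH.bind hX).pair (ComputesScalar.const 0)).retain.select
    (fun k : MemName d m => match k with
      | .ref j => Sum.inl (.point j)
      | .dual _ => Sum.inr (Sum.inr ())
      | .invHess p => Sum.inr (Sum.inl p)
      | k => Sum.inl k)
  have hle : (m / d + 1) * (d * d) ≤ m * d + d * d := by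
    have := Nat.div_mul_le_self m d
    calc (m / d + 1) * (d * d) = (m / d * d) * d + d * d := by ring
      _ ≤ m * d + d * d := by gcongr
  have hm : m ≤ m * d := Nat.le_mul_of_pos_right m hd
  have hdd : 1 ≤ d * d := Nat.mul_pos hd hd
  refine Computes.mono (n := m * (2 * d + 4) + ((m / d + 1) * (4 * (d * d) + M) + 5 * (d * d)) +
    (0 + (0 + 0 + (2 * M + 3 * (d * d))) + (2 * M + 3 * (d * d))) + 1) ?_ ?_
  · convert h using 1
    funext x k
    cases k <;> rfl
  · have e : (m / d + 1) * (4 * (d * d) + M) = 4 * ((m / d + 1) * (d * d)) + (m / d + 1) * M := by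
      ring
    have e2 : (m / d + 5) * M = (m / d + 1) * M + 4 * M := by ring
    have e3 : m * (2 * d + 4) = 2 * (m * d) + 4 * m := by ring
    rw [e, e2, e3]
    omega

end Renewal

/-! ### The initial inverse Hessian -/

section Init

variable {d m : ℕ}

/-- The rank-one update of an inverse matrix. -/
noncomputable def rankOneUpdate (c : ℝ) (n : Fin d → ℝ) (X : Matrix (Fin d) (Fin d) ℝ) :
    Matrix (Fin d) (Fin d) ℝ :=
  X - (c / (1 + c * (n ⬝ᵥ X.mulVec n))) • Matrix.vecMulVec (X.mulVec n) (X.mulVec n)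

theorem rankOneUpdate_inv {H : Matrix (Fin d) (Fin d) ℝ} (hH : H.PosDef) {c : ℝ} (hc : 0 ≤ c)
    (n : Fin d → ℝ) :
    (H + c • Matrix.vecMulVec n n).PosDef ∧
      rankOneUpdate c n H⁻¹ = (H + c • Matrix.vecMulVec n n)⁻¹ := by
  have hdet := (Matrix.isUnit_iff_isUnit_det _).1 hH.isUnit
  have hps : (c • Matrix.vecMulVec n n).PosSemidef := by
    have := Matrix.posSemidef_vecMulVec_self_star n
    rw [star_trivial] at this
    exact this.smul hc
  refine ⟨hH.add_posSemidef hps, ?_⟩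
  set z := H⁻¹.mulVec n with hz
  have hpos : 0 ≤ n ⬝ᵥ z := by
    have := hH.inv.posSemidef.dotProduct_mulVec_nonneg n
    rwa [star_trivial] at this
  have hHz : H.mulVec z = n := by
    rw [hz, Matrix.mulVec_mulVec, Matrix.mul_nonsing_inv _ hdet, Matrix.one_mulVec]
  have hnX : Matrix.vecMul n H⁻¹ = z := by
    have : H⁻¹.transpose = H⁻¹ := by
      rw [← Matrix.conjTranspose_eq_transpose_of_trivial, hH.inv.1.eq]
    rw [← Matrix.mulVec_transpose, this]
  symm
  apply Matrix.inv_eq_right_inv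
  rw [rankOneUpdate, ← hz]
  set κ := c / (1 + c * (n ⬝ᵥ z)) with hκ
  -- The cancellation behind the Sherman–Morrison formula; since c ≥ 0 and the form is nonnegative,
  -- the denominator is at least 1.
  have hκ' : κ + c * κ * (n ⬝ᵥ z) = c := by
    have : 1 + c * (n ⬝ᵥ z) ≠ 0 := by positivity
    rw [hκ]; field_simp
  rw [add_mul, mul_sub, mul_sub, Matrix.mul_nonsing_inv _ hdet, mul_smul_comm,
    Matrix.mul_vecMulVec, hHz, smul_mul_assoc, Matrix.vecMulVec_mul, hnX, smul_mul_assoc,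
    mul_smul_comm, Matrix.vecMulVec_mul_vecMulVec]
  ext i j
  simp only [Matrix.add_apply, Matrix.sub_apply, Matrix.smul_apply, Matrix.vecMulVec_apply,
    smul_eq_mul, Pi.smul_apply]
  linear_combination (-(n i * z j)) * hκ'

theorem foldl_rankOneUpdate {c : Fin m → ℝ} (hc : ∀ i, 0 ≤ c i) (n : Fin m → Fin d → ℝ)
    (l : List (Fin m)) : ∀ {H : Matrix (Fin d) (Fin d) ℝ}, H.PosDef →
    l.foldl (fun X i => rankOneUpdate (c i) (n i) X) H⁻¹ =
      (H + (l.map fun i => c i • Matrix.vecMulVec (n i) (n i)).sum)⁻¹ := by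
  induction l with
  | nil => intro H _; simp
  | cons i l ih =>
    intro H hH
    obtain ⟨h1, h2⟩ := rankOneUpdate_inv hH (hc i) (n i)
    rw [List.foldl_cons, h2, ih h1, List.map_cons, List.sum_cons, add_assoc]

end Init

/-! ### The first inverse Hessian as a computation -/

section Initialization

variable {d m : ℕ}

/-- The names of the values available during the computation of the first inverse Hessian. -/
abbrev InitName (d m : ℕ) : Type := (InputName d m ⊕ Fin m) ⊕ (Fin d × Fin d)

/-- The image of a constraint vector under the current inverse matrix. -/
noncomputable def initImage (i : Fin m) (y : InitName d m → ℝ) (j : Fin d) : ℝ :=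
  ∑ l, y (.inr (j, l)) * y (.inl (.inl (.normal i l)))

/-- The coefficient of a rank-one update. -/
noncomputable def initCoeff (i : Fin m) (y : InitName d m ⊕ Fin d → ℝ) : ℝ :=
  y (.inl (.inl (.inr i))) * y (.inl (.inl (.inr i))) /
    (1 + y (.inl (.inl (.inr i))) * y (.inl (.inl (.inr i))) *
      ∑ j, y (.inl (.inl (.inl (.normal i j)))) * y (.inr j))

/-- A rank-one update as a function of the available values. -/
noncomputable def initStep (i : Fin m) (y : InitName d m → ℝ) : InitName d m → ℝ
  | .inl k => y (.inl k)
  | .inr p => y (.inr p) - initCoeff i (Sum.elim y (initImage i y)) *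
      (initImage i y p.1 * initImage i y p.2)

theorem computes_initStep (hd : 0 < d) (i : Fin m) :
    Computes (initStep (d := d) i) (20 * (d * d)) := by
  have h1 : Computes (initImage (d := d) i) (d * (1 + d * 2)) := by
    refine (computes_pi (n := 1 + d * 2) fun j => ?_).mono (by simp)
    exact ComputesScalar.sum (n := 1) fun l => (ComputesScalar.var _).mul (ComputesScalar.var _)
  have h2 : ComputesScalar (initCoeff (d := d) i) (2 * d + 7) := by
    refine (((ComputesScalar.var _).mul (ComputesScalar.var _)).div
      ((ComputesScalar.const 1).add (((ComputesScalar.var _).mul (ComputesScalar.var _)).mul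
        (ComputesScalar.sum (n := 1) fun l =>
          (ComputesScalar.var _).mul (ComputesScalar.var _))))).mono (by omega)
  have h3 : Computes (fun (z : (InitName d m ⊕ Fin d) ⊕ Unit → ℝ) (p : Fin d × Fin d) =>
      z (Sum.inl (Sum.inl (Sum.inr p))) - z (Sum.inr ()) *
        (z (Sum.inl (Sum.inr p.1)) * z (Sum.inl (Sum.inr p.2)))) (d * d * 3) := by
    refine (computes_pi (n := 3) fun p => ?_).mono (by simp)
    exact (ComputesScalar.var _).sub
      ((ComputesScalar.var _).mul ((ComputesScalar.var _).mul (ComputesScalar.var _)))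
  have h := (h1.bind (Computes.bind h2 h3)).retain.select
    (fun k : InitName d m => match k with
      | .inl k => Sum.inl (Sum.inl k)
      | .inr p => Sum.inr p)
  refine Computes.mono (n := d * (1 + d * 2) + ((2 * d + 7) + d * d * 3)) ?_ ?_
  · convert h using 1
    funext x k
    cases k <;> rfl
  · nlinarith

/-- The values available at the start of the computation of the first inverse Hessian. -/
noncomputable def initStart (x : InputName d m → ℝ) : InitName d m → ℝ :=
  Sum.elim (Sum.elim x (invSlackVal (fun i j => x (.normal i j)) (fun i => x (.offset i))
    (fun j => x (.start j))))
    fun p => if p.1 = p.2 then x .radius * x .radius / m else 0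

theorem computes_initStart :
    Computes (initStart (d := d) (m := m)) (m * (2 * d + 4) + d * d * 3) := by
  have h1 := computes_invSlack (ι := InputName d m) (fun (i : Fin m) (j : Fin d) => .normal i j)
    (fun i => .offset i) (fun j => .start j)
  have h2 : Computes (fun (x : InputName d m → ℝ) (p : Fin d × Fin d) =>
      if p.1 = p.2 then x .radius * x .radius / (m : ℝ) else 0) (d * d * 3) := by
    refine (computes_pi (n := 3) fun p => ?_).mono (by simp)
    by_cases h : p.1 = p.2
    · simp only [if_pos h]
      exact ((ComputesScalar.var _).mul (ComputesScalar.var _)).div (ComputesScalar.const _)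
    · simp only [if_neg h]
      exact (ComputesScalar.const 0).mono (by norm_num)
  exact h1.retain.pair h2

/-- The initial memory as a function of the inputs. -/
noncomputable def memInit (x : InputName d m → ℝ) : MemName d m → ℝ
  | .inp n => x n
  | .point j => x (.start j)
  | .ref j => x (.start j)
  | .grads _ => 0
  | .dual _ => 0
  | .invHess p => (List.finRange m).foldl (fun y i => initStep i y) (initStart x) (.inr p)

theorem computes_memInit (hd : 0 < d) :
    Computes (memInit (d := d) (m := m))
      (m * (2 * d + 4) + d * d * 3 + m * (20 * (d * d)) + 1) := by
  have h := (((computes_initStart (d := d) (m := m)).comp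
    (computes_foldl (computes_initStep hd) (List.finRange m))).pair
      (ComputesScalar.const 0)).retain.select
    (fun k : MemName d m => match k with
      | .inp n => Sum.inl n
      | .point j => Sum.inl (.start j)
      | .ref j => Sum.inl (.start j)
      | .grads _ => Sum.inr (Sum.inr ())
      | .dual _ => Sum.inr (Sum.inr ())
      | .invHess p => Sum.inr (Sum.inl (Sum.inr p)))
  rw [List.length_finRange] at h
  convert h using 1
  funext x k
  cases k <;> rfl

/-- The values during the computation of the first inverse Hessian. -/
def initVal (x : InputName d m → ℝ) (v : Fin m → ℝ) (X : Matrix (Fin d) (Fin d) ℝ) :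
    InitName d m → ℝ :=
  Sum.elim (Sum.elim x v) fun p => X p.1 p.2

theorem initStep_initVal (i : Fin m) (x : InputName d m → ℝ) (v : Fin m → ℝ)
    (X : Matrix (Fin d) (Fin d) ℝ) :
    initStep i (initVal x v X) =
      initVal x v (rankOneUpdate (v i * v i) (fun j => x (.normal i j)) X) := by
  funext k
  rcases k with k | p
  · rfl
  · have hz : initImage i (initVal x v X) = X.mulVec fun j => x (.normal i j) := rfl
    simp only [initStep, hz]
    simp only [initVal, rankOneUpdate, Sum.elim_inr, Matrix.sub_apply, Matrix.smul_apply,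
      Matrix.vecMulVec_apply, smul_eq_mul]
    rfl

theorem foldl_initStep_initVal (x : InputName d m → ℝ) (v : Fin m → ℝ) (l : List (Fin m)) :
    ∀ X : Matrix (Fin d) (Fin d) ℝ,
    l.foldl (fun y i => initStep i y) (initVal x v X) =
      initVal x v (l.foldl (fun X i => rankOneUpdate (v i * v i) (fun j => x (.normal i j)) X) X) := by
  induction l with
  | nil => intro X; rfl
  | cons i l ih => intro X; rw [List.foldl_cons, initStep_initVal, ih]; rfl

namespace BaronsState

/-- The initial state. -/
noncomputable def initial (a : Fin m → EuclideanSpace ℝ (Fin d)) (b : Fin m → ℝ) (ρ : ℝ)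
    (wstar : EuclideanSpace ℝ (Fin d)) : BaronsState d where
  w := wstar
  u := wstar
  s := 0
  p := 0
  X := (barrierHess a b ρ wstar)⁻¹

end BaronsState

/-- The rank-one updates start from (R²/m)·I, the inverse of the quadratic part, and add one
constraint each. The result is the exact inverse Hessian at w*. -/
theorem memInit_inputVal (hm : 0 < m) {a : Fin m → EuclideanSpace ℝ (Fin d)} {b : Fin m → ℝ}
    {wstar : EuclideanSpace ℝ (Fin d)} {R : ℝ} (hR : 0 < R) (η : ℝ) :
    memInit (inputVal a b wstar R η) =
      memVal (inputVal a b wstar R η) (BaronsState.initial a b (m / R ^ 2) wstar) := by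
  funext k
  cases k with
  | invHess p =>
    have hm' : (0 : ℝ) < m := by exact_mod_cast hm
    have hρ : (0 : ℝ) < m / R ^ 2 := by positivity
    have hs : initStart (inputVal a b wstar R η) =
        initVal (inputVal a b wstar R η) (fun i => (slack a b wstar i)⁻¹)
          ((m / R ^ 2 : ℝ) • (1 : Matrix (Fin d) (Fin d) ℝ))⁻¹ := by
      have h1 : ((m / R ^ 2 : ℝ) • (1 : Matrix (Fin d) (Fin d) ℝ))⁻¹ =
          (R * R / m : ℝ) • (1 : Matrix (Fin d) (Fin d) ℝ) := by
        apply Matrix.inv_eq_right_inv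
        rw [smul_mul_smul_comm, one_mul, show (m / R ^ 2 : ℝ) * (R * R / m) = 1 by field_simp,
          one_smul]
      rw [h1, initStart, initVal]
      congr 1
      · congr 1
        exact funext fun i => invSlackVal_eq a b wstar i
      · funext p
        simp [Matrix.one_apply, inputVal]
    have hpd : ((m / R ^ 2 : ℝ) • (1 : Matrix (Fin d) (Fin d) ℝ)).PosDef :=
      Matrix.PosDef.one.smul hρ
    have hf := foldl_rankOneUpdate (c := fun i => (slack a b wstar i)⁻¹ * (slack a b wstar i)⁻¹)
      (fun i => mul_self_nonneg _) (fun i => (a i).ofLp) (List.finRange m) hpd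
    have e : (m / R ^ 2 : ℝ) • (1 : Matrix (Fin d) (Fin d) ℝ) + ((List.finRange m).map fun i =>
        ((slack a b wstar i)⁻¹ * (slack a b wstar i)⁻¹) •
          Matrix.vecMulVec (a i).ofLp (a i).ofLp).sum = barrierHess a b (m / R ^ 2) wstar := by
      rw [barrierHess, barrierSecant, weightMat, add_comm, ← List.ofFn_eq_map, List.sum_ofFn]
      simp only [mul_inv]
    rw [e] at hf
    simp only [memInit]
    rw [hs, foldl_initStep_initVal]
    change initVal _ _ (List.foldl (fun X i => rankOneUpdate
      ((slack a b wstar i)⁻¹ * (slack a b wstar i)⁻¹) (a i).ofLp X) _ (List.finRange m)) _ = _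
    rw [hf]
    rfl
  | _ => rfl

end Initialization

/-! ### The online algorithm -/

section Algorithm

variable {d m : ℕ}

/-- The states of the algorithm. -/
noncomputable def BaronsState.states (a : Fin m → EuclideanSpace ℝ (Fin d)) (b : Fin m → ℝ)
    (ρ η : ℝ) (n : ℕ) (wstar : EuclideanSpace ℝ (Fin d)) (g : ℕ → EuclideanSpace ℝ (Fin d)) :
    ℕ → BaronsState d
  | 0 => .initial a b ρ wstar
  | t + 1 => (states a b ρ η n wstar g t).next a b ρ η n (g t)

-- The trees depend only on d, m, n and the multiplication tree; the polytope enters through the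
-- memory. Since the memory encodes the abstract state in every round, the branch taken is known
-- exactly, and the matrix products are charged only to rounds with a renewal.
open scoped Classical in
theorem exists_onlineAlg (hd : 0 < d) {M : ℕ} (hM : Computes
      (fun (x : (Fin d × Fin d) ⊕ (Fin d × Fin d) → ℝ) (p : Fin d × Fin d) =>
        ∑ k, x (.inl (p.1, k)) * x (.inr (k, p.2))) M) (n : ℕ) :
    ∃ P : OnlineAlg d m, ∀ (a : Fin m → EuclideanSpace ℝ (Fin d)) (b : Fin m → ℝ) (R η : ℝ)
      (wstar : EuclideanSpace ℝ (Fin d)) (g : ℕ → EuclideanSpace ℝ (Fin d)), 0 < m → 0 < R →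
      (∀ t, P.iterate (inputVal a b wstar R η) g t =
        (BaronsState.states a b (m / R ^ 2) η n wstar g t).w) ∧
      ∀ T, P.totalCost (inputVal a b wstar R η) g T ≤
        (m * (2 * d + 4) + d * d * 3 + m * (20 * (d * d)) + 1) +
        ∑ t ∈ Finset.range T, (d * 2 + n * (20 * (m * d + d * d)) + (1 + d * 3 + 2) +
          if ((BaronsState.states a b (m / R ^ 2) η n wstar g t).advance a b (m / R ^ 2) η n
            (g t)).Keeps then 0 else 20 * (m * d + d * d) + (m / d + 5) * M) := by
  obtain ⟨ti, hti⟩ := computes_memInit (m := m) hd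
  obtain ⟨tr, htr⟩ := exists_tree_branch (computes_memAdvance (m := m) hd n)
    (computes_memTest (d := d) (m := m)) (computes_select (ι := MemName d m) id)
    (computes_memRenew (m := m) hd hM) (1 / 1681)
  refine ⟨⟨MemName d m, finite_memName d m, ti, tr, .point⟩, fun a b R η wstar g hm hR => ?_⟩
  set P : OnlineAlg d m := ⟨MemName d m, finite_memName d m, ti, tr, .point⟩ with hP
  set x := inputVal a b wstar R η with hx
  have hN : m ≤ (m / d + 1) * d := by
    have := Nat.div_add_mod m d
    have := Nat.mod_lt m hd
    nlinarith
  have hstate : ∀ t, P.state x g t = memVal x (BaronsState.states a b (m / R ^ 2) η n wstar g t) := by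
    intro t
    induction t with
    | zero => exact (hti x).1.trans (memInit_inputVal hm hR η)
    | succ t ih =>
      change tr.eval (Sum.elim (P.state x g t) (g t).ofLp) = _
      rw [ih, (htr _).1, memAdvance_memVal, memTest_memVal, BaronsState.states, BaronsState.next]
      by_cases h : ((BaronsState.states a b (m / R ^ 2) η n wstar g t).advance a b (m / R ^ 2) η n
          (g t)).Keeps
      · rw [if_pos h, if_pos (by exact h)]
        rfl
      · rw [if_neg h, if_neg (by exact h)]
        exact memRenew_memVal a b wstar R η _ hN
  refine ⟨fun t => ?_, fun T => ?_⟩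
  · rw [OnlineAlg.iterate, hstate]
    rfl
  · refine Nat.add_le_add (hti x).2 (Finset.sum_le_sum fun t _ => ?_)
    rw [hstate]
    have h := (htr (Sum.elim (memVal x (BaronsState.states a b (m / R ^ 2) η n wstar g t))
      (g t).ofLp)).2
    rw [memAdvance_memVal, memTest_memVal] at h
    exact h

end Algorithm

/-! ### The algorithm executes BARONS -/

section Execution

variable {d m : ℕ} {a : Fin m → EuclideanSpace ℝ (Fin d)} {b : Fin m → ℝ} {ρ ε τ η : ℝ} {N : ℕ}

/-- The invariant of the states of the algorithm. -/
structure BaronsState.Inv (a : Fin m → EuclideanSpace ℝ (Fin d)) (b : Fin m → ℝ) (ρ ε : ℝ)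
    (st : BaronsState d) : Prop where
  posDef : st.X.PosDef
  dual : st.p = matVec st.X⁻¹ (st.w - st.u)
  barons : BaronsInv a b ρ ε st.w st.u st.s st.X⁻¹

namespace BaronsState

theorem inv_inv_of_posDef {X : Matrix (Fin d) (Fin d) ℝ} (hX : X.PosDef) : X⁻¹⁻¹ = X :=
  Matrix.nonsing_inv_nonsing_inv _ ((Matrix.isUnit_iff_isUnit_det _).1 hX.isUnit)

theorem iterate_newton (st : BaronsState d) (n : ℕ) :
    ((newton a b ρ)^[n] st).u = st.u ∧ ((newton a b ρ)^[n] st).s = st.s ∧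
      ((newton a b ρ)^[n] st).X = st.X := by
  induction n with
  | zero => exact ⟨rfl, rfl, rfl⟩
  | succ n ih => rw [Function.iterate_succ_apply']; exact ih

theorem iterate_newton_w (st : BaronsState d) (hX : st.X.PosDef) (n : ℕ) :
    ((newton a b ρ)^[n + 1] st).w = ((newton a b ρ)^[n] st).w -
      matVec st.X⁻¹⁻¹ (barrierGrad a b ρ ((newton a b ρ)^[n] st).w + st.s) := by
  obtain ⟨-, h2, h3⟩ := iterate_newton (a := a) (b := b) (ρ := ρ) st n
  rw [Function.iterate_succ_apply', newton, h2, h3, inv_inv_of_posDef hX]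

/-- A step changes w by −H⁻¹r and therefore H(w − u) by −r. This updates the dual vector in O(d)
operations, although H itself is never stored. -/
theorem iterate_newton_p (st : BaronsState d) (hX : st.X.PosDef)
    (hp : st.p = matVec st.X⁻¹ (st.w - st.u)) (n : ℕ) :
    ((newton a b ρ)^[n] st).p = matVec st.X⁻¹ (((newton a b ρ)^[n] st).w - st.u) := by
  induction n with
  | zero => exact hp
  | succ n ih =>
    obtain ⟨-, h2, h3⟩ := iterate_newton (a := a) (b := b) (ρ := ρ) st n
    rw [Function.iterate_succ_apply', newton, ih, h2, h3]
    simp only [matVec_sub]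
    rw [show ∀ v, matVec st.X⁻¹ (matVec st.X v) = v from hX.matVec_inv_matVec]
    abel

variable {st : BaronsState d} {g : EuclideanSpace ℝ (Fin d)}

theorem advance_u (n : ℕ) : (st.advance a b ρ η n g).u = st.u := (iterate_newton _ n).1

theorem advance_s (n : ℕ) : (st.advance a b ρ η n g).s = st.s + η • g := (iterate_newton _ n).2.1

theorem advance_X (n : ℕ) : (st.advance a b ρ η n g).X = st.X := (iterate_newton _ n).2.2

theorem Inv.advance_p (inv : st.Inv a b ρ ε) (n : ℕ) :
    (st.advance a b ρ η n g).p = matVec st.X⁻¹ ((st.advance a b ρ η n g).w - st.u) :=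
  iterate_newton_p (st.observe η g) inv.posDef inv.dual n

/-- The test value is the squared distance, because p = H(w − u), and 1681 = 41²; no square root is
computed. -/
theorem Inv.keeps_advance_iff (inv : st.Inv a b ρ ε) (n : ℕ) :
    (st.advance a b ρ η n g).Keeps ↔
      matNorm st.X⁻¹ ((st.advance a b ρ η n g).w - st.u) ≤ 1 / 41 := by
  rw [Keeps, inv.advance_p, advance_u, matNorm_eq, Real.sqrt_le_left (by norm_num), quad]
  norm_num

theorem Inv.advance (inv : st.Inv a b ρ ε) (hp : BaronsParams ρ ε τ N)
    (hg : ‖η • g‖ / √ρ ≤ τ) :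
    matNorm st.X⁻¹ ((st.advance a b ρ η (N - 1) g).w - st.u) ≤ 0.03 ∧
    matNorm (barrierHess a b ρ (st.advance a b ρ η (N - 1) g).w)⁻¹
      (barrierGrad a b ρ (st.advance a b ρ η (N - 1) g).w + (st.s + η • g)) ≤ 2 * ε ∧
    matNorm st.X⁻¹ ((st.advance a b ρ η (N - 1) g).w - st.w) ≤ 5 * (ε + τ) := by
  refine inv.barons.newton hp (by rwa [add_sub_cancel_left])
    (y := fun k => ((newton a b ρ)^[k] (st.observe η g)).w)
    (h := fun k => barrierGrad a b ρ ((newton a b ρ)^[k] (st.observe η g)).w) rfl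
    (fun k _ _ => ?_) (fun k _ => iterate_newton_w (st.observe η g) inv.posDef k)
  rw [sub_self, matNorm_zero]
  exact hp.eps_pos.le

/-- As w is still within 0.03 of the old reference point, the old inverse has relative error at most
0.1 at w. Two squarings give 10⁻⁴, below the required 0.0005. -/
theorem renew_hessAnswer (inv : st.Inv a b ρ ε) (hρ : 0 < ρ) {w : EuclideanSpace ℝ (Fin d)}
    (hw : matNorm st.X⁻¹ (w - st.u) ≤ 0.03) :
    (schulzStep (barrierHess a b ρ w) (schulzStep (barrierHess a b ρ w) st.X)).PosDef ∧
      IsHessAnswer (regBarrier a b ρ) 0.001 w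
        (schulzStep (barrierHess a b ρ w) (schulzStep (barrierHess a b ρ w) st.X))⁻¹ := by
  have hpos := slack_pos_of_near hρ inv.barons.u_pos inv.barons.hess hw
  have hpd := barrierHess_posDef hρ hpos
  have h0 : ∀ v, |quad ((barrierHess a b ρ w)⁻¹ - st.X) v| ≤
      0.1 * quad (barrierHess a b ρ w)⁻¹ v := by
    intro v
    have h1 := inv_le_inv_hess hρ inv.barons.u_pos inv.barons.hess hw v
    have h2 := inv_hess_le_inv hρ inv.barons.u_pos inv.barons.hess hw v
    rw [inv_inv_of_posDef inv.posDef] at h1 h2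
    rw [quad_sub, abs_le]
    constructor <;> linarith
  obtain ⟨e1, h1⟩ := newtonSchulz hpd inv.posDef.1 h0
  obtain ⟨e2, h2⟩ := newtonSchulz hpd e1 h1
  refine isHessAnswer_inv hρ hpos e2 fun v => (h2 v).trans ?_
  have := hpd.inv.posSemidef.quad_nonneg v
  gcongr
  norm_num

theorem Inv.next (inv : st.Inv a b ρ ε) (hp : BaronsParams ρ ε τ N)
    (hg : ‖η • g‖ / √ρ ≤ τ) : (st.next a b ρ η (N - 1) g).Inv a b ρ ε := by
  obtain ⟨h1, h2, -⟩ := inv.advance hp hg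
  rw [BaronsState.next]
  split_ifs with h
  · rw [inv.keeps_advance_iff] at h
    refine ⟨?_, ?_, ?_⟩
    · rw [advance_X]; exact inv.posDef
    · rw [advance_X, inv.advance_p, advance_u]
    · rw [advance_X, advance_u, advance_s]
      exact inv.barons.keep h h2
  · obtain ⟨e1, e2⟩ := renew_hessAnswer inv hp.rho_pos h1
    have hpos := slack_pos_of_near hp.rho_pos inv.barons.u_pos inv.barons.hess h1
    rw [renew, advance_X, advance_s]
    refine ⟨e1, ?_, ?_⟩
    · rw [sub_self, matVec_zero]
    · exact .renew hp.rho_pos hpos e2 h2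

theorem inv_initial (hp : BaronsParams ρ ε τ N) {wstar : EuclideanSpace ℝ (Fin d)}
    (hpos : ∀ i, 0 < slack a b wstar i) (hgrad : barrierGrad a b ρ wstar = 0) :
    IsHessAnswer (regBarrier a b ρ) 0.001 wstar (initial a b ρ wstar).X⁻¹ ∧
      (initial a b ρ wstar).Inv a b ρ ε := by
  have hpd := barrierHess_posDef hp.rho_pos hpos
  obtain ⟨e1, e2⟩ := isHessAnswer_inv hp.rho_pos hpos hpd.inv.1 fun v => by
    rw [sub_self, quad]
    have := hpd.inv.posSemidef.quad_nonneg v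
    simp [matVec]
    linarith
  refine ⟨e2, e1, ?_, .renew hp.rho_pos hpos e2 ?_⟩
  · rw [initial, sub_self, matVec_zero]
  · change matNorm _ (barrierGrad a b ρ wstar + 0) ≤ _
    rw [hgrad, add_zero, matNorm_zero]
    have := hp.eps_pos
    positivity

/-! ### Whole executions and the number of renewals -/

section States

variable {wstar : EuclideanSpace ℝ (Fin d)} {g : ℕ → EuclideanSpace ℝ (Fin d)} {T : ℕ}

theorem inv_states (hp : BaronsParams ρ ε τ N) (hpos : ∀ i, 0 < slack a b wstar i)
    (hgrad : barrierGrad a b ρ wstar = 0) (hg : ∀ t < T, ‖η • g t‖ / √ρ ≤ τ) :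
    ∀ t ≤ T, (states a b ρ η (N - 1) wstar g t).Inv a b ρ ε := by
  intro t
  induction t with
  | zero => exact fun _ => (inv_initial hp hpos hgrad).2
  | succ t ih => exact fun ht => (ih (Nat.le_of_lt ht)).next hp (hg t ht)

/-- The states of the algorithm form an execution of BARONS. -/
theorem exists_run (ha : ∀ i, a i ≠ 0) (hp : BaronsParams ρ ε τ N)
    (hpos : ∀ i, 0 < slack a b wstar i)
    (hgrad : barrierGrad a b ρ wstar = 0) (hg : ∀ t < T, ‖η • g t‖ / √ρ ≤ τ) :
    ∃ run : BaronsRun (polytope a b) (regBarrier a b ρ) 1 η ε 0.001 N T wstar g,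
      ∀ t, run.w t = (states a b ρ η (N - 1) wstar g t).w := by
  have hint := interior_polytope (b := b) ha
  have inv := inv_states hp hpos hgrad hg
  set S := states a b ρ η (N - 1) wstar g with hS
  have hsucc : ∀ t, S (t + 1) = (S t).next a b ρ η (N - 1) (g t) := fun t => rfl
  have hw : ∀ t, (S (t + 1)).w = ((S t).advance a b ρ η (N - 1) (g t)).w := by
    intro t
    rw [hsucc, next]
    split_ifs <;> rfl
  have hs : ∀ t, (S (t + 1)).s = (S t).s + η • g t := by
    intro t
    rw [hsucc, next]
    split_ifs
    · exact advance_s _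
    · exact advance_s _
  refine ⟨{
    w := fun t => (S t).w
    u := fun t => (S t).u
    s := fun t => (S t).s
    H := fun t => (S t).X⁻¹
    y := fun t k => ((newton a b ρ)^[k] ((S t).observe η (g t))).w
    h := fun t k => barrierGrad a b ρ ((newton a b ρ)^[k] ((S t).observe η (g t))).w
    w_zero := rfl
    u_zero := rfl
    s_zero := rfl
    H_zero := fun _ => (inv_initial hp hpos hgrad).1
    s_succ := fun t _ => hs t
    y_zero := fun t _ => rfl
    h_spec := fun t ht k hk hy => by
      rw [hint] at hy
      rw [IsGradAnswer, gradient_regBarrier fun i => (hy i).ne', sub_self, matNorm_zero]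
      exact hp.eps_pos.le
    y_succ := fun t ht k hk => by
      rw [hs]
      exact iterate_newton_w ((S t).observe η (g t)) (inv t ht.le).posDef k
    w_succ := fun t _ => hw t
    keep := fun t ht hk => by
      rw [mul_one, hw, ← (inv t ht.le).keeps_advance_iff] at hk
      rw [hsucc, next, if_pos hk]
      exact ⟨advance_u _, by rw [advance_X]⟩
    renew := fun t ht hk => by
      rw [mul_one, hw, ← (inv t ht.le).keeps_advance_iff] at hk
      rw [hsucc, next, if_neg hk]
      refine ⟨rfl, fun _ => ?_⟩
      rw [BaronsState.renew, advance_X]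
      exact (renew_hessAnswer (inv t ht.le) hp.rho_pos
        ((inv t ht.le).advance hp (hg t ht)).1).2 }, fun t => rfl⟩

open scoped Classical in
/-- The number of renewals is controlled by the distance travelled. -/
theorem renewals_le (hp : BaronsParams ρ ε τ N)
    (hpos : ∀ i, 0 < slack a b wstar i)
    (hgrad : barrierGrad a b ρ wstar = 0) (hg : ∀ t < T, ‖η • g t‖ / √ρ ≤ τ) :
    (∑ t ∈ Finset.range T, if ((states a b ρ η (N - 1) wstar g t).advance a b ρ η (N - 1)
        (g t)).Keeps then (0 : ℝ) else 1) ≤ 205 * (T * (ε + τ)) := by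
  have inv := inv_states hp hpos hgrad hg
  set S := states a b ρ η (N - 1) wstar g with hS
  have hsucc : ∀ t, S (t + 1) = (S t).next a b ρ η (N - 1) (g t) := fun t => rfl
  -- Amortization with potential 41 times the distance to the reference point. A round raises it by
  -- at most 41·5(ε + τ) = 205(ε + τ); a renewal resets a value above 1 to zero, which pays for the
  -- count.
  have key : ∀ t ≤ T, (∑ t ∈ Finset.range t, if ((S t).advance a b ρ η (N - 1) (g t)).Keeps
      then (0 : ℝ) else 1) + 41 * matNorm (S t).X⁻¹ ((S t).w - (S t).u) ≤
        205 * (t * (ε + τ)) := by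
    intro t
    induction t with
    | zero =>
      intro _
      have : (S 0).w - (S 0).u = 0 := sub_self wstar
      simp [this, matNorm_zero]
    | succ t ih =>
      intro ht
      have ht' : t < T := ht
      have h0 := ih ht'.le
      have inv' := inv t ht'.le
      have h1 := (inv'.advance hp (hg t ht')).2.2
      have h2 := matNorm_add_le inv'.barons.hess.1.posSemidef
        (((S t).advance a b ρ η (N - 1) (g t)).w - (S t).w) ((S t).w - (S t).u)
      rw [sub_add_sub_cancel] at h2
      rw [Finset.sum_range_succ, hsucc, next]
      push_cast
      by_cases h : ((S t).advance a b ρ η (N - 1) (g t)).Keeps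
      · rw [if_pos h, if_pos h, advance_X, advance_u]
        linarith
      · rw [if_neg h, if_neg h]
        rw [inv'.keeps_advance_iff, not_le] at h
        rw [renew]
        simp only [sub_self, matNorm_zero]
        linarith
  have h := key T le_rfl
  have := matNorm_nonneg (S T).X⁻¹ ((S T).w - (S T).u)
  linarith

end States

end BaronsState

end Execution

/-! ### The cost of the algorithm -/

section Cost

variable {d m : ℕ} {R G : ℝ} {T N : ℕ}

/-- The total distance travelled, in terms of the number of rounds. -/
theorem rounds_mul_le (hm : 0 < m) (hR : 0 < R) (hG : 0 < G) (hT : (400000000 : ℝ) ≤ T) :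
    T * (gradTol m T + stepSize m R G T * (R * G / √(m : ℝ))) ≤
      2 * (√(m * T) * (1 + Real.log T)) := by
  have hm' : (0 : ℝ) < m := by exact_mod_cast hm
  have hT' : (0 : ℝ) < T := by linarith
  have hL := one_le_log hT
  have h1 : T * gradTol m T = √((m : ℝ) * T) := by
    rw [gradTol, eq_comm, Real.sqrt_eq_iff_mul_self_eq (by positivity) (by positivity)]
    rw [mul_mul_mul_comm, Real.mul_self_sqrt (by positivity)]
    field_simp
  have h2 : √((m : ℝ) * ((Real.log T + 1) / T)) = gradTol m T * √(Real.log T + 1) := by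
    rw [gradTol, ← Real.sqrt_mul (by positivity)]
    congr 1
    ring
  have h3 : √(Real.log T + 1) ≤ 1 + Real.log T := by
    rw [Real.sqrt_le_left (by positivity)]
    nlinarith
  rw [tau_eq hm hR hG, h2]
  have h4 : 0 ≤ √((m : ℝ) * T) := Real.sqrt_nonneg _
  calc (T : ℝ) * (gradTol m T + gradTol m T * √(Real.log T + 1))
      = T * gradTol m T * (1 + √(Real.log T + 1)) := by ring
    _ = √((m : ℝ) * T) * (1 + √(Real.log T + 1)) := by rw [h1]
    _ ≤ √((m : ℝ) * T) * (2 * (1 + Real.log T)) := by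
        gcongr
        linarith
    _ = _ := by ring

/-- Here log(1/ε) is the logarithm of √(T/m), which lies between 1 and T. The absolute value appears
because the sign of c is arbitrary. -/
theorem steps_le (hm : 0 < m) (hT : 400000000 * (m : ℝ) ≤ T) {c : ℝ}
    (h : (N : ℝ) ≤ c * Real.log (1 / gradTol m T)) : (N : ℝ) ≤ |c| * Real.log T := by
  have hm' : (1 : ℝ) ≤ m := by exact_mod_cast hm
  have hT' : (0 : ℝ) < T := by linarith
  have h1 : 1 / gradTol m T = √((T : ℝ) / m) := by
    rw [gradTol, one_div, ← Real.sqrt_inv, inv_div]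
  have h2 : (1 : ℝ) ≤ √((T : ℝ) / m) := by
    rw [Real.one_le_sqrt, one_le_div (by linarith)]
    linarith
  have h3 : √((T : ℝ) / m) ≤ T := by
    rw [Real.sqrt_le_left hT'.le, div_le_iff₀ (by linarith)]
    nlinarith
  have h4 : Real.log √((T : ℝ) / m) ≤ Real.log T := Real.log_le_log (by linarith) h3
  rw [h1] at h
  calc (N : ℝ) ≤ c * Real.log √((T : ℝ) / m) := h
    _ ≤ |c| * Real.log √((T : ℝ) / m) := by
        have := Real.log_nonneg h2
        gcongr
        exact le_abs_self c
    _ ≤ _ := by gcongr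

theorem cost_combination {c K L l D W S T : ℝ} (hc : 0 ≤ c) (hK : 0 ≤ K) (hL : 0 ≤ L)
    (hl : 0 ≤ l) (hD : 0 ≤ D) (hW : 0 ≤ W) (hS : 0 ≤ S) (hST : S ≤ T) :
    30 * (D * T) + (T * ((8 + 20 * (c * L)) * D) + 410 * (S * (1 + L)) * (20 * D + 6 * K * W)) ≤
      (9000 + 20 * c + 2460 * K) * (1 + L + l) * (D * T + W * S) := by
  have hT : 0 ≤ T := hS.trans hST
  have h1 : D * S ≤ D * T := by gcongr
  have h2 : (38 + 20 * c * L) + 8200 * (1 + L) ≤ (9000 + 20 * c + 2460 * K) * (1 + L) := by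
    have := mul_nonneg hc hL
    have := mul_nonneg hK hL
    linarith
  calc _ = (38 + 20 * c * L) * (D * T) + 8200 * (1 + L) * (D * S) +
        2460 * K * (1 + L) * (W * S) := by ring
    _ ≤ (38 + 20 * c * L) * (D * T) + 8200 * (1 + L) * (D * T) +
        (9000 + 20 * c + 2460 * K) * (1 + L) * (W * S) := by
        gcongr
        linarith
    _ = ((38 + 20 * c * L) + 8200 * (1 + L)) * (D * T) +
        (9000 + 20 * c + 2460 * K) * (1 + L) * (W * S) := by ring
    _ ≤ (9000 + 20 * c + 2460 * K) * (1 + L) * (D * T) +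
        (9000 + 20 * c + 2460 * K) * (1 + L) * (W * S) := by gcongr
    _ = (9000 + 20 * c + 2460 * K) * (1 + L) * (D * T + W * S) := by ring
    _ ≤ _ := by
        have h3 : 1 + L ≤ 1 + L + l := by linarith
        exact mul_le_mul_of_nonneg_right (mul_le_mul_of_nonneg_left h3 (by positivity))
          (by positivity)

/-- From d ≤ m ≤ T the initialization cost of order m·d² is at most of order m·d·T, and m/d + 5 ≤
6m/d. The part of a renewal linear in md + d² is absorbed as well, since √(mT) ≤ T. -/
theorem total_le (hd : 0 < d) (hdm : d ≤ m) (hT : 400000000 * (m : ℝ) ≤ T) {M : ℕ} {K ω c r : ℝ}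
    (hM : (M : ℝ) ≤ K * (d : ℝ) ^ ω) (hK : 0 < K) (hN : (N : ℝ) ≤ |c| * Real.log T)
    (hr : r ≤ 410 * (√(m * T) * (1 + Real.log T))) :
    ((m * (2 * d + 4) + d * d * 3 + m * (20 * (d * d)) + 1 : ℕ) : ℝ) +
      (T * ((d * 2 + (N - 1) * (20 * (m * d + d * d)) + (1 + d * 3 + 2) : ℕ) : ℝ) +
        r * ((20 * (m * d + d * d) + (m / d + 5) * M : ℕ) : ℝ)) ≤
    (9000 + 20 * |c| + 2460 * K) * (1 + Real.log T + Real.log d) ^ 1 *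
      ((m * d + (d : ℝ) ^ 2) * T + m * (d : ℝ) ^ (ω - 1) * √(m * T)) := by
  have hd1 : (1 : ℝ) ≤ d := by exact_mod_cast hd
  have hdm' : (d : ℝ) ≤ m := by exact_mod_cast hdm
  have hT1 : (400000000 : ℝ) ≤ T := by linarith
  have hL := one_le_log hT1
  have hlogd := Real.log_nonneg hd1
  have hN1 : ((N - 1 : ℕ) : ℝ) ≤ N := by exact_mod_cast Nat.sub_le N 1
  have hdiv : ((m / d : ℕ) : ℝ) ≤ (m : ℝ) / d := Nat.cast_div_le
  set L := Real.log T with hLdef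
  set D : ℝ := m * d + (d : ℝ) ^ 2 with hD
  set S := √((m : ℝ) * T) with hS
  set W : ℝ := m * (d : ℝ) ^ (ω - 1) with hW
  have hW0 : 0 ≤ W := by positivity
  have hS0 : 0 ≤ S := Real.sqrt_nonneg _
  have hST : S ≤ T := by
    rw [hS, Real.sqrt_le_left (by linarith)]; nlinarith
  have hmd : (m : ℝ) ≤ m * d := le_mul_of_one_le_right (by linarith) hd1
  have hdd : (d : ℝ) ≤ d ^ 2 := by nlinarith
  have hD1 : 1 ≤ D := by nlinarith
  have hDT : D ≤ D * T := le_mul_of_one_le_right (by linarith) (by linarith)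
  have hmT : (m : ℝ) * (d * d) ≤ D * T := by
    have h1 : (m : ℝ) * (d * d) = (m * d) * d := by ring
    have h2 : (d : ℝ) ≤ T := by linarith
    have h3 : (m : ℝ) * d ≤ D := by rw [hD]; nlinarith
    rw [h1]; gcongr
  have hinit : ((m * (2 * d + 4) + d * d * 3 + m * (20 * (d * d)) + 1 : ℕ) : ℝ) ≤
      30 * (D * T) := by
    push_cast
    have : (m : ℝ) * (2 * d + 4) + d * d * 3 ≤ 6 * D := by rw [hD]; nlinarith
    linarith
  have hround : ((d * 2 + (N - 1) * (20 * (m * d + d * d)) + (1 + d * 3 + 2) : ℕ) : ℝ) ≤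
      (8 + 20 * (|c| * L)) * D := by
    push_cast
    have h1 : (m : ℝ) * d + d * d = D := by rw [hD]; ring
    have h2 : ((N - 1 : ℕ) : ℝ) * (20 * D) ≤ |c| * L * (20 * D) := by
      gcongr
      exact hN1.trans hN
    have h3 : (d : ℝ) ≤ D := by rw [hD]; nlinarith
    rw [h1]
    linarith
  have hrenew : ((20 * (m * d + d * d) + (m / d + 5) * M : ℕ) : ℝ) ≤ 20 * D + 6 * K * W := by
    push_cast
    have h1 : (m : ℝ) * d + d * d = D := by rw [hD]; ring
    have h5 : (1 : ℝ) ≤ m / d := by rw [one_le_div (by linarith)]; exact hdm'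
    have h2 : (((m / d : ℕ) : ℝ) + 5) * M ≤ (6 * (m / d)) * (K * (d : ℝ) ^ ω) := by
      gcongr
      linarith
    have h3 : (6 * ((m : ℝ) / d)) * (K * (d : ℝ) ^ ω) = 6 * K * W := by
      rw [hW, Real.rpow_sub_one (by positivity)]
      ring
    rw [h1]
    linarith
  refine (add_le_add hinit (add_le_add (mul_le_mul_of_nonneg_left hround (by linarith))
    (mul_le_mul hr hrenew (by positivity) (by positivity)))).trans ?_
  refine (cost_combination (abs_nonneg c) hK.le (by linarith) hlogd (by linarith) hW0 hS0
    hST).trans (le_of_eq ?_)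
  rw [pow_one]

end Cost

/-- An online algorithm that carries out BARONS within the claimed number of steps. -/
theorem exists_barons_algorithm {ω : ℝ} (hω : IsMatMulExponent ω) (c : ℝ) :
    ∃ C > (0 : ℝ), ∀ (d m N : ℕ), 0 < d → 1 ≤ N → ∃ P : OnlineAlg d m,
      ∀ (a : Fin m → EuclideanSpace ℝ (Fin d)) (b : Fin m → ℝ)
        (R G : ℝ) (T : ℕ) (wstar : EuclideanSpace ℝ (Fin d))
        (g : ℕ → EuclideanSpace ℝ (Fin d)),
        0 < R → 0 < G → 1 ≤ T → (∀ i, a i ≠ 0) →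
        polytope a b ⊆ Metric.closedBall 0 R →
        wstar ∈ interior (polytope a b) →
        IsMinOn (regBarrier a b (m / R ^ 2)) (interior (polytope a b)) wstar →
        stepSize m R G T * (R * G / √(m : ℝ)) ≤ 1 / 1000 →
        gradTol m T ≤ 1 / 20000 →
        1 * Real.log (1 / gradTol m T) ≤ N →
        N ≤ c * Real.log (1 / gradTol m T) →
        (∀ t < T, ‖g t‖ ≤ G) →
        (∃ run : BaronsRun (polytope a b) (regBarrier a b (m / R ^ 2)) 1
            (stepSize m R G T) (gradTol m T) 0.001 N T wstar g,
          ∀ t ≤ T, run.w t = P.iterate (inputVal a b wstar R (stepSize m R G T)) g t) ∧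
        (P.totalCost (inputVal a b wstar R (stepSize m R G T)) g T : ℝ) ≤
          C * (1 + Real.log T + Real.log d) ^ 1 *
            ((m * d + (d : ℝ) ^ 2) * T + m * (d : ℝ) ^ (ω - 1) * √(m * T)) := by
  classical
  obtain ⟨K, hK, hM⟩ := hω.exists_computes
  refine ⟨9000 + 20 * |c| + 2460 * K, by positivity, fun d m N hd hN => ?_⟩
  obtain ⟨M, hMle, hMc⟩ := hM d hd
  obtain ⟨P, hP⟩ := exists_onlineAlg (m := m) hd hMc (N - 1)
  refine ⟨P, fun a b R G T wstar g hR hG hT ha hpoly hw hmin hτ hε hlog hNc hg => ?_⟩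
  have hdm := dim_le_card hpoly (interior_subset hw)
  have hm : 0 < m := by omega
  have hTm := card_le_rounds hT hε
  have hTbig : (400000000 : ℝ) ≤ T := by
    have : (1 : ℝ) ≤ m := by exact_mod_cast hm
    linarith
  have hp := baronsParams hm hR hG hT hN hτ hε hlog
  have hgτ : ∀ t < T, ‖stepSize m R G T • g t‖ / √((m : ℝ) / R ^ 2) ≤
      stepSize m R G T * (R * G / √(m : ℝ)) := fun t ht => norm_step_le hm hR hG (hg t ht)
  have hgrad := barrierGrad_eq_zero_of_isMinOn ha hw hmin
  have hpos : ∀ i, 0 < slack a b wstar i := by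
    rw [interior_polytope ha] at hw
    exact hw
  obtain ⟨hiter, hcost⟩ := hP a b R (stepSize m R G T) wstar g hm hR
  constructor
  · obtain ⟨run, hrun⟩ := BaronsState.exists_run ha hp hpos hgrad hgτ
    exact ⟨run, fun t _ => (hrun t).trans (hiter t).symm⟩
  · have hr := BaronsState.renewals_le hp hpos hgrad hgτ
    have h1 := rounds_mul_le hm hR hG hTbig
    refine le_trans ?_ (total_le hd hdm hTm hMle hK (steps_le hm hTm hNc)
      (hr.trans (by linarith)))
    refine (Nat.cast_le.2 (hcost T)).trans (le_of_eq ?_)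
    rw [Nat.cast_add, Nat.cast_sum, Finset.sum_mul]
    congr 1
    simp only [Nat.cast_add _ (ite _ _ _), Finset.sum_add_distrib]
    rw [Finset.sum_const, Finset.card_range, nsmul_eq_mul]
    congr 1
    refine Finset.sum_congr rfl fun t _ => ?_
    split_ifs <;> simp

theorem corollary2 :
    -- The logarithmic barrier of a polytope with `m` constraints is `(1, m)`-self-concordant.
    (∀ (d m : ℕ) (a : Fin m → EuclideanSpace ℝ (Fin d)) (b : Fin m → ℝ) (R : ℝ),
      0 < d → (∀ i, a i ≠ 0) → polytope a b ⊆ Metric.closedBall 0 R →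
      (interior (polytope a b)).Nonempty →
      IsSelfConcordantBarrier (polytope a b) (logBarrier a b) 1 m) ∧
    ∃ c₀ > (0 : ℝ),
      -- Feasibility and regret of every execution of BARONS.
      (∃ C > (0 : ℝ), ∀ (d m : ℕ) (a : Fin m → EuclideanSpace ℝ (Fin d)) (b : Fin m → ℝ)
        (R G : ℝ) (T mN : ℕ) (wstar : EuclideanSpace ℝ (Fin d))
        (g : ℕ → EuclideanSpace ℝ (Fin d)) (ℓ : ℕ → EuclideanSpace ℝ (Fin d) → ℝ),
        0 < d → 0 < R → 0 < G → 1 ≤ T → 1 ≤ mN → (∀ i, a i ≠ 0) →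
        polytope a b ⊆ Metric.closedBall 0 R →
        wstar ∈ interior (polytope a b) →
        IsMinOn (hybrid (logBarrier a b) m R) (interior (polytope a b)) wstar →
        stepSize m R G T * (R * G / √(m : ℝ)) ≤ 1 / 1000 →
        gradTol m T ≤ 1 / 20000 →
        c₀ * Real.log (1 / gradTol m T) ≤ mN →
        ∀ run : BaronsRun (polytope a b) (hybrid (logBarrier a b) m R) 1
            (stepSize m R G T) (gradTol m T) 0.001 mN T wstar g,
          (∀ t < T, ConvexOn ℝ (polytope a b) (ℓ t)) →
          (∀ t < T, ‖g t‖ ≤ G) →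
          (∀ t < T, run.w t ∈ polytope a b →
            IsSubgradient (polytope a b) (ℓ t) (run.w t) (g t)) →
          (∀ t < T, run.w t ∈ interior (polytope a b)) ∧
          ∀ w ∈ interior (polytope a b),
            ∑ t ∈ Finset.range T, (ℓ t (run.w t) - ℓ t w) ≤
              C * (R * G * √(T * Real.log T))) ∧
      -- Computational cost of BARONS.
      (∀ ω : ℝ, IsMatMulExponent ω → ∀ c₁ : ℝ, ∃ C > (0 : ℝ), ∃ k : ℕ,
        ∀ (d m mN : ℕ), 0 < d → 1 ≤ mN → ∃ P : OnlineAlg d m,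
        ∀ (a : Fin m → EuclideanSpace ℝ (Fin d)) (b : Fin m → ℝ)
          (R G : ℝ) (T : ℕ) (wstar : EuclideanSpace ℝ (Fin d))
          (g : ℕ → EuclideanSpace ℝ (Fin d)),
          0 < R → 0 < G → 1 ≤ T → (∀ i, a i ≠ 0) →
          polytope a b ⊆ Metric.closedBall 0 R →
          wstar ∈ interior (polytope a b) →
          IsMinOn (hybrid (logBarrier a b) m R) (interior (polytope a b)) wstar →
          stepSize m R G T * (R * G / √(m : ℝ)) ≤ 1 / 1000 →
          gradTol m T ≤ 1 / 20000 →
          c₀ * Real.log (1 / gradTol m T) ≤ mN →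
          mN ≤ c₁ * Real.log (1 / gradTol m T) →
          (∀ t < T, ‖g t‖ ≤ G) →
          (∃ run : BaronsRun (polytope a b) (hybrid (logBarrier a b) m R) 1
              (stepSize m R G T) (gradTol m T) 0.001 mN T wstar g,
            ∀ t ≤ T, run.w t = P.iterate (inputVal a b wstar R (stepSize m R G T)) g t) ∧
          (P.totalCost (inputVal a b wstar R (stepSize m R G T)) g T : ℝ) ≤
            C * (1 + Real.log T + Real.log d) ^ k *
              ((m * d + (d : ℝ) ^ 2) * T + m * (d : ℝ) ^ (ω - 1) * √(m * T))) := by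
  -- The same c₀ = 1 serves both parts. The regret constant 1000 covers 2·300 from the linear regret
  -- and 2 from moving the comparator.
  refine ⟨fun d m a b R _ ha hR _ => isSelfConcordantBarrier_logBarrier ha hR, 1, one_pos,
    ⟨1000, by norm_num, ?_⟩, fun ω hω c₁ => ?_⟩
  · intro d m a b R G T mN wstar g ℓ hd hR hG hT hN ha hpoly hw hmin hτ hε hlog run _ hg hsub
    exact barons_regret hd hR hG hT hN ha hpoly hw (hybrid_eq_regBarrier R) rfl rfl rfl hmin hτ hε
      hlog run hg hsub
  · obtain ⟨C, hC, h⟩ := exists_barons_algorithm hω c₁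
    refine ⟨C, hC, 1, fun d m mN hd hN => ?_⟩
    obtain ⟨P, hP⟩ := h d m mN hd hN
    refine ⟨P, fun a b R G T wstar g => ?_⟩
    rw [hybrid_eq_regBarrier]
    exact hP a b R G T wstar g
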